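/- **Setting.** Let $s>0$, $1\le p<\infty$, $1\le q\le\infty$, $L,T>0$, and let $N\ge 0$ be an integer with $s<N+1$. Write $g_{jk}(x)=2^{j/2}g(2^jx-k)$. Let $\varphi:\mathbb R\to\mathbb R$ be a father wavelet: its integer translates are orthonormal in $L^2(\mathbb R)$, and the closed spans $V_j$ of $\{\varphi_{jk}:k\in\mathbb Z\}$ satisfy $V_j\subset V_{j+1}$ for all $j\in\mathbb Z$ and have a dense union in $L^2(\mathbb R)$. Assume that $\varphi$ has a weak derivative $\varphi^{(N+1)}$ of order $N+1$ with $\operatorname{ess\,sup}_x\sum_{k\in\mathbb Z}|\varphi^{(N+1)}(x-k)|<\infty$, and that $|\varphi(u)|\le\Phi(|u|)$ for some bounded non-increasing $\Phi$ on $[0,\infty)$ with $\int\Phi(|u|)\,du<\infty$ and $\int\Phi(|u|)|u|^N\,du<\infty$. Let $\psi:\mathbb R\to\mathbb R$ be an associated mother wavelet, i.e. $\{\psi_{0k}:k\in\mathbb Z\}$ is an orthonormal basis of the orthogonal complement of $V_0$ in $V_1$. Assume that $\varphi$ and $\psi$ are supported in $[-A,A]$. Let $D^s_{pq}=D^s_{pq}(L,T)$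 be the set of probability densities $f$ with support in $[-T,T]$ such that $$\Big\|\Big(\int f\varphi_{0k}\Big)_{k\in\mathbb Z}\Big\|_{\ell^p}+\Big\|\Big(2^{j(s+1/2-1/p)}\Big\|\Big(\int f\psi_{jk}\Big)_{k\in\mathbb Z}\Big\|_{\ell^p}\Big)_{j\ge0}\Big\|_{\ell^q}\le L .$$ For $n\ge1$, $\alpha>0$ and an integer $j_1\ge0$, let $X_1,\dots,X_n$ have density $f$, let the $W_{ijk}$ have the Laplace density $\tfrac12e^{-|x|}$, and let all these variables be mutually independent. Put $\psi_{-1,k}=\varphi_{0k}$, $c_A=2\lceil A\rceil+1$, $\mathcal N_j=\{k\in\mathbb Z:|k|\le 2^{\max(j,0)}T+A\}$ (the $k$ for which the $k$-th coefficient at level $j$ of a function supported in $[-T,T]$ can be non-zero), and, for $-1\le j\le j_1$ and $k\in\mathcal N_j$, $$Z_{ijk}=\psi_{jk}(X_i)+\tau_jW_{ijk},\qquad \tau_{-1}=\frac{4c_A\|\varphi\|_\infty}{\alpha},\qquad \tau_j=\frac{4c_A\|\psi\|_\infty}{\alpha}\cdot\frac{\sqrt2}{\sqrt2-1}\cdot2^{j_1/2}\quad(0\le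 j\le j_1).$$ The linear wavelet estimator is $$\widehat f_{\mathrm{lin}}(x)=\sum_{j=-1}^{j_1}\sum_{k\in\mathcal N_j}\widehat\beta_{jk}\,\psi_{jk}(x),\qquad \widehat\beta_{jk}=\frac1n\sum_{i=1}^nZ_{ijk}.$$ **Proposition.** (i) For every $\kappa>0$ there is a constant $C>0$, depending only on $\kappa,\varphi,\psi,A,N,s,p,q,L,T$ (and not on $n,\alpha,j_1$), such that for all integers $n\ge1$, $j_1\ge0$ and all $\alpha>0$ for which at least one of $p\le2$, $2^{j_1}\le\kappa n$, $\alpha\le\kappa$ holds, $$\sup_{f\in D^s_{pq}}\mathbb E\|\widehat f_{\mathrm{lin}}-f\|_p^p\le C\Big(2^{-j_1ps}+\Big(\frac{2^{2j_1}}{n\alpha^2}\Big)^{p/2}+\Big(\frac{2^{j_1}}n\Big)^{p/2}\Big).$$ (ii) For all $c_1,c_2>0$ there is a constant $C>0$, depending only on $c_1,c_2,\varphi,\psi,A,N,s,p,q,L,T$, such that for all integers $n\ge1$, $j_1\ge0$ and all $\alpha>0$ with $$c_1\big((n\alpha^2)^{\frac1{2s+2}}\wedge n^{\frac1{2s+1}}\big)\le2^{j_1}\le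 c_2\big((n\alpha^2)^{\frac1{2s+2}}\wedge n^{\frac1{2s+1}}\big),$$ $$\sup_{f\in D^s_{pq}}\mathbb E\|\widehat f_{\mathrm{lin}}-f\|_p^p\le C\Big((n\alpha^2)^{-\frac{ps}{2s+2}}\vee n^{-\frac{ps}{2s+1}}\Big).$$ -/

import Mathlib

open MeasureTheory ProbabilityTheory Set
open scoped ENNReal

universe u

noncomputable section

namespace LDPWavelet

/-! ### Wavelet bases -/

/-- The dilated and translated function `g_{jk} = 2^{j/2} g(2^j · - k)`. -/
def dil (g : ℝ → ℝ) (j k : ℤ) (x : ℝ) : ℝ :=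
  (2 : ℝ) ^ ((j : ℝ) / 2) * g ((2 : ℝ) ^ j * x - k)

/-- The closed linear span in `L²(ℝ)` of the functions `g_{jk}`, `k ∈ ℤ`. -/
def spanSpace (g : ℝ → ℝ) (j : ℤ) : Submodule ℝ (Lp ℝ 2 (volume : Measure ℝ)) :=
  (Submodule.span ℝ {u : Lp ℝ 2 (volume : Measure ℝ) |
    ∃ k : ℤ, (u : ℝ → ℝ) =ᵐ[volume] dil g j k}).topologicalClosure

/-- The integer translates of `g` form an orthonormal system in `L²(ℝ)`. -/
structure OrthonormalTranslates (g : ℝ → ℝ) : Prop where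
  memLp : MemLp g 2 volume
  inner_eq : ∀ k l : ℤ, ∫ x, dil g 0 k x * dil g 0 l x = if k = l then 1 else 0

/-- `φ` is a father wavelet, that is, it generates a multiresolution analysis of `L²(ℝ)`:
its integer translates are orthonormal, and the spaces `V_j` spanned by the `φ_{jk}` increase
with `j` and have a dense union. (That the `V_j` have trivial intersection follows.) -/
structure GeneratesMRA (φ : ℝ → ℝ) : Prop where
  orthonormal : OrthonormalTranslates φ
  nested : ∀ j : ℤ, spanSpace φ j ≤ spanSpace φ (j + 1)
  dense : Dense (⋃ j : ℤ, (spanSpace φ j : Set (Lp ℝ 2 (volume : Measure ℝ))))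

/-- `ψ` is a mother wavelet associated to the father wavelet `φ`: its integer translates form an
orthonormal basis of the orthogonal complement of `V_0` in `V_1`. -/
structure IsMotherWavelet (φ ψ : ℝ → ℝ) : Prop where
  orthonormal : OrthonormalTranslates ψ
  span_eq : spanSpace ψ 0 = spanSpace φ 1 ⊓ (spanSpace φ 0)ᗮ

/-- `v` is the weak derivative of order `m` of `u` on the real line. -/
structure IsWeakDeriv (m : ℕ) (u v : ℝ → ℝ) : Prop where
  locInt_left : LocallyIntegrable u volume
  locInt_right : LocallyIntegrable v volume
  integral_eq : ∀ η : ℝ → ℝ, ContDiff ℝ ((⊤ : ℕ∞) : WithTop ℕ∞) η → HasCompactSupport η →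
    ∫ x, u x * iteratedDeriv m η x = (-1) ^ m * ∫ x, v x * η x

/-- The regularity assumption on the father wavelet `φ`, with the integer `N`. -/
structure FatherAssumption (φ : ℝ → ℝ) (N : ℕ) : Prop where
  mra : GeneratesMRA φ
  weakDeriv : ∃ v : ℝ → ℝ, IsWeakDeriv (N + 1) φ v ∧
    ∃ M : ℝ, ∀ᵐ x : ℝ, ∑' k : ℤ, ENNReal.ofReal |v (x - k)| ≤ ENNReal.ofReal M
  majorant : ∃ Φ : ℝ → ℝ, BddAbove (Φ '' Ici 0) ∧ AntitoneOn Φ (Ici 0) ∧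
    (∀ u, |φ u| ≤ Φ |u|) ∧ Integrable (fun u => Φ |u|) volume ∧
    Integrable (fun u => Φ |u| * |u| ^ N) volume

/-! ### Besov ellipsoids of densities -/

/-- The wavelet coefficient `∫ f g_{jk}`. -/
def coeff (f g : ℝ → ℝ) (j k : ℤ) : ℝ := ∫ x, f x * dil g j k x

/-- The Besov sequence norm `J_{spq}(f)`. The norms of `ℓ^p(ℤ)` and of `ℓ^q(ℕ)` are those of
`L^p` and `L^q` for the counting measure, with values in `[0, ∞]`; `q = ∞` is allowed. -/
def besovJ (φ ψ : ℝ → ℝ) (s p : ℝ) (q : ℝ≥0∞) (f : ℝ → ℝ) : ℝ≥0∞ :=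
  eLpNorm (fun k : ℤ => coeff f φ 0 k) (ENNReal.ofReal p) Measure.count +
  eLpNorm (fun j : ℕ => ENNReal.ofReal ((2 : ℝ) ^ ((j : ℝ) * (s + 1 / 2 - 1 / p))) *
      eLpNorm (fun k : ℤ => coeff f ψ j k) (ENNReal.ofReal p) Measure.count) q Measure.count

/-- The class `D^s_{pq}(L, T)` of probability densities in the Besov ellipsoid of radius `L` with
support in `[-T, T]`. -/
structure MemDensityClass (φ ψ : ℝ → ℝ) (s p : ℝ) (q : ℝ≥0∞) (L T : ℝ) (f : ℝ → ℝ) : Prop where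
  besov : besovJ φ ψ s p q f ≤ ENNReal.ofReal L
  nonneg : ∀ x, 0 ≤ f x
  integrable : Integrable f volume
  integral_eq_one : ∫ x, f x = 1
  support_subset : Function.support f ⊆ Icc (-T) T

/-! ### The privacy mechanism and the linear estimator -/

/-- The centred Laplace distribution with parameter `1`. -/
def laplaceOne : Measure ℝ :=
  volume.withDensity fun x => ENNReal.ofReal (Real.exp (-|x|) / 2)

/-- The basis functions `ψ_{jk}` for `j ≥ 0`, with the convention `ψ_{-1,k} = φ_{0k}`. -/
def basisFun (φ ψ : ℝ → ℝ) (j k : ℤ) : ℝ → ℝ :=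
  if j = -1 then dil φ 0 k else dil ψ j k

/-- The finite set `N_j` of the `k` for which the coefficient with index `(j, k)` of a function
supported in `[-T, T]` may be non-zero, for wavelets supported in `[-A, A]`: those for which
`2^{-j} [k - A, k + A]` meets `[-T, T]`, i.e. `|k| ≤ 2^j T + A`. The index `j = -1` stands for the
functions `φ_{0k}`, which have the scale `2^0`. -/
def translations (A T : ℝ) (j : ℤ) : Finset ℤ :=
  Finset.Icc (-⌊(2 : ℝ) ^ (max j 0) * T + A⌋) ⌊(2 : ℝ) ^ (max j 0) * T + A⌋

/-- The pairs `(j, k)` with `-1 ≤ j ≤ j₁` and `k ∈ N_j`. -/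
def indexSet (A T : ℝ) (j₁ : ℕ) : Set (ℤ × ℤ) :=
  {t | t.1 ∈ Finset.Icc (-1 : ℤ) j₁ ∧ t.2 ∈ translations A T t.1}

/-- The norm of `L^∞(ℝ)`. -/
def supNorm (g : ℝ → ℝ) : ℝ := (eLpNorm g ∞ volume).toReal

/-- The noise levels: `σ_{-1}` for `j = -1` (with `j₀ = 0`) and `σ̃_j` for `0 ≤ j ≤ j₁`. -/
def noiseLevel (φ ψ : ℝ → ℝ) (A α : ℝ) (j₁ : ℕ) (j : ℤ) : ℝ :=
  if j = -1 then 4 * (2 * (⌈A⌉ : ℝ) + 1) * supNorm φ / α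
  else 4 * (2 * (⌈A⌉ : ℝ) + 1) * supNorm ψ / α * (√2 / (√2 - 1)) * (2 : ℝ) ^ ((j₁ : ℝ) / 2)

/-- The private views `Z_{ijk}`, as functions of the observation `x = X_i` and of the noise
`w = W_{ijk}`. -/
def privateView (φ ψ : ℝ → ℝ) (A α : ℝ) (j₁ : ℕ) (j k : ℤ) (x w : ℝ) : ℝ :=
  basisFun φ ψ j k x + noiseLevel φ ψ A α j₁ j * w

/-- The linear wavelet estimator computed from private views `Z_{ijk}`. -/
def linEstimator (φ ψ : ℝ → ℝ) (A T : ℝ) (j₁ n : ℕ) (Z : Fin n → ℤ → ℤ → ℝ) (x : ℝ) : ℝ :=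
  ∑ j ∈ Finset.Icc (-1 : ℤ) j₁, ∑ k ∈ translations A T j,
    ((1 / (n : ℝ)) * ∑ i, Z i j k) * basisFun φ ψ j k x

/-- The `X_i` have the density `f`, the `W_{ijk}` with `(j, k) ∈ I` are Laplace distributed with
parameter `1`, and all these random variables are mutually independent. -/
structure IsSample {Ω : Type*} [MeasurableSpace Ω] (P : Measure Ω) (f : ℝ → ℝ) (n : ℕ)
    (I : Set (ℤ × ℤ)) (X : Fin n → Ω → ℝ) (W : Fin n → ℤ → ℤ → Ω → ℝ) : Prop where
  law_X : ∀ i, HasLaw (X i) (volume.withDensity fun x => ENNReal.ofReal (f x)) P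
  law_W : ∀ i, ∀ t ∈ I, HasLaw (W i t.1 t.2) laplaceOne P
  indep : iIndepFun (β := fun _ : Fin n ⊕ (Fin n × I) => ℝ)
    (Sum.elim X fun t => W t.1 t.2.1.1 t.2.1.2) P

/-- The risk `E ‖f̂_lin - f‖_p^p`, with values in `[0, ∞]`, of the linear estimator built from the
private views of the `X_i` with the noise variables `W_{ijk}`. -/
def linRisk {Ω : Type*} [MeasurableSpace Ω] (P : Measure Ω) (φ ψ : ℝ → ℝ) (A T α p : ℝ)
    (j₁ n : ℕ) (f : ℝ → ℝ) (X : Fin n → Ω → ℝ) (W : Fin n → ℤ → ℤ → Ω → ℝ) : ℝ≥0∞ :=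
  ∫⁻ ω, eLpNorm (fun x => linEstimator φ ψ A T j₁ n
    (fun i j k => privateView φ ψ A α j₁ j k (X i ω) (W i j k ω)) x - f x)
    (ENNReal.ofReal p) volume ^ p ∂P

/-- `sup_f E ‖f̂_lin - f‖_p^p ≤ B`, the supremum being over the densities `f` in
`D^s_{pq}(L, T)`; the sample may be realised on any probability space. -/
def SupRiskLE (φ ψ : ℝ → ℝ) (A s p : ℝ) (q : ℝ≥0∞) (L T : ℝ) (n : ℕ) (α : ℝ) (j₁ : ℕ)
    (B : ℝ) : Prop :=
  ∀ f : ℝ → ℝ, MemDensityClass φ ψ s p q L T f →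
    ∀ (Ω : Type u) [MeasurableSpace Ω] (P : Measure Ω) [IsProbabilityMeasure P]
      (X : Fin n → Ω → ℝ) (W : Fin n → ℤ → ℤ → Ω → ℝ),
      IsSample P f n (indexSet A T j₁) X W →
        linRisk P φ ψ A T α p j₁ n f X W ≤ ENNReal.ofReal B

end LDPWavelet

end

namespace LDPWavelet

/-! ### Moment inequalities for sums of independent variables -/

/-! The error `f̂ - f` is the sum over the levels of the expansions of the coefficient errors, minus
the bias `f - P f`, where `P` is the projection onto the space `V_{j₁+1}`. Minkowski's inequality in
`L^p(ℝ)` for fixed `ω`, then in `L^p(P)`, reduces the risk to the bias and one stochastic term per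
level.

Bias. In `L²` the mother wavelet spans the orthogonal complement of `V_0` in `V_1`, so consecutive
projections differ by the `ψ`-expansion at one level; dilation carries this to every level. A
density is only known to be integrable, so the identity is proved for the truncations `min f m` and
passed to the limit (`proj_succ_ae_eq`). The projections of `f` converge to `f` in `L¹`
(`tendsto_eLpNorm_one_proj`). Since the synthesis map is bounded from `ℓ^p` to `L^p`
(`IsAtom.eLpNorm_sum_dil_le`), the Besov condition makes the level `j` term of order `2^{-js}`; a
geometric series and a Fatou argument give the bias `2^{-j₁s}` (`eLpNorm_sub_proj_le`), and also a
bound for the `L^p` norms of all densities of the class.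

Stochastic error. Each coefficient error is a sum of `2n` independent centred variables: `n` from
the observations and `n` from the Laplace noise. Its moment of order `p` is bounded by its variance
if `p ≤ 2`, and by Rosenthal's inequality otherwise (`integral_abs_coeff_error_rpow_le`). The
variance due to the observations is at most `2^j/n`, up to a constant, times the mass of `f` in a
cell of length of order `2^{-j}`; the `L^p` bound on `f` controls the sum of the powers `p/2` of
these masses (`sum_cellMass_rpow_half_le`). Errors at different `(j, k)` share the `X_i`, but only
sums of moments and Minkowski's inequality are used, so this dependence is harmless. At level `j`
the `L^p` norm of the error is of order `(2^j/n)^{1/2}` times `1 + τ`, with `τ` of order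
`2^{j₁/2}/α`, plus, for `p > 2`, a contribution of the high moments. The top level dominates the sum
over `j`.

The term of high moments carries the extra factor `(2^{j₁}/n)^{p/2-1}`. It is absorbed by the
classical term if `2^{j₁} ≤ κ n` and by the privacy term if `α ≤ κ` (`highMoment_mul_le`). For (ii),
the prescribed `j₁` satisfies `2^{j₁} ≤ c₂ n`, so (i) applies with `κ = c₂`, and `rate_terms_le`
balances the three terms. -/

lemma rpow_sub_rpow_le_mul {x y r : ℝ} (hy : 0 ≤ y) (hyx : y ≤ x) (hr : 1 ≤ r) :
    x ^ r - y ^ r ≤ r * x ^ (r - 1) * (x - y) := by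
  rcases hy.eq_or_lt with rfl | hy0
  · rw [Real.zero_rpow (by linarith), sub_zero, sub_zero]
    rcases hyx.eq_or_lt with rfl | hx
    · rw [Real.zero_rpow (by linarith), mul_zero]
    · rw [Real.rpow_sub_one hx.ne', mul_assoc, div_mul_cancel₀ _ hx.ne']
      nlinarith [Real.rpow_nonneg hx.le r]
  · have hx : 0 < x := hy0.trans_le hyx
    -- Bernoulli's inequality at `y / x - 1 ≥ -1`, multiplied by `x ^ r`, replaces the mean value
    -- theorem.
    have hb := one_add_mul_self_le_rpow_one_add (s := y / x - 1) (by
      have : 0 ≤ y / x := by positivity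
      linarith) hr
    rw [add_sub_cancel, Real.div_rpow hy hx.le] at hb
    have hxr : 0 < x ^ r := Real.rpow_pos_of_pos hx r
    rw [le_div_iff₀ hxr] at hb
    have : (1 + r * (y / x - 1)) * x ^ r = x ^ r - r * (x ^ r / x) * (x - y) := by
      field_simp
      ring
    rw [Real.rpow_sub_one hx.ne']
    linarith

/-- The function `|x|^{p-2} x` is, up to the factor `p`, the derivative of `|x|^p`; this is its
Lipschitz bound on `[-M, M]`. For arguments of the same sign, oddness reduces to powers of
nonnegative numbers; for opposite signs both are compared with `0`. -/
lemma abs_rpow_mul_self_sub_le {p : ℝ} (hp : 2 ≤ p) (x y M : ℝ) (hx : |x| ≤ M) (hy : |y| ≤ M) :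
    |(|x| ^ (p - 2) * x - |y| ^ (p - 2) * y)| ≤ (p - 1) * M ^ (p - 2) * |x - y| := by
  have key : ∀ u v : ℝ, 0 ≤ v → v ≤ u → u ≤ M →
      u ^ (p - 2) * u - v ^ (p - 2) * v ≤ (p - 1) * M ^ (p - 2) * (u - v) := by
    intro u v hv hvu huM
    have h1 : ∀ w : ℝ, 0 ≤ w → w ^ (p - 2) * w = w ^ (p - 1) := by
      intro w hw
      rcases hw.eq_or_lt with rfl | hw
      · rw [mul_zero, Real.zero_rpow (by linarith)]
      · rw [← Real.rpow_add_one hw.ne']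
        congr 1
        ring
    rw [h1 u (hv.trans hvu), h1 v hv]
    refine (rpow_sub_rpow_le_mul hv hvu (by linarith)).trans ?_
    have h2 : p - 1 - 1 = p - 2 := by ring
    rw [h2]
    have := Real.rpow_le_rpow (hv.trans hvu) huM (by linarith : 0 ≤ p - 2)
    have h3 : 0 ≤ u - v := by linarith
    gcongr
    linarith
  have hmono : ∀ u v : ℝ, 0 ≤ v → v ≤ u → v ^ (p - 2) * v ≤ u ^ (p - 2) * u := by
    intro u v hv hvu
    have := Real.rpow_le_rpow hv hvu (by linarith : 0 ≤ p - 2)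
    have h0 := Real.rpow_nonneg hv (p - 2)
    nlinarith
  have h00 : (0 : ℝ) ^ (p - 2) * 0 = 0 := by ring
  wlog hyx : y ≤ x generalizing x y
  · rw [abs_sub_comm, abs_sub_comm x y]
    exact this y x hy hx (by linarith)
  rcases le_total 0 y with h0y | hy0
  · have h0x := h0y.trans hyx
    rw [abs_of_nonneg h0x] at hx ⊢
    rw [abs_of_nonneg h0y] at hy ⊢
    rw [abs_of_nonneg (by linarith [hmono x y h0y hyx]), abs_of_nonneg (by linarith)]
    exact key x y h0y hyx hx
  · rcases le_total 0 x with h0x | hx0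
    · rw [abs_of_nonneg h0x] at hx ⊢
      rw [abs_of_nonpos hy0] at hy ⊢
      have k1 := key x 0 le_rfl h0x hx
      have k2 := key (-y) 0 le_rfl (by linarith) hy
      have m1 := hmono x 0 le_rfl h0x
      have m2 := hmono (-y) 0 le_rfl (by linarith)
      rw [h00] at k1 k2 m1 m2
      rw [abs_of_nonneg (by linarith), abs_of_nonneg (by linarith)]
      linarith
    · rw [abs_of_nonpos hx0] at hx ⊢
      rw [abs_of_nonpos hy0] at hy ⊢
      have k := key (-y) (-x) (by linarith) (by linarith) hy
      have m := hmono (-y) (-x) (by linarith) (by linarith)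
      rw [abs_of_nonneg (by linarith), abs_of_nonneg (by linarith)]
      linarith

/-- Convexity: the graph of `|·|^p` lies above its tangent at `c`. It follows from Young's
inequality for `|a|` and `|c|^{p-1}` with conjugate exponents `p` and `p/(p-1)`. -/
lemma abs_rpow_le_add_tangent {p : ℝ} (hp : 2 ≤ p) (a c : ℝ) :
    |c| ^ p ≤ |a| ^ p + p * (|c| ^ (p - 2) * c) * (c - a) := by
  have hpq : (p).HolderConjugate (p / (p - 1)) :=
    Real.HolderConjugate.conjExponent (by linarith)
  have hy := Real.young_inequality_of_nonneg (abs_nonneg a)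
    (Real.rpow_nonneg (abs_nonneg c) (p - 1)) hpq
  have h1 : (|c| ^ (p - 1)) ^ (p / (p - 1)) = |c| ^ p := by
    rw [← Real.rpow_mul (abs_nonneg c), mul_div_cancel₀]
    linarith
  rw [h1] at hy
  have h2 : |c| ^ (p - 2) * c * c = |c| ^ p := by
    rw [mul_assoc, ← pow_two, ← sq_abs, ← Real.rpow_natCast, ← Real.rpow_add_of_nonneg
      (abs_nonneg c) (by linarith) (by norm_num)]
    congr 1
    push_cast
    ring
  have h3 : |c| ^ (p - 2) * c * a ≤ |a| * |c| ^ (p - 1) := by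
    have : |c| ^ (p - 1) = |c| ^ (p - 2) * |c| := by
      rw [← Real.rpow_add_one' (abs_nonneg c) (by linarith)]
      congr 1
      ring
    rw [this, mul_assoc]
    have hca : c * a ≤ |c| * |a| := by rw [← abs_mul]; exact le_abs_self _
    nlinarith [Real.rpow_nonneg (abs_nonneg c) (p - 2)]
  have hp0 : (0 : ℝ) < p := by linarith
  have h4 : p * (|a| ^ p / p + |c| ^ p / (p / (p - 1))) = |a| ^ p + (p - 1) * |c| ^ p := by
    have : p - 1 ≠ 0 := by linarith
    field_simp
  have h5 := mul_le_mul_of_nonneg_left (h3.trans hy) hp0.le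
  rw [h4] at h5
  nlinarith

/-- A Taylor bound of second order whose linear term disappears on taking expectations. The tangent
inequality at `a + b` gives a linear term with the derivative at `a + b`; the Lipschitz bound moves
it to `a`, at the cost of a term quadratic in `b`. -/
lemma abs_add_rpow_le {p : ℝ} (hp : 2 ≤ p) (a b : ℝ) :
    |a + b| ^ p ≤ |a| ^ p + p * (|a| ^ (p - 2) * a * b) +
      p * (p - 1) * 2 ^ (p - 2) * (|a| ^ (p - 2) * b ^ 2 + |b| ^ p) := by
  have h1 := abs_rpow_le_add_tangent hp a (a + b)
  have hm0 : 0 ≤ max |a| |b| := le_max_of_le_left (abs_nonneg a)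
  have h2 := abs_rpow_mul_self_sub_le hp (a + b) a (2 * max |a| |b|)
    ((abs_add_le a b).trans (by linarith [le_max_left |a| |b|, le_max_right |a| |b|]))
    (by linarith [le_max_left |a| |b|, abs_nonneg a])
  rw [add_sub_cancel_left] at h1 h2
  set G1 := |a + b| ^ (p - 2) * (a + b)
  set G0 := |a| ^ (p - 2) * a
  have h3 : (G1 - G0) * b ≤ (p - 1) * (2 * max |a| |b|) ^ (p - 2) * b ^ 2 := by
    calc (G1 - G0) * b ≤ |G1 - G0| * |b| := by rw [← abs_mul]; exact le_abs_self _
      _ ≤ (p - 1) * (2 * max |a| |b|) ^ (p - 2) * |b| * |b| := by gcongr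
      _ = _ := by rw [mul_assoc _ |b| |b|, ← pow_two, sq_abs]
  have h4 : (max |a| |b|) ^ (p - 2) * b ^ 2 ≤ |a| ^ (p - 2) * b ^ 2 + |b| ^ p := by
    have hb : |b| ^ p = |b| ^ (p - 2) * b ^ 2 := by
      rw [← sq_abs, ← Real.rpow_natCast, ← Real.rpow_add_of_nonneg
        (abs_nonneg b) (by linarith) (by norm_num)]
      congr 1
      push_cast
      ring
    have ha0 := Real.rpow_nonneg (abs_nonneg a) (p - 2)
    have hb0 := Real.rpow_nonneg (abs_nonneg b) (p - 2)
    rw [hb, ← add_mul]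
    refine mul_le_mul_of_nonneg_right ?_ (sq_nonneg b)
    rcases max_cases |a| |b| with ⟨h, -⟩ | ⟨h, -⟩ <;> rw [h] <;> linarith
  rw [Real.mul_rpow (by norm_num) hm0] at h3
  have h5 : 0 ≤ (p - 1) * 2 ^ (p - 2) :=
    mul_nonneg (by linarith) (Real.rpow_nonneg (by norm_num) _)
  have h6 := mul_le_mul_of_nonneg_left h4 h5
  have h7 : (G1 - G0) * b ≤
      (p - 1) * 2 ^ (p - 2) * (|a| ^ (p - 2) * b ^ 2 + |b| ^ p) := by linarith
  have h8 := mul_le_mul_of_nonneg_left h7 (by linarith : 0 ≤ p)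
  nlinarith

/-- The constant in the moment inequality `integral_abs_sum_rpow_le`. -/
noncomputable def momentConst (p : ℝ) : ℝ := 2 * (p * (p - 1) * 2 ^ (p - 2))

section Rosenthal

variable {Ω : Type*} [MeasurableSpace Ω] {P : Measure Ω} [IsProbabilityMeasure P] {ι : Type*}

/-- Jensen's inequality for the concave function `x ↦ x^{r/p}`; integrability comes from `|X|^r ≤
|X|^p + 1`. -/
lemma integral_abs_rpow_le_of_memLp {X : Ω → ℝ} {p r : ℝ} (hr : 0 ≤ r) (hrp : r ≤ p) (hp : 0 < p)
    (hX : MemLp X (ENNReal.ofReal p) P) :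
    Integrable (fun ω => |X ω| ^ r) P ∧
      ∫ ω, |X ω| ^ r ∂P ≤ (∫ ω, |X ω| ^ p ∂P) ^ (r / p) := by
  have hp_int : Integrable (fun ω => |X ω| ^ p) P := by
    have := hX.integrable_norm_rpow (by simpa using hp) ENNReal.ofReal_ne_top
    simpa [ENNReal.toReal_ofReal hp.le, Real.norm_eq_abs] using this
  have hpow : ∀ ω, |X ω| ^ r = (|X ω| ^ p) ^ (r / p) := by
    intro ω
    rw [← Real.rpow_mul (abs_nonneg _), mul_div_cancel₀ _ hp.ne']
  have hint : Integrable (fun ω => |X ω| ^ r) P := by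
    refine Integrable.mono' (hp_int.add (integrable_const 1))
      ((continuous_abs.comp_aestronglyMeasurable hX.1).aemeasurable.pow_const r
        |>.aestronglyMeasurable) (ae_of_all _ fun ω => ?_)
    rw [Real.norm_of_nonneg (Real.rpow_nonneg (abs_nonneg _) _)]
    rcases le_total |X ω| 1 with h | h
    · have := Real.rpow_le_one (abs_nonneg (X ω)) h hr
      have := Real.rpow_nonneg (abs_nonneg (X ω)) p
      simp only [Pi.add_apply]
      linarith
    · have := Real.rpow_le_rpow_of_exponent_le h hrp
      simp only [Pi.add_apply]
      linarith
  refine ⟨hint, ?_⟩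
  have hc : ConcaveOn ℝ (Ici (0 : ℝ)) fun x : ℝ => x ^ (r / p) :=
    Real.concaveOn_rpow (by positivity) (by rw [div_le_one hp]; exact hrp)
  have hj := hc.le_map_integral
    (Real.continuous_rpow_const (by positivity)).continuousOn isClosed_Ici
    (ae_of_all P fun ω => Real.rpow_nonneg (abs_nonneg (X ω)) p) hp_int (by
      simpa only [Function.comp_def, ← hpow] using hint)
  simpa only [← hpow] using hj

/-- The induction step for Rosenthal's inequality. Expand around the old sum `S` by
`abs_add_rpow_le`: independence and centring kill the linear term, independence factors the
quadratic one, and Jensen's inequality turns `E|S|^{p-2}` into `(E|S|^p)^{1-2/p}`. -/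
lemma integral_abs_sum_rpow_insert_le [DecidableEq ι] {ξ : ι → Ω → ℝ} {p : ℝ} (hp : 2 ≤ p)
    (hind : iIndepFun ξ P) (hξ : ∀ i, MemLp (ξ i) (ENNReal.ofReal p) P)
    (hmean : ∀ i, ∫ ω, ξ i ω ∂P = 0) (s : Finset ι) (a : ι) (ha : a ∉ s) :
    ∫ ω, |∑ i ∈ insert a s, ξ i ω| ^ p ∂P ≤ ∫ ω, |∑ i ∈ s, ξ i ω| ^ p ∂P +
      p * (p - 1) * 2 ^ (p - 2) * ((∫ ω, |∑ i ∈ s, ξ i ω| ^ p ∂P) ^ (1 - 2 / p) *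
        ∫ ω, ξ a ω ^ 2 ∂P + ∫ ω, |ξ a ω| ^ p ∂P) := by
  have hp0 : 0 < p := by linarith
  set S : Ω → ℝ := fun ω => ∑ i ∈ s, ξ i ω with hS
  have hSmem : MemLp S (ENNReal.ofReal p) P := memLp_finsetSum s fun i _ => hξ i
  have hSa : IndepFun S (ξ a) P := by
    have := hind.indepFun_finsetSum_of_notMem₀ (fun i => (hξ i).1.aemeasurable) ha
    convert this using 1
    ext ω
    simp [hS]
  have hSp := integral_abs_rpow_le_of_memLp hp0.le le_rfl hp0 hSmem
  have hS2 := integral_abs_rpow_le_of_memLp (r := p - 2) (by linarith) (by linarith) hp0 hSmem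
  have hS1 := integral_abs_rpow_le_of_memLp (r := p - 1) (by linarith) (by linarith) hp0 hSmem
  have hap := integral_abs_rpow_le_of_memLp hp0.le le_rfl hp0 (hξ a)
  have ha2 := integral_abs_rpow_le_of_memLp (r := 2) (by norm_num) hp hp0 (hξ a)
  have ha1 : Integrable (ξ a) P := (hξ a).integrable (by
    rw [← ENNReal.ofReal_one]; exact ENNReal.ofReal_le_ofReal (by linarith))
  have hsq : ∀ ω, |ξ a ω| ^ (2 : ℝ) = ξ a ω ^ 2 := by
    intro ω
    rw [Real.rpow_two, sq_abs]
  simp only [hsq] at ha2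
  have hm1 : Measurable fun x : ℝ => |x| ^ (p - 2) * x := by fun_prop
  have hm2 : Measurable fun x : ℝ => |x| ^ (p - 2) := by fun_prop
  have hm3 : Measurable fun x : ℝ => x ^ 2 := by fun_prop
  have i1 : IndepFun (fun ω => |S ω| ^ (p - 2) * S ω) (ξ a) P :=
    hSa.comp hm1 measurable_id
  have i2 : IndepFun (fun ω => |S ω| ^ (p - 2)) (fun ω => ξ a ω ^ 2) P := hSa.comp hm2 hm3
  have hG : Integrable (fun ω => |S ω| ^ (p - 2) * S ω) P := by
    refine hS1.1.mono' (hm1.comp_aemeasurable hSmem.1.aemeasurable).aestronglyMeasurable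
      (ae_of_all _ fun ω => ?_)
    rw [norm_mul, Real.norm_of_nonneg (Real.rpow_nonneg (abs_nonneg _) _), Real.norm_eq_abs,
      ← Real.rpow_add_one' (abs_nonneg _) (by linarith)]
    refine le_of_eq ?_
    congr 1
    ring
  have e1 : ∫ ω, |S ω| ^ (p - 2) * S ω * ξ a ω ∂P = 0 := by
    rw [i1.integral_fun_mul_eq_mul_integral hG.1 ha1.1, hmean a, mul_zero]
  have e2 : ∫ ω, |S ω| ^ (p - 2) * ξ a ω ^ 2 ∂P =
      (∫ ω, |S ω| ^ (p - 2) ∂P) * ∫ ω, ξ a ω ^ 2 ∂P :=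
    i2.integral_fun_mul_eq_mul_integral hS2.1.1 ha2.1.1
  have n1 : Integrable (fun ω => |S ω| ^ (p - 2) * S ω * ξ a ω) P := i1.integrable_mul hG ha1
  have n2 : Integrable (fun ω => |S ω| ^ (p - 2) * ξ a ω ^ 2) P := i2.integrable_mul hS2.1 ha2.1
  have hK : 0 ≤ p * (p - 1) * 2 ^ (p - 2) :=
    mul_nonneg (mul_nonneg hp0.le (by linarith)) (Real.rpow_nonneg (by norm_num) _)
  have hL : Integrable (fun ω => |S ω| ^ p + p * (|S ω| ^ (p - 2) * S ω * ξ a ω)) P :=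
    hSp.1.add (n1.const_mul p)
  have hR : Integrable (fun ω => p * (p - 1) * 2 ^ (p - 2) *
      (|S ω| ^ (p - 2) * ξ a ω ^ 2 + |ξ a ω| ^ p)) P := (n2.add hap.1).const_mul _
  calc ∫ ω, |∑ i ∈ insert a s, ξ i ω| ^ p ∂P
      ≤ ∫ ω, (|S ω| ^ p + p * (|S ω| ^ (p - 2) * S ω * ξ a ω) + p * (p - 1) * 2 ^ (p - 2) *
          (|S ω| ^ (p - 2) * ξ a ω ^ 2 + |ξ a ω| ^ p)) ∂P := by
        refine integral_mono_of_nonneg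
          (ae_of_all _ fun ω => Real.rpow_nonneg (abs_nonneg _) _) (hL.add hR)
          (ae_of_all _ fun ω => ?_)
        simp only [Finset.sum_insert ha]
        rw [add_comm]
        exact abs_add_rpow_le hp (S ω) (ξ a ω)
    _ = ∫ ω, |S ω| ^ p ∂P + p * (p - 1) * 2 ^ (p - 2) *
          ((∫ ω, |S ω| ^ (p - 2) ∂P) * ∫ ω, ξ a ω ^ 2 ∂P + ∫ ω, |ξ a ω| ^ p ∂P) := by
        rw [integral_add hL hR, integral_add hSp.1 (n1.const_mul p), integral_const_mul, e1,
          integral_const_mul, integral_add n2 hap.1, e2]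
        ring
    _ ≤ _ := by
        have : (p - 2) / p = 1 - 2 / p := by field_simp
        rw [this] at hS2
        have h2 : 0 ≤ ∫ ω, ξ a ω ^ 2 ∂P := integral_nonneg fun ω => sq_nonneg _
        gcongr
        exact hS2.2

/-- **Rosenthal's inequality.** The moment of order `p ≥ 2` of a sum of independent centred random
variables. -/
theorem integral_abs_sum_rpow_le [Fintype ι] {ξ : ι → Ω → ℝ} {p : ℝ} (hp : 2 ≤ p)
    (hind : iIndepFun ξ P) (hξ : ∀ i, MemLp (ξ i) (ENNReal.ofReal p) P)
    (hmean : ∀ i, ∫ ω, ξ i ω ∂P = 0) :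
    ∫ ω, |∑ i, ξ i ω| ^ p ∂P ≤ momentConst p ^ (p / 2) * (∑ i, ∫ ω, ξ i ω ^ 2 ∂P) ^ (p / 2) +
      momentConst p * ∑ i, ∫ ω, |ξ i ω| ^ p ∂P := by
  classical
  have hp0 : 0 < p := by linarith
  have hK : 0 < momentConst p :=
    mul_pos two_pos (mul_pos (mul_pos hp0 (by linarith)) (Real.rpow_pos_of_pos two_pos _))
  set K := momentConst p with hKdef
  set v : ι → ℝ := fun i => ∫ ω, ξ i ω ^ 2 ∂P
  set r : ι → ℝ := fun i => ∫ ω, |ξ i ω| ^ p ∂P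
  have hv : ∀ i, 0 ≤ v i := fun i => integral_nonneg fun ω => sq_nonneg _
  have hr : ∀ i, 0 ≤ r i := fun i => integral_nonneg fun ω => Real.rpow_nonneg (abs_nonneg _) _
  set V := ∑ i, v i
  set R := ∑ i, r i
  have hV : 0 ≤ V := Finset.sum_nonneg fun i _ => hv i
  have hR : 0 ≤ R := Finset.sum_nonneg fun i _ => hr i
  set B := K ^ (p / 2) * V ^ (p / 2) + K * R with hB
  have hB0 : 0 ≤ B := by positivity
  -- `B` is the bound to be proved. Since `(K V)^{p/2} ≤ B`, it is stable under the recursion of the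
  -- induction step.
  have hVB : K * V * B ^ (1 - 2 / p) ≤ B := by
    have h1 : K * V ≤ B ^ (2 / p) := by
      have : (K * V) = ((K * V) ^ (p / 2)) ^ (2 / p) := by
        rw [← Real.rpow_mul (by positivity)]
        have : p / 2 * (2 / p) = 1 := by field_simp
        rw [this, Real.rpow_one]
      rw [this]
      refine Real.rpow_le_rpow (by positivity) ?_ (by positivity)
      rw [Real.mul_rpow hK.le hV]
      have : 0 ≤ K * R := by positivity
      linarith
    calc K * V * B ^ (1 - 2 / p) ≤ B ^ (2 / p) * B ^ (1 - 2 / p) :=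
          mul_le_mul_of_nonneg_right h1 (Real.rpow_nonneg hB0 _)
      _ = B := by
          rw [← Real.rpow_add_of_nonneg hB0 (by positivity)
            (by rw [sub_nonneg, div_le_one hp0]; exact hp)]
          norm_num
  have hKR : K * R ≤ B := by
    have : 0 ≤ K ^ (p / 2) * V ^ (p / 2) := by positivity
    linarith
  -- The induction keeps a bound that is linear in the partial sums of `v` and `r`, with the power
  -- of the current moment replaced by that of `B`. The factor `2` in `momentConst` makes this bound
  -- at most the mean of `K V B^{1-2/p}` and `K R`, hence at most `B`, so the induction can
  -- continue.
  have claim : ∀ s : Finset ι, ∫ ω, |∑ i ∈ s, ξ i ω| ^ p ∂P ≤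
      K / 2 * (B ^ (1 - 2 / p) * ∑ i ∈ s, v i + ∑ i ∈ s, r i) := by
    intro s
    induction s using Finset.induction_on with
    | empty => simp [Real.zero_rpow hp0.ne']
    | insert a s ha ih =>
      have hBs : ∫ ω, |∑ i ∈ s, ξ i ω| ^ p ∂P ≤ B := by
        refine ih.trans ?_
        have h1 : ∑ i ∈ s, v i ≤ V :=
          Finset.sum_le_univ_sum_of_nonneg hv
        have h2 : ∑ i ∈ s, r i ≤ R := Finset.sum_le_univ_sum_of_nonneg hr
        have hBn := Real.rpow_nonneg hB0 (1 - 2 / p)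
        calc K / 2 * (B ^ (1 - 2 / p) * ∑ i ∈ s, v i + ∑ i ∈ s, r i)
            ≤ K / 2 * (B ^ (1 - 2 / p) * V + R) := by gcongr
          _ = (K * V * B ^ (1 - 2 / p) + K * R) / 2 := by ring
          _ ≤ B := by linarith
      have hstep := integral_abs_sum_rpow_insert_le hp hind hξ hmean s a ha
      have hu0 : 0 ≤ ∫ ω, |∑ i ∈ s, ξ i ω| ^ p ∂P :=
        integral_nonneg fun ω => Real.rpow_nonneg (abs_nonneg _) _
      have hpow := Real.rpow_le_rpow hu0 hBs
        (by rw [sub_nonneg, div_le_one hp0]; exact hp : 0 ≤ 1 - 2 / p)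
      have hK2 : p * (p - 1) * 2 ^ (p - 2) = K / 2 := by
        rw [hKdef, momentConst]
        ring
      rw [hK2] at hstep
      rw [Finset.sum_insert ha, Finset.sum_insert ha]
      have h3 := mul_le_mul_of_nonneg_right hpow (hv a)
      have h4 := mul_le_mul_of_nonneg_left h3 (by positivity : 0 ≤ K / 2)
      have : K / 2 * (B ^ (1 - 2 / p) * (v a + ∑ i ∈ s, v i) + (r a + ∑ i ∈ s, r i)) =
        K / 2 * (B ^ (1 - 2 / p) * ∑ i ∈ s, v i + ∑ i ∈ s, r i) +
          (K / 2 * (B ^ (1 - 2 / p) * v a) + K / 2 * r a) := by ring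
      rw [this]
      refine hstep.trans (add_le_add ih ?_)
      rw [mul_add]
      exact add_le_add h4 le_rfl
  refine (claim Finset.univ).trans ?_
  calc K / 2 * (B ^ (1 - 2 / p) * V + R) = (K * V * B ^ (1 - 2 / p) + K * R) / 2 := by ring
    _ ≤ B := by linarith

/-- The moment of order `p ≤ 2` of a sum of independent centred random variables. -/
theorem integral_abs_sum_rpow_le_of_le_two [Fintype ι] {ξ : ι → Ω → ℝ} {p : ℝ} (hp0 : 0 < p)
    (hp : p ≤ 2) (hind : iIndepFun ξ P) (hξ : ∀ i, MemLp (ξ i) 2 P)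
    (hmean : ∀ i, ∫ ω, ξ i ω ∂P = 0) :
    ∫ ω, |∑ i, ξ i ω| ^ p ∂P ≤ (∑ i, ∫ ω, ξ i ω ^ 2 ∂P) ^ (p / 2) := by
  have hmem : MemLp (fun ω => ∑ i, ξ i ω) (ENNReal.ofReal 2) P := by
    have := memLp_finsetSum Finset.univ fun i _ => hξ i
    simpa using this
  have h1 := (integral_abs_rpow_le_of_memLp hp0.le hp two_pos hmem).2
  have h2 : ∫ ω, |∑ i, ξ i ω| ^ (2 : ℝ) ∂P = ∑ i, ∫ ω, ξ i ω ^ 2 ∂P := by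
    have hv := IndepFun.variance_sum (s := Finset.univ) (fun i _ => hξ i)
      (fun i _ j _ hij => hind.indepFun hij)
    rw [variance_of_integral_eq_zero] at hv
    · calc ∫ ω, |∑ i, ξ i ω| ^ (2 : ℝ) ∂P = ∫ ω, (∑ i, ξ i) ω ^ 2 ∂P := by
            congr with ω
            rw [Real.rpow_two, sq_abs, Finset.sum_apply]
        _ = _ := by
            rw [hv]
            exact Finset.sum_congr rfl fun i _ =>
              variance_of_integral_eq_zero (hξ i).1.aemeasurable (hmean i)
    · exact (memLp_finsetSum' Finset.univ fun i _ => hξ i).1.aemeasurable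
    · simp only [Finset.sum_apply]
      rw [integral_finsetSum _ fun i _ => (hξ i).integrable one_le_two]
      exact Finset.sum_eq_zero fun i _ => hmean i
  rwa [h2] at h1

end Rosenthal

/-! ### Moments of the Laplace distribution -/

lemma integrable_abs_rpow_mul_exp_neg_abs {r : ℝ} (hr : 0 ≤ r) :
    Integrable (fun x : ℝ => |x| ^ r * Real.exp (-|x|)) volume := by
  have h1 : IntegrableOn (fun x : ℝ => |x| ^ r * Real.exp (-|x|)) (Ioi 0) volume := by
    refine (Real.GammaIntegral_convergent (s := r + 1) (by linarith)).congr_fun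
      (fun x hx => ?_) measurableSet_Ioi
    simp only [mem_Ioi] at hx
    simp only [abs_of_pos hx, add_sub_cancel_right]
    ring
  have h2 : IntegrableOn (fun x : ℝ => |x| ^ r * Real.exp (-|x|)) (Iic 0) volume := by
    rw [integrableOn_Iic_iff_integrableOn_Iio]
    have := IntegrableOn.comp_neg_Iio (c := (0 : ℝ)) (f := fun x : ℝ => |x| ^ r * Real.exp (-|x|))
      (by simpa using h1)
    simpa using this
  rw [← integrableOn_univ, ← Iic_union_Ioi (a := (0 : ℝ))]
  exact h2.union h1

lemma integrable_abs_rpow_laplaceOne {r : ℝ} (hr : 0 ≤ r) :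
    Integrable (fun x : ℝ => |x| ^ r) laplaceOne := by
  unfold laplaceOne
  rw [integrable_withDensity_iff_integrable_smul' (by fun_prop) (ae_of_all _ fun x => by simp)]
  refine ((integrable_abs_rpow_mul_exp_neg_abs hr).const_mul (1 / 2)).congr
    (ae_of_all _ fun x => ?_)
  simp only [smul_eq_mul]
  rw [ENNReal.toReal_ofReal (by positivity)]
  ring

lemma memLp_id_laplaceOne {r : ℝ} (hr : 0 < r) :
    MemLp (fun x : ℝ => x) (ENNReal.ofReal r) laplaceOne := by
  rw [← integrable_norm_rpow_iff (by fun_prop) (by simpa using hr) ENNReal.ofReal_ne_top]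
  simpa [ENNReal.toReal_ofReal hr.le] using integrable_abs_rpow_laplaceOne hr.le

lemma integral_id_laplaceOne : ∫ x, x ∂laplaceOne = 0 := by
  unfold laplaceOne
  rw [integral_withDensity_eq_integral_toReal_smul (by fun_prop) (ae_of_all _ fun x => by simp)]
  have h := integral_neg_eq_self (fun x : ℝ => (ENNReal.ofReal (Real.exp (-|x|) / 2)).toReal • x)
    volume
  simp only [abs_neg, smul_neg, integral_neg] at h
  linarith

/-- The absolute moments of the Laplace distribution. -/
noncomputable def laplaceMoment (r : ℝ) : ℝ := ∫ x, |x| ^ r ∂laplaceOne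

lemma laplaceMoment_nonneg (r : ℝ) : 0 ≤ laplaceMoment r :=
  integral_nonneg fun _ => Real.rpow_nonneg (abs_nonneg _) _

section

variable {Ω : Type*} [MeasurableSpace Ω] {P : Measure Ω} {Y : Ω → ℝ}

lemma memLp_of_hasLaw_laplaceOne (hY : HasLaw Y laplaceOne P) {r : ℝ} (hr : 0 < r) :
    MemLp Y (ENNReal.ofReal r) P := by
  have h := memLp_id_laplaceOne hr
  rw [← hY.map_eq] at h
  exact h.comp_of_map hY.aemeasurable

lemma integral_of_hasLaw_laplaceOne (hY : HasLaw Y laplaceOne P) : ∫ ω, Y ω ∂P = 0 := by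
  rw [hY.integral_eq, integral_id_laplaceOne]

lemma integral_abs_rpow_of_hasLaw_laplaceOne (hY : HasLaw Y laplaceOne P) (r : ℝ) :
    ∫ ω, |Y ω| ^ r ∂P = laplaceMoment r :=
  hY.integral_comp (f := fun x : ℝ => |x| ^ r) (by
    have : Measurable fun x : ℝ => |x| ^ r := by fun_prop
    exact this.aestronglyMeasurable)

end

/-! ### Bounded compactly supported functions and their dilations -/

/-- `g` is measurable, almost everywhere bounded by `B`, and supported in `[-A, A]`. -/
structure IsAtom (A B : ℝ) (g : ℝ → ℝ) : Prop where
  nonneg : 0 ≤ A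
  bound_nonneg : 0 ≤ B
  aesm : AEStronglyMeasurable g volume
  bound : ∀ᵐ x, |g x| ≤ B
  supp : Function.support g ⊆ Icc (-A) A

/-- The interval outside of which `g_{jk}` vanishes. -/
def cell (A : ℝ) (j k : ℤ) : Set ℝ := {x | |(2 : ℝ) ^ j * x - k| ≤ A}

/-- Bounds on the wavelets are only available almost everywhere; this transports them from `g` to
every `g_{jk}`. -/
lemma quasiMeasurePreserving_affine {c : ℝ} (hc : c ≠ 0) (d : ℝ) :
    Measure.QuasiMeasurePreserving (fun x : ℝ => c * x - d) volume volume := by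
  have h1 : Measure.QuasiMeasurePreserving (fun x : ℝ => c * x) volume volume := by
    refine ⟨by fun_prop, ?_⟩
    rw [Real.map_volume_mul_left hc]
    exact Measure.smul_absolutelyContinuous
  exact (measurePreserving_sub_right volume d).quasiMeasurePreserving.comp h1

lemma cell_eq_Icc (A : ℝ) (j k : ℤ) :
    cell A j k = Icc ((k - A) / (2 : ℝ) ^ j) ((k + A) / (2 : ℝ) ^ j) := by
  ext x
  have : (0 : ℝ) < 2 ^ j := by positivity
  simp only [cell, mem_ofPred_eq, mem_Icc, abs_le, div_le_iff₀ this, le_div_iff₀ this]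
  constructor <;> rintro ⟨h1, h2⟩ <;> constructor <;> linarith

lemma measurableSet_cell (A : ℝ) (j k : ℤ) : MeasurableSet (cell A j k) := by
  rw [cell_eq_Icc]
  exact measurableSet_Icc

lemma volume_cell (A : ℝ) (j k : ℤ) :
    volume (cell A j k) = ENNReal.ofReal (2 * A * (2 : ℝ) ^ (-j)) := by
  rw [cell_eq_Icc, Real.volume_Icc]
  congr 1
  rw [zpow_neg]
  field_simp
  ring

/-- At most `2A + 1` of the cells at a given level contain a given point. -/
lemma card_cell_le {A : ℝ} (hA : 0 ≤ A) (j : ℤ) (x : ℝ) (S : Finset ℤ)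
    (hS : ∀ k ∈ S, x ∈ cell A j k) : (S.card : ℝ) ≤ 2 * A + 1 := by
  set y := (2 : ℝ) ^ j * x
  have hsub : S ⊆ Finset.Icc ⌈y - A⌉ ⌊y + A⌋ := by
    intro k hk
    have := hS k hk
    simp only [cell, mem_ofPred_eq, abs_le] at this
    rw [Finset.mem_Icc, Int.ceil_le, Int.le_floor]
    constructor <;> linarith [this.1, this.2]
  have hcard := Finset.card_le_card hsub
  rw [Int.card_Icc] at hcard
  have h1 : (S.card : ℝ) ≤ ((⌊y + A⌋ + 1 - ⌈y - A⌉).toNat : ℝ) := by exact_mod_cast hcard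
  refine h1.trans ?_
  rcases le_total 0 (⌊y + A⌋ + 1 - ⌈y - A⌉) with h | h
  · have : (((⌊y + A⌋ + 1 - ⌈y - A⌉).toNat : ℤ) : ℝ) = (⌊y + A⌋ + 1 - ⌈y - A⌉ : ℤ) := by
      rw [Int.toNat_of_nonneg h]
    rw [Int.cast_natCast] at this
    rw [this]
    push_cast
    linarith [Int.floor_le (y + A), Int.le_ceil (y - A)]
  · rw [Int.toNat_of_nonpos h]
    simp
    linarith

lemma sum_indicator_cell_le {A : ℝ} (hA : 0 ≤ A) (j : ℤ) (x : ℝ) (S : Finset ℤ) :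
    ∑ k ∈ S, (cell A j k).indicator (fun _ => (1 : ℝ)) x ≤ 2 * A + 1 := by
  classical
  have : ∑ k ∈ S, (cell A j k).indicator (fun _ => (1 : ℝ)) x =
      ((S.filter fun k => x ∈ cell A j k).card : ℝ) := by
    simp only [indicator_apply, Finset.sum_ite, Finset.sum_const_zero, add_zero,
      Finset.sum_const, nsmul_eq_mul, mul_one]
  rw [this]
  exact card_cell_le hA j x _ fun k hk => (Finset.mem_filter.1 hk).2

namespace IsAtom

variable {A B : ℝ} {g : ℝ → ℝ}

lemma dil_eq_zero (hg : IsAtom A B g) {j k : ℤ} {x : ℝ} (hx : x ∉ cell A j k) :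
    dil g j k x = 0 := by
  have : g ((2 : ℝ) ^ j * x - k) = 0 := by
    by_contra h
    have := hg.supp (Function.mem_support.2 h)
    exact hx (abs_le.2 this)
  rw [dil, this, mul_zero]

lemma aestronglyMeasurable_dil (hg : IsAtom A B g) (j k : ℤ) :
    AEStronglyMeasurable (dil g j k) volume :=
  (hg.aesm.comp_quasiMeasurePreserving
    (quasiMeasurePreserving_affine (by positivity) _)).const_mul _

lemma ae_abs_dil_le (hg : IsAtom A B g) :
    ∀ᵐ x, ∀ j k : ℤ, |dil g j k x| ≤
      (cell A j k).indicator (fun _ => B * (2 : ℝ) ^ ((j : ℝ) / 2)) x := by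
  rw [ae_all_iff]
  intro j
  rw [ae_all_iff]
  intro k
  filter_upwards [(quasiMeasurePreserving_affine (c := (2 : ℝ) ^ j) (by positivity)
    (k : ℝ)).ae hg.bound] with x hx
  by_cases hc : x ∈ cell A j k
  · rw [indicator_of_mem hc, dil, abs_mul, abs_of_pos (by positivity), mul_comm]
    gcongr
  · rw [indicator_of_notMem hc, hg.dil_eq_zero hc, abs_zero]

end IsAtom

/-- The constant in `IsAtom.eLpNorm_sum_dil_le`. -/
noncomputable def synthConst (A B p : ℝ) : ℝ :=
  ((2 * A + 1) ^ (p - 1) * B ^ p * (2 * A)) ^ (1 / p)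

/-- At most `2A + 1` of the terms are non-zero at `x`, so the power mean inequality costs only a
constant, whatever the size of `S`. -/
lemma abs_sum_rpow_le_of_cell {A : ℝ} (hA : 0 ≤ A) {p : ℝ} (hp : 1 ≤ p) (j : ℤ) (x : ℝ)
    (S : Finset ℤ) (b : ℤ → ℝ) (hb : ∀ k, x ∉ cell A j k → b k = 0) :
    |∑ k ∈ S, b k| ^ p ≤ (2 * A + 1) ^ (p - 1) * ∑ k ∈ S, |b k| ^ p := by
  classical
  have h0 : ∑ k ∈ S, b k = ∑ k ∈ S.filter (fun k => x ∈ cell A j k), b k := by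
    rw [Finset.sum_filter]
    refine Finset.sum_congr rfl fun k _ => ?_
    split_ifs with h
    · rfl
    · exact hb k h
  rw [h0]
  calc |∑ k ∈ S.filter (fun k => x ∈ cell A j k), b k| ^ p
      ≤ (∑ k ∈ S.filter (fun k => x ∈ cell A j k), |b k|) ^ p := by
        gcongr
        exact Finset.abs_sum_le_sum_abs _ _
    _ ≤ ((S.filter (fun k => x ∈ cell A j k)).card : ℝ) ^ (p - 1) *
          ∑ k ∈ S.filter (fun k => x ∈ cell A j k), |b k| ^ p :=
        Real.rpow_sum_le_const_mul_sum_rpow _ _ hp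
    _ ≤ (2 * A + 1) ^ (p - 1) * ∑ k ∈ S, |b k| ^ p := by
        refine mul_le_mul (Real.rpow_le_rpow (by positivity) ?_ (by linarith)) ?_
          (Finset.sum_nonneg fun k _ => by positivity) (by positivity)
        · exact card_cell_le hA j x _ fun k hk => (Finset.mem_filter.1 hk).2
        · exact Finset.sum_le_sum_of_subset_of_nonneg (Finset.filter_subset _ _)
            fun k _ _ => by positivity

/-- The synthesis operator is bounded from `ℓ^p` to `L^p`. -/
lemma IsAtom.eLpNorm_sum_dil_le {A B : ℝ} {g : ℝ → ℝ} (hg : IsAtom A B g) {p : ℝ} (hp : 1 ≤ p)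
    (j : ℤ) (S : Finset ℤ) (a : ℤ → ℝ) :
    eLpNorm (fun x => ∑ k ∈ S, a k * dil g j k x) (ENNReal.ofReal p) volume ≤
      ENNReal.ofReal (synthConst A B p * (2 : ℝ) ^ ((j : ℝ) * (1 / 2 - 1 / p)) *
        (∑ k ∈ S, |a k| ^ p) ^ (1 / p)) := by
  have hp0 : 0 < p := by linarith
  have hA := hg.nonneg
  have hB := hg.bound_nonneg
  rw [eLpNorm_eq_lintegral_rpow_enorm_toReal (by simpa using hp0) ENNReal.ofReal_ne_top,
    ENNReal.toReal_ofReal hp0.le]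
  have hc0 : 0 ≤ (2 * A + 1) ^ (p - 1) * B ^ p * (2 : ℝ) ^ ((j : ℝ) * p / 2) := by positivity
  have hpt : ∀ᵐ x, ‖∑ k ∈ S, a k * dil g j k x‖ₑ ^ p ≤
      ENNReal.ofReal ((2 * A + 1) ^ (p - 1) * B ^ p * (2 : ℝ) ^ ((j : ℝ) * p / 2)) *
        ∑ k ∈ S, ENNReal.ofReal (|a k| ^ p) * (cell A j k).indicator (fun _ => 1) x := by
    filter_upwards [hg.ae_abs_dil_le] with x hx
    have h1 := abs_sum_rpow_le_of_cell hA hp j x S (fun k => a k * dil g j k x) (fun k hk => by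
      rw [hg.dil_eq_zero hk, mul_zero])
    have h2 : ∀ k, |a k * dil g j k x| ^ p ≤ B ^ p * (2 : ℝ) ^ ((j : ℝ) * p / 2) *
        (|a k| ^ p * (cell A j k).indicator (fun _ => (1 : ℝ)) x) := by
      intro k
      have h3 := hx j k
      by_cases hk : x ∈ cell A j k
      · rw [indicator_of_mem hk] at h3 ⊢
        rw [abs_mul, Real.mul_rpow (abs_nonneg _) (abs_nonneg _)]
        have : |dil g j k x| ^ p ≤ B ^ p * (2 : ℝ) ^ ((j : ℝ) * p / 2) := by
          refine (Real.rpow_le_rpow (abs_nonneg _) h3 hp0.le).trans_eq ?_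
          rw [Real.mul_rpow hB (by positivity), ← Real.rpow_mul (by norm_num)]
          ring_nf
        calc _ ≤ |a k| ^ p * (B ^ p * (2 : ℝ) ^ ((j : ℝ) * p / 2)) := by gcongr
          _ = _ := by ring
      · rw [hg.dil_eq_zero hk, mul_zero, abs_zero, Real.zero_rpow hp0.ne', indicator_of_notMem hk]
        simp
    have h4 : |∑ k ∈ S, a k * dil g j k x| ^ p ≤
        ((2 * A + 1) ^ (p - 1) * B ^ p * (2 : ℝ) ^ ((j : ℝ) * p / 2)) *
          ∑ k ∈ S, |a k| ^ p * (cell A j k).indicator (fun _ => (1 : ℝ)) x := by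
      refine h1.trans ?_
      rw [mul_assoc ((2 * A + 1) ^ (p - 1)), mul_assoc ((2 * A + 1) ^ (p - 1))]
      refine mul_le_mul_of_nonneg_left ?_ (by positivity)
      rw [Finset.mul_sum]
      exact Finset.sum_le_sum fun k _ => h2 k
    rw [Real.enorm_eq_ofReal_abs, ENNReal.ofReal_rpow_of_nonneg (abs_nonneg _) hp0.le]
    refine (ENNReal.ofReal_le_ofReal h4).trans_eq ?_
    rw [ENNReal.ofReal_mul hc0, ENNReal.ofReal_sum_of_nonneg]
    · congr 1
      refine Finset.sum_congr rfl fun k _ => ?_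
      rw [ENNReal.ofReal_mul (by positivity)]
      congr 1
      by_cases hk : x ∈ cell A j k <;> simp [hk]
    · intro k _
      by_cases hk : x ∈ cell A j k <;> simp [hk]
      positivity
  calc (∫⁻ x, ‖∑ k ∈ S, a k * dil g j k x‖ₑ ^ p) ^ (1 / p)
      ≤ (∫⁻ x, ENNReal.ofReal ((2 * A + 1) ^ (p - 1) * B ^ p * (2 : ℝ) ^ ((j : ℝ) * p / 2)) *
        ∑ k ∈ S, ENNReal.ofReal (|a k| ^ p) * (cell A j k).indicator (fun _ => 1) x) ^ (1 / p) := by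
        gcongr ?_ ^ (1 / p)
        exact lintegral_mono_ae hpt
    _ = (ENNReal.ofReal ((2 * A + 1) ^ (p - 1) * B ^ p * (2 : ℝ) ^ ((j : ℝ) * p / 2)) *
        ∑ k ∈ S, ENNReal.ofReal (|a k| ^ p) * ENNReal.ofReal (2 * A * (2 : ℝ) ^ (-j))) ^ (1 / p) := by
        congr 1
        have hm : ∀ k, Measurable ((cell A j k).indicator (fun _ => (1 : ℝ≥0∞))) := fun k =>
          measurable_const.indicator (measurableSet_cell A j k)
        rw [lintegral_const_mul _ (by fun_prop), lintegral_finsetSum _ (by fun_prop)]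
        congr 1
        refine Finset.sum_congr rfl fun k _ => ?_
        rw [lintegral_const_mul _ (hm k), lintegral_indicator (measurableSet_cell A j k)]
        simp [volume_cell]
    _ = ENNReal.ofReal ((((2 * A + 1) ^ (p - 1) * B ^ p * (2 : ℝ) ^ ((j : ℝ) * p / 2)) *
        ((∑ k ∈ S, |a k| ^ p) * (2 * A * (2 : ℝ) ^ (-j)))) ^ (1 / p)) := by
        rw [← Finset.sum_mul, ← ENNReal.ofReal_sum_of_nonneg (fun k _ => by positivity),
          ← ENNReal.ofReal_mul (Finset.sum_nonneg fun k _ => by positivity),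
          ← ENNReal.ofReal_mul hc0, ENNReal.ofReal_rpow_of_nonneg _ (by positivity)]
        positivity
    _ = _ := by
        congr 1
        have hS : 0 ≤ ∑ k ∈ S, |a k| ^ p := Finset.sum_nonneg fun k _ => by positivity
        -- The power `jp/2` comes from the amplitude of `g_{jk}` and the power `-j` from the length
        -- of a cell.
        have : (2 : ℝ) ^ ((j : ℝ) * (1 / 2 - 1 / p)) =
            ((2 : ℝ) ^ ((j : ℝ) * p / 2) * (2 : ℝ) ^ (-j)) ^ (1 / p) := by
          rw [← Real.rpow_intCast, ← Real.rpow_add two_pos, ← Real.rpow_mul two_pos.le]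
          congr 1
          push_cast
          field_simp
          ring
        rw [synthConst, this, ← Real.mul_rpow (by positivity) (by positivity),
          ← Real.mul_rpow (by positivity) hS]
        congr 1
        ring

/-! ### Orthogonal projections onto the spaces of a multiresolution analysis -/

section Hilbert

variable {H : Type*} [NormedAddCommGroup H] [InnerProductSpace ℝ H]

/-- `u` is the orthogonal projection of `v` onto `V`. -/
def IsProjOn (V : Submodule ℝ H) (v u : H) : Prop := u ∈ V ∧ v - u ∈ Vᗮ

lemma IsProjOn.unique {V : Submodule ℝ H} {v u u' : H} (h : IsProjOn V v u)
    (h' : IsProjOn V v u') : u = u' := by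
  have h1 : u - u' ∈ V := V.sub_mem h.1 h'.1
  have h2 : u - u' ∈ Vᗮ := by
    have := Vᗮ.sub_mem h'.2 h.2
    rwa [sub_sub_sub_cancel_left] at this
  have := V.inf_orthogonal_eq_bot
  have h3 : u - u' ∈ V ⊓ Vᗮ := ⟨h1, h2⟩
  rw [this, Submodule.mem_bot, sub_eq_zero] at h3
  exact h3

lemma isProjOn_self {V : Submodule ℝ H} {v : H} (h : v ∈ V) : IsProjOn V v v :=
  ⟨h, by simp⟩

/-- The difference `u₁ - u₀` is itself the projection onto `V₁ ⊓ V₀ᗮ`: the residual `(v - u₁) + u₀`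
is a sum of vectors orthogonal to `V₁` and to `V₀ᗮ`. -/
lemma IsProjOn.add_of_inf_orthogonal {V₀ V₁ : Submodule ℝ H} (hV : V₀ ≤ V₁) {v u₀ u₁ w : H}
    (h₀ : IsProjOn V₀ v u₀) (h₁ : IsProjOn V₁ v u₁) (hw : IsProjOn (V₁ ⊓ V₀ᗮ) v w) :
    u₁ = u₀ + w := by
  have : IsProjOn (V₁ ⊓ V₀ᗮ) v (u₁ - u₀) := by
    refine ⟨⟨V₁.sub_mem h₁.1 (hV h₀.1), ?_⟩, ?_⟩
    · have h2 := V₀ᗮ.sub_mem h₀.2 (Submodule.orthogonal_le hV h₁.2)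
      rwa [sub_sub_sub_cancel_left] at h2
    · have e : v - (u₁ - u₀) = (v - u₁) + u₀ := by abel
      rw [e]
      refine Submodule.add_mem _ (Submodule.orthogonal_le inf_le_left h₁.2) ?_
      exact Submodule.orthogonal_le inf_le_right (Submodule.le_orthogonal_orthogonal V₀ h₀.1)
  rw [hw.unique this]
  abel

lemma IsProjOn.norm_sub_le {V : Submodule ℝ H} {v u w : H} (h : IsProjOn V v u) (hw : w ∈ V) :
    ‖v - u‖ ≤ ‖v - w‖ := by
  have h0 : inner ℝ (v - u) (u - w) = 0 :=
    (Submodule.mem_orthogonal' _ _).1 h.2 _ (V.sub_mem h.1 hw)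
  have h1 := norm_add_sq_eq_norm_sq_add_norm_sq_real h0
  rw [sub_add_sub_cancel] at h1
  nlinarith [norm_nonneg (v - u), norm_nonneg (v - w), mul_self_nonneg ‖u - w‖]

/-- When all inner products outside a finite set vanish, the projection onto the closed span is a
finite sum, and no convergence question arises. -/
lemma isProjOn_sum {ι : Type*} [DecidableEq ι] {e : ι → H} (he : Orthonormal ℝ e) (S : Finset ι) (v : H)
    (hS : ∀ k ∉ S, inner ℝ (e k) v = 0) :
    IsProjOn (Submodule.span ℝ (range e)).topologicalClosure v
      (∑ k ∈ S, inner ℝ (e k) v • e k) := by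
  refine ⟨?_, ?_⟩
  · refine Submodule.le_topologicalClosure _ (Submodule.sum_mem _ fun k _ => ?_)
    exact Submodule.smul_mem _ _ (Submodule.subset_span (mem_range_self k))
  · rw [Submodule.orthogonal_closure, Submodule.mem_orthogonal]
    intro u hu
    induction hu using Submodule.span_induction with
    | mem x hx =>
      obtain ⟨l, rfl⟩ := hx
      rw [inner_sub_right, inner_sum]
      simp only [inner_smul_right, orthonormal_iff_ite.1 he l]
      by_cases hl : l ∈ S
      · simp [hl]
      · simp [hl, hS l hl]
    | zero => simp
    | add x y _ _ hx hy => rw [inner_add_left, hx, hy, add_zero]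
    | smul a x _ hx => rw [inner_smul_left, hx, mul_zero]

end Hilbert

/-! ### Scaling identities -/

lemma dil_add (g : ℝ → ℝ) (j i k : ℤ) (x : ℝ) :
    dil g (j + i) k x = (2 : ℝ) ^ ((j : ℝ) / 2) * dil g i k ((2 : ℝ) ^ j * x) := by
  simp only [dil]
  rw [← mul_assoc, ← Real.rpow_add two_pos, zpow_add₀ two_ne_zero]
  congr 2
  · push_cast
    ring
  · ring

lemma dil_zero_zero (g : ℝ → ℝ) : dil g 0 0 = g := by
  ext x
  simp [dil]

lemma two_rpow_half_mul_self (j : ℤ) :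
    (2 : ℝ) ^ ((j : ℝ) / 2) * (2 : ℝ) ^ ((j : ℝ) / 2) = (2 : ℝ) ^ j := by
  rw [← Real.rpow_add two_pos, add_halves, Real.rpow_intCast]

lemma OrthonormalTranslates.integral_dil_mul_dil {g : ℝ → ℝ} (hg : OrthonormalTranslates g)
    (j k l : ℤ) : ∫ x, dil g j k x * dil g j l x = if k = l then 1 else 0 := by
  rw [← hg.inner_eq k l]
  have h : ∀ x, dil g j k x * dil g j l x = (2 : ℝ) ^ j *
      (fun y => dil g 0 k y * dil g 0 l y) ((2 : ℝ) ^ j * x) := by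
    intro x
    have := dil_add g j 0
    rw [add_zero] at this
    rw [this, this, ← two_rpow_half_mul_self]
    ring
  simp only [h]
  have h2 : (0 : ℝ) < 2 ^ j := by positivity
  rw [integral_const_mul, Measure.integral_comp_mul_left (fun y => dil g 0 k y * dil g 0 l y), abs_of_pos (by positivity),
    smul_eq_mul, mul_inv_cancel_left₀ h2.ne']

lemma IsAtom.memLp_dil {A B : ℝ} {g : ℝ → ℝ} (hg : IsAtom A B g) {p : ℝ} (hp : 1 ≤ p) (j k : ℤ) :
    MemLp (dil g j k) (ENNReal.ofReal p) volume := by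
  refine ⟨hg.aestronglyMeasurable_dil j k, ?_⟩
  have := hg.eLpNorm_sum_dil_le hp j {k} (fun _ => 1)
  simp only [Finset.sum_singleton, one_mul] at this
  exact this.trans_lt ENNReal.ofReal_lt_top

lemma IsAtom.memLp_two_dil {A B : ℝ} {g : ℝ → ℝ} (hg : IsAtom A B g) (j k : ℤ) :
    MemLp (dil g j k) 2 volume := by
  have := hg.memLp_dil one_le_two j k
  simpa using this

lemma mem_translations {A T : ℝ} {j k : ℤ} :
    k ∈ translations A T j ↔ |(k : ℝ)| ≤ (2 : ℝ) ^ (max j 0) * T + A := by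
  rw [translations, Finset.mem_Icc, neg_le, Int.le_floor, Int.le_floor, abs_le]
  push_cast
  rw [neg_le]

/-- If the cell of `k` met `[-T, T]` at a point `x`, then `|k| ≤ |2^j x| + A ≤ 2^j T + A`. -/
lemma IsAtom.mul_dil_eq_zero {A B T : ℝ} {g f : ℝ → ℝ} (hg : IsAtom A B g)
    (hf : Function.support f ⊆ Icc (-T) T) {j k : ℤ} (hj : 0 ≤ j)
    (hk : k ∉ translations A T j) (x : ℝ) : f x * dil g j k x = 0 := by
  by_cases hx : x ∈ cell A j k
  · have : f x = 0 := by
      by_contra h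
      have hxT : |x| ≤ T := abs_le.2 (hf (Function.mem_support.2 h))
      rw [mem_translations, max_eq_left hj, not_le] at hk
      have hx' : |(2 : ℝ) ^ j * x - k| ≤ A := hx
      have h2 : (0 : ℝ) < 2 ^ j := by positivity
      have h3 : |(2 : ℝ) ^ j * x| ≤ (2 : ℝ) ^ j * T := by
        rw [abs_mul, abs_of_pos h2]
        gcongr
      have h4 : |(k : ℝ)| ≤ |(2 : ℝ) ^ j * x| + |(2 : ℝ) ^ j * x - k| := by
        have := abs_sub ((2 : ℝ) ^ j * x) ((2 : ℝ) ^ j * x - k)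
        rwa [sub_sub_cancel] at this
      linarith
    rw [this, zero_mul]
  · rw [hg.dil_eq_zero hx, mul_zero]

lemma IsAtom.coeff_eq_zero {A B T : ℝ} {g f : ℝ → ℝ} (hg : IsAtom A B g)
    (hf : Function.support f ⊆ Icc (-T) T) {j k : ℤ} (hj : 0 ≤ j)
    (hk : k ∉ translations A T j) : coeff f g j k = 0 := by
  simp only [coeff, hg.mul_dil_eq_zero hf hj hk, integral_zero]

/-- The partial wavelet expansion of `f` at level `j`. -/
noncomputable def proj (A T : ℝ) (g : ℝ → ℝ) (j : ℤ) (f : ℝ → ℝ) (x : ℝ) : ℝ :=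
  ∑ k ∈ translations A T j, coeff f g j k * dil g j k x

section L2

variable {A B T : ℝ} {g f : ℝ → ℝ}

lemma IsAtom.memLp_two_proj (hg : IsAtom A B g) (j : ℤ) : MemLp (proj A T g j f) 2 volume :=
  memLp_finsetSum _ fun k _ => (hg.memLp_two_dil j k).const_mul _

lemma inner_toLp {u v : ℝ → ℝ} (hu : MemLp u 2 volume) (hv : MemLp v 2 volume) :
    inner ℝ (hu.toLp u) (hv.toLp v) = ∫ x, u x * v x := by
  rw [MeasureTheory.L2.inner_def]
  refine integral_congr_ae ?_
  filter_upwards [hu.coeFn_toLp, hv.coeFn_toLp] with x h1 h2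
  rw [h1, h2]
  simp [mul_comm]

lemma IsAtom.spanSpace_eq (hg : IsAtom A B g) (j : ℤ) :
    spanSpace g j = (Submodule.span ℝ
      (range fun k => (hg.memLp_two_dil j k).toLp (dil g j k))).topologicalClosure := by
  unfold spanSpace
  congr 2
  ext u
  simp only [mem_ofPred_eq, mem_range]
  refine exists_congr fun k => ?_
  constructor
  · intro h
    exact Lp.ext ((hg.memLp_two_dil j k).coeFn_toLp.trans h.symm)
  · rintro rfl
    exact (hg.memLp_two_dil j k).coeFn_toLp

/-- Compact support leaves only the coefficients in `translations A T j`, so the finite expansion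
`proj` is exactly the orthogonal projection onto the whole space `V_j`. -/
lemma IsAtom.isProjOn_proj (hg : IsAtom A B g) (ho : OrthonormalTranslates g)
    (hf : MemLp f 2 volume) (hT : Function.support f ⊆ Icc (-T) T) {j : ℤ} (hj : 0 ≤ j) :
    IsProjOn (spanSpace g j) (hf.toLp f) ((hg.memLp_two_proj j).toLp (proj A T g j f)) := by
  set e : ℤ → Lp ℝ 2 (volume : Measure ℝ) := fun k => (hg.memLp_two_dil j k).toLp (dil g j k)
  have he : Orthonormal ℝ e := by
    rw [orthonormal_iff_ite]
    intro k l
    rw [inner_toLp, ho.integral_dil_mul_dil]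
  have hin : ∀ k, inner ℝ (e k) (hf.toLp f) = coeff f g j k := by
    intro k
    rw [inner_toLp, coeff]
    simp only [mul_comm]
  have h := isProjOn_sum he (translations A T j) (hf.toLp f) fun k hk => by
    rw [hin, hg.coeff_eq_zero hT hj hk]
  rw [← hg.spanSpace_eq] at h
  have e1 : (hg.memLp_two_proj j).toLp (proj A T g j f) =
      ∑ k ∈ translations A T j, inner ℝ (e k) (hf.toLp f) • e k := by
    refine Lp.ext ?_
    refine (hg.memLp_two_proj j).coeFn_toLp.trans ?_
    refine Filter.EventuallyEq.trans ?_ (Lp.coeFn_finsetSum _ _).symm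
    have h1 : ∀ᵐ x, ∀ k : ℤ, (inner ℝ (e k) (hf.toLp f) • e k : Lp ℝ 2 (volume : Measure ℝ)) x =
        coeff f g j k * dil g j k x := by
      rw [ae_all_iff]
      intro k
      filter_upwards [Lp.coeFn_smul (inner ℝ (e k) (hf.toLp f)) (e k),
        (hg.memLp_two_dil j k).coeFn_toLp] with x h1 h2
      rw [h1, Pi.smul_apply, h2, hin, smul_eq_mul]
    filter_upwards [h1] with x hx
    rw [Finset.sum_apply]
    exact Finset.sum_congr rfl fun k _ => (hx k).symm
  rwa [e1]

end L2

/-! ### The father and the mother wavelet are bounded -/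

lemma FatherAssumption.exists_isAtom {φ : ℝ → ℝ} {N : ℕ} {A : ℝ} (hφ : FatherAssumption φ N)
    (hA : Function.support φ ⊆ Icc (-A) A) : ∃ B, IsAtom A B φ := by
  obtain ⟨Φ, ⟨M, hM⟩, -, hle, -, -⟩ := hφ.majorant
  have hb : ∀ x, |φ x| ≤ M := fun x => (hle x).trans (hM ⟨|x|, abs_nonneg x, rfl⟩)
  refine ⟨M, ?_, (abs_nonneg _).trans (hb 0), hφ.mra.orthonormal.memLp.1, ae_of_all _ hb, hA⟩
  -- If `A < 0` the interval is empty and `φ = 0`, which contradicts the unit norm.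
  by_contra hneg
  have h0 : φ = 0 := by
    rw [← Function.support_eq_empty_iff]
    refine subset_empty_iff.1 (hA.trans ?_)
    rw [Icc_eq_empty (by linarith)]
  have := hφ.mra.orthonormal.inner_eq 0 0
  rw [dil_zero_zero, h0] at this
  simp at this

/-- Being in `V_1` and compactly supported, `ψ` is almost everywhere a finite combination of the
bounded functions `φ_{1k}`. -/
lemma IsMotherWavelet.exists_isAtom {φ ψ : ℝ → ℝ} {A B : ℝ} (hψ : IsMotherWavelet φ ψ)
    (hφ : IsAtom A B φ) (ho : OrthonormalTranslates φ)
    (hA : Function.support ψ ⊆ Icc (-A) A) : ∃ B', IsAtom A B' ψ := by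
  have h1 := hφ.isProjOn_proj ho hψ.orthonormal.memLp hA zero_le_one
  have hmem : hψ.orthonormal.memLp.toLp ψ ∈ spanSpace ψ 0 := by
    refine Submodule.le_topologicalClosure _ (Submodule.subset_span ⟨0, ?_⟩)
    rw [dil_zero_zero]
    exact hψ.orthonormal.memLp.coeFn_toLp
  rw [hψ.span_eq] at hmem
  have h2 := h1.unique (isProjOn_self hmem.1)
  have h3 := (MemLp.toLp_eq_toLp_iff _ _).1 h2
  -- The expansion is taken with `T = A`, because the function expanded is `ψ` itself.
  refine ⟨∑ k ∈ translations A A 1, |coeff ψ φ 1 k| * (B * (2 : ℝ) ^ (((1 : ℤ) : ℝ) / 2)),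
    hφ.nonneg, ?_, hψ.orthonormal.memLp.1, ?_, hA⟩
  · have := hφ.bound_nonneg
    positivity
  · filter_upwards [h3, hφ.ae_abs_dil_le] with x hx hb
    rw [← hx, proj]
    refine (Finset.abs_sum_le_sum_abs _ _).trans (Finset.sum_le_sum fun k _ => ?_)
    rw [abs_mul]
    refine mul_le_mul_of_nonneg_left ((hb 1 k).trans ?_) (abs_nonneg _)
    refine indicator_le_self' (fun _ _ => ?_) x
    have := hφ.bound_nonneg
    positivity

/-! ### The telescoping identity -/

section

variable {A B B' T : ℝ} {φ ψ f : ℝ → ℝ}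

/-- The hypothesis on `ψ` identifies the detail space only between `V_0` and `V_1`; the other levels
are reduced to this one by dilation. -/
lemma proj_one_ae_eq_of_memLp_two (hφ : IsAtom A B φ) (hψ : IsAtom A B' ψ) (hm : GeneratesMRA φ)
    (hw : IsMotherWavelet φ ψ) (hf : MemLp f 2 volume) (hT : Function.support f ⊆ Icc (-T) T) :
    proj A T φ 1 f =ᵐ[volume] fun x => proj A T φ 0 f x + proj A T ψ 0 f x := by
  have h0 := hφ.isProjOn_proj hm.orthonormal hf hT le_rfl
  have h1 := hφ.isProjOn_proj hm.orthonormal hf hT zero_le_one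
  have h2 := hψ.isProjOn_proj hw.orthonormal hf hT le_rfl
  rw [hw.span_eq] at h2
  have h3 := h0.add_of_inf_orthogonal (hm.nested 0) h1 h2
  rw [← MemLp.toLp_add, MemLp.toLp_eq_toLp_iff] at h3
  exact h3

/-- The function `2^{-j/2} f(2^{-j} ·)`. -/
noncomputable def dilInv (f : ℝ → ℝ) (j : ℤ) (x : ℝ) : ℝ :=
  (2 : ℝ) ^ (-(j : ℝ) / 2) * f ((2 : ℝ) ^ (-j) * x)

/-- A change of variables: dilating `f` shifts the levels of its coefficients. -/
lemma coeff_dilInv (f g : ℝ → ℝ) (j i k : ℤ) : coeff (dilInv f j) g i k = coeff f g (j + i) k := by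
  simp only [coeff]
  have h2 : (0 : ℝ) < 2 ^ (-j) := by positivity
  have h : ∀ x, dilInv f j x * dil g i k x = (2 : ℝ) ^ (-j) *
      (fun y => f y * dil g (j + i) k y) ((2 : ℝ) ^ (-j) * x) := by
    intro x
    have e1 : (2 : ℝ) ^ j * ((2 : ℝ) ^ (-j) * x) = x := by
      rw [← mul_assoc, ← zpow_add₀ two_ne_zero, add_neg_cancel, zpow_zero, one_mul]
    have e2 : (2 : ℝ) ^ (-j) * (2 : ℝ) ^ ((j : ℝ) / 2) = (2 : ℝ) ^ (-(j : ℝ) / 2) := by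
      rw [← Real.rpow_intCast, ← Real.rpow_add two_pos]
      congr 1
      push_cast
      ring
    simp only [dil_add, e1, dilInv, ← e2]
    ring
  simp only [h]
  rw [integral_const_mul,
    Measure.integral_comp_mul_left (fun y => f y * dil g (j + i) k y), abs_of_pos (by positivity),
    smul_eq_mul, mul_inv_cancel_left₀ h2.ne']

lemma translations_add (A T : ℝ) {j i : ℤ} (hj : 0 ≤ j) (hi : 0 ≤ i) :
    translations A ((2 : ℝ) ^ j * T) i = translations A T (j + i) := by
  ext k
  rw [mem_translations, mem_translations, max_eq_left hi, max_eq_left (by lia),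
    zpow_add₀ two_ne_zero]
  ring_nf

lemma proj_add (A T : ℝ) (g f : ℝ → ℝ) {j i : ℤ} (hj : 0 ≤ j) (hi : 0 ≤ i) (x : ℝ) :
    proj A T g (j + i) f x = (2 : ℝ) ^ ((j : ℝ) / 2) *
      proj A ((2 : ℝ) ^ j * T) g i (dilInv f j) ((2 : ℝ) ^ j * x) := by
  simp only [proj, translations_add A T hj hi, coeff_dilInv, dil_add, Finset.mul_sum]
  exact Finset.sum_congr rfl fun k _ => by ring

lemma support_dilInv_subset {f : ℝ → ℝ} {T : ℝ} (hT : Function.support f ⊆ Icc (-T) T) (j : ℤ) :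
    Function.support (dilInv f j) ⊆ Icc (-((2 : ℝ) ^ j * T)) ((2 : ℝ) ^ j * T) := by
  intro x hx
  have hx' : f ((2 : ℝ) ^ (-j) * x) ≠ 0 := fun h => hx (by rw [dilInv, h, mul_zero])
  have h := abs_le.2 (hT (Function.mem_support.2 hx'))
  have h2 : (0 : ℝ) < 2 ^ j := by positivity
  rw [zpow_neg, abs_mul, abs_of_pos (by positivity), inv_mul_le_iff₀ h2] at h
  exact abs_le.1 h

lemma memLp_two_dilInv (hf : MemLp f 2 volume) (j : ℤ) : MemLp (dilInv f j) 2 volume := by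
  have h2 : (0 : ℝ) < 2 ^ (-j) := by positivity
  have hq : Measure.QuasiMeasurePreserving (fun x : ℝ => (2 : ℝ) ^ (-j) * x) volume volume := by
    simpa using quasiMeasurePreserving_affine h2.ne' 0
  refine MemLp.const_mul (f := fun x => f ((2 : ℝ) ^ (-j) * x)) ?_ _
  refine (memLp_two_iff_integrable_sq (hf.1.comp_quasiMeasurePreserving hq)).2 ?_
  exact (hf.integrable_sq).comp_mul_left' h2.ne'

lemma proj_succ_ae_eq_of_memLp_two (hφ : IsAtom A B φ) (hψ : IsAtom A B' ψ) (hm : GeneratesMRA φ)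
    (hw : IsMotherWavelet φ ψ) (hf : MemLp f 2 volume) (hT : Function.support f ⊆ Icc (-T) T)
    {j : ℤ} (hj : 0 ≤ j) :
    ∀ᵐ x, proj A T φ (j + 1) f x = proj A T φ j f x + proj A T ψ j f x := by
  have h := proj_one_ae_eq_of_memLp_two hφ hψ hm hw (memLp_two_dilInv hf j)
    (support_dilInv_subset hT j)
  have hq : Measure.QuasiMeasurePreserving (fun x : ℝ => (2 : ℝ) ^ j * x) volume volume := by
    simpa using quasiMeasurePreserving_affine (c := (2 : ℝ) ^ j) (by positivity) 0
  filter_upwards [hq.ae h] with x hx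
  have e : ∀ g, proj A T g j f x = (2 : ℝ) ^ ((j : ℝ) / 2) *
      proj A ((2 : ℝ) ^ j * T) g 0 (dilInv f j) ((2 : ℝ) ^ j * x) := by
    intro g
    have := proj_add A T g f hj le_rfl x
    rwa [add_zero] at this
  rw [proj_add A T φ f hj zero_le_one, e, e, hx]
  ring

lemma IsAtom.integrable_mul_dil {g : ℝ → ℝ} (hg : IsAtom A B g) (hf : Integrable f volume)
    (j k : ℤ) : Integrable (fun x => f x * dil g j k x) volume := by
  refine hf.mul_bdd (c := B * (2 : ℝ) ^ ((j : ℝ) / 2)) (hg.aestronglyMeasurable_dil j k) ?_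
  filter_upwards [hg.ae_abs_dil_le] with x hx
  refine (hx j k).trans (indicator_le_self' (fun _ _ => ?_) x)
  have := hg.bound_nonneg
  positivity

/-- The square of `min f m` is at most `m f`. The truncations let the Hilbert space identities reach
a density that is only integrable. -/
lemma memLp_two_min (hf : Integrable f volume) (h0 : ∀ x, 0 ≤ f x) (m : ℕ) :
    MemLp (fun x => min (f x) m) 2 volume := by
  have hm : AEStronglyMeasurable (fun x => min (f x) (m : ℝ)) volume :=
    (hf.1.aemeasurable.min aemeasurable_const).aestronglyMeasurable
  rw [memLp_two_iff_integrable_sq hm]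
  refine (hf.mul_const (m : ℝ)).mono' (by fun_prop) (ae_of_all _ fun x => ?_)
  have h1 : 0 ≤ min (f x) m := le_min (h0 x) (by positivity)
  rw [Real.norm_of_nonneg (sq_nonneg _), pow_two]
  exact mul_le_mul (min_le_left _ _) (min_le_right _ _) h1 (h0 x)

lemma support_min_subset (hT : Function.support f ⊆ Icc (-T) T) (m : ℕ) :
    Function.support (fun x => min (f x) m) ⊆ Icc (-T) T := by
  refine Subset.trans (fun x hx => ?_) hT
  intro h
  refine hx ?_
  change min (f x) (m : ℝ) = 0
  rw [h]
  exact min_eq_left (by positivity)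

lemma tendsto_min_natCast (y : ℝ) :
    Filter.Tendsto (fun m : ℕ => min y m) Filter.atTop (nhds y) := by
  refine tendsto_const_nhds.congr' ?_
  filter_upwards [Filter.eventually_ge_atTop ⌈y⌉₊] with m hm
  exact (min_eq_left ((Nat.le_ceil y).trans (by exact_mod_cast hm))).symm

lemma abs_min_natCast_le {y : ℝ} (hy : 0 ≤ y) (m : ℕ) : |min y (m : ℝ)| ≤ |y| := by
  rw [abs_of_nonneg hy, abs_of_nonneg (le_min hy (by positivity))]
  exact min_le_left _ _

lemma IsAtom.tendsto_coeff_min {g : ℝ → ℝ} (hg : IsAtom A B g) (hf : Integrable f volume)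
    (h0 : ∀ x, 0 ≤ f x) (j k : ℤ) :
    Filter.Tendsto (fun m : ℕ => coeff (fun x => min (f x) m) g j k) Filter.atTop
      (nhds (coeff f g j k)) := by
  refine tendsto_integral_of_dominated_convergence (fun x => ‖f x * dil g j k x‖)
    (fun m => ?_) (hg.integrable_mul_dil hf j k).norm (fun m => ae_of_all _ fun x => ?_)
    (ae_of_all _ fun x => ?_)
  · exact ((hf.1.aemeasurable.min aemeasurable_const).mul
      (hg.aestronglyMeasurable_dil j k).aemeasurable).aestronglyMeasurable
  · rw [norm_mul, norm_mul]
    exact mul_le_mul_of_nonneg_right (abs_min_natCast_le (h0 x) m) (norm_nonneg _)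
  · exact (tendsto_min_natCast (f x)).mul_const _

lemma IsAtom.tendsto_proj_min {g : ℝ → ℝ} (hg : IsAtom A B g) (hf : Integrable f volume)
    (h0 : ∀ x, 0 ≤ f x) (j : ℤ) (x : ℝ) :
    Filter.Tendsto (fun m : ℕ => proj A T g j (fun x => min (f x) m) x) Filter.atTop
      (nhds (proj A T g j f x)) :=
  tendsto_finsetSum _ fun k _ => (hg.tendsto_coeff_min hf h0 j k).mul_const _

/-- The identity holds for all truncations `min f m` off a common null set. Both sides are finite
sums whose coefficients converge by dominated convergence, so it survives the limit at each such
point. -/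
lemma proj_succ_ae_eq (hφ : IsAtom A B φ) (hψ : IsAtom A B' ψ) (hm : GeneratesMRA φ)
    (hw : IsMotherWavelet φ ψ) (hf : Integrable f volume) (h0 : ∀ x, 0 ≤ f x)
    (hT : Function.support f ⊆ Icc (-T) T) {j : ℤ} (hj : 0 ≤ j) :
    ∀ᵐ x, proj A T φ (j + 1) f x = proj A T φ j f x + proj A T ψ j f x := by
  have h : ∀ᵐ x, ∀ m : ℕ, proj A T φ (j + 1) (fun x => min (f x) m) x =
      proj A T φ j (fun x => min (f x) m) x + proj A T ψ j (fun x => min (f x) m) x := by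
    rw [ae_all_iff]
    intro m
    exact proj_succ_ae_eq_of_memLp_two hφ hψ hm hw (memLp_two_min hf h0 m)
      (support_min_subset hT m) hj
  filter_upwards [h] with x hx
  refine tendsto_nhds_unique (hφ.tendsto_proj_min hf h0 (j + 1) x) ?_
  simp only [hx]
  exact (hφ.tendsto_proj_min hf h0 j x).add (hψ.tendsto_proj_min hf h0 j x)

/-- The projection of a density at level `j₁ + 1` is its wavelet expansion up to the level `j₁`. -/
lemma proj_add_ae_eq_sum (hφ : IsAtom A B φ) (hψ : IsAtom A B' ψ) (hm : GeneratesMRA φ)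
    (hw : IsMotherWavelet φ ψ) (hf : Integrable f volume) (h0 : ∀ x, 0 ≤ f x)
    (hT : Function.support f ⊆ Icc (-T) T) (j m : ℕ) :
    ∀ᵐ x, proj A T φ (j + m : ℕ) f x =
      proj A T φ j f x + ∑ i ∈ Finset.range m, proj A T ψ (j + i : ℕ) f x := by
  induction m with
  | zero => simp
  | succ m ih =>
    have h1 := proj_succ_ae_eq hφ hψ hm hw hf h0 hT (j := (j + m : ℕ)) (by positivity)
    filter_upwards [ih, h1] with x hx hx1
    rw [Finset.sum_range_succ, ← add_assoc (proj A T φ j f x), ← hx, ← hx1]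
    push_cast
    rw [add_assoc]

/-! ### Convergence of the projections -/

/-- The interval does not depend on `j`; this is what later turns `L²` convergence into `L¹`
convergence. -/
lemma IsAtom.support_proj_subset {g : ℝ → ℝ} (hg : IsAtom A B g) {j : ℤ} (hj : 0 ≤ j) :
    Function.support (proj A T g j f) ⊆ Icc (-(T + 2 * A)) (T + 2 * A) := by
  intro x hx
  obtain ⟨k, hk, hne⟩ := Finset.exists_ne_zero_of_sum_ne_zero (Function.mem_support.1 hx)
  have hc : x ∈ cell A j k := by
    by_contra h
    exact hne (by rw [hg.dil_eq_zero h, mul_zero])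
  rw [mem_translations, max_eq_left hj] at hk
  have hc' : |(2 : ℝ) ^ j * x - k| ≤ A := hc
  have h1 : (1 : ℝ) ≤ 2 ^ j := one_le_zpow₀ one_le_two hj
  have h2 : |(2 : ℝ) ^ j * x| ≤ (2 : ℝ) ^ j * T + 2 * A := by
    have h := abs_add_le ((2 : ℝ) ^ j * x - k) k
    rw [sub_add_cancel] at h
    linarith
  rw [abs_mul, abs_of_pos (by positivity)] at h2
  have hA := hg.nonneg
  have h3 : (2 : ℝ) ^ j * |x| ≤ (2 : ℝ) ^ j * (T + 2 * A) := by nlinarith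
  exact abs_le.1 (le_of_mul_le_mul_left h3 (by positivity))

/-- Best approximation: an element of some `V_i` within `ε` of `f` lies in every later `V_j`, and
the projection onto `V_j` is at least as close to `f`. -/
lemma tendsto_eLpNorm_two_proj (hφ : IsAtom A B φ) (hm : GeneratesMRA φ) (hf : MemLp f 2 volume)
    (hT : Function.support f ⊆ Icc (-T) T) :
    Filter.Tendsto (fun j : ℕ => eLpNorm (fun x => f x - proj A T φ j f x) 2 volume) Filter.atTop
      (nhds 0) := by
  have hmono : Monotone (spanSpace φ) := monotone_int_of_le_succ hm.nested
  have hnorm : ∀ j : ℕ, eLpNorm (fun x => f x - proj A T φ j f x) 2 volume =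
      ENNReal.ofReal ‖hf.toLp f - (hφ.memLp_two_proj j).toLp (proj A T φ j f)‖ := by
    intro j
    rw [← MemLp.toLp_sub, Lp.norm_toLp, ENNReal.ofReal_toReal]
    · rfl
    · exact (hf.sub (hφ.memLp_two_proj j)).2.ne
  simp only [hnorm]
  rw [← ENNReal.ofReal_zero]
  refine (ENNReal.continuous_ofReal.tendsto 0).comp ?_
  rw [Metric.tendsto_atTop]
  intro ε hε
  obtain ⟨w, hw, hd⟩ := Metric.dense_iff.1 hm.dense (hf.toLp f) ε hε
  obtain ⟨i, hi⟩ := mem_iUnion.1 hd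
  -- The level `i` found by density may be negative; monotonicity of the spaces still covers it.
  refine ⟨i.toNat, fun j hj => ?_⟩
  rw [Real.dist_0_eq_abs, abs_of_nonneg (norm_nonneg _)]
  have h1 : w ∈ spanSpace φ j := hmono (by lia) hi
  refine ((hφ.isProjOn_proj hm.orthonormal hf hT (j := j) (by positivity)).norm_sub_le h1).trans_lt ?_
  rwa [← dist_eq_norm, dist_comm]

lemma eLpNorm_one_le_of_support {u : ℝ → ℝ} {R : ℝ} (hu : AEStronglyMeasurable u volume)
    (hR : Function.support u ⊆ Icc (-R) R) :
    eLpNorm u 1 volume ≤ eLpNorm u 2 volume * ENNReal.ofReal (2 * R) ^ (1 / 2 : ℝ) := by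
  have h : ∀ p, eLpNorm u p volume = eLpNorm u p (volume.restrict (Icc (-R) R)) := fun p =>
    (eLpNorm_restrict_eq_of_support_subset hR).symm
  rw [h 1, h 2]
  refine (eLpNorm_le_eLpNorm_mul_rpow_measure_univ one_le_two hu.restrict).trans_eq ?_
  congr 1
  rw [Measure.restrict_apply_univ, Real.volume_Icc, sub_neg_eq_add, two_mul]
  norm_num

/-- The bound is uniform in `j`: bounded overlap of the cells makes the `ℓ¹` norm of the
coefficients at most of order `2^{j/2} ‖f‖₁`, and synthesis in `L¹` gives back `2^{-j/2}`. -/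
lemma IsAtom.eLpNorm_one_proj_le {g : ℝ → ℝ} (hg : IsAtom A B g) (hf : Integrable f volume) (j : ℤ) :
    eLpNorm (proj A T g j f) 1 volume ≤
      ENNReal.ofReal (synthConst A B 1 * (B * (2 * A + 1))) * eLpNorm f 1 volume := by
  have hA := hg.nonneg
  have hB := hg.bound_nonneg
  have h := hg.eLpNorm_sum_dil_le le_rfl j (translations A T j) (coeff f g j)
  rw [ENNReal.ofReal_one] at h
  refine h.trans ?_
  simp only [Real.rpow_one, one_div_one]
  have hS : ∑ k ∈ translations A T j, |coeff f g j k| ≤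
      B * (2 : ℝ) ^ ((j : ℝ) / 2) * (2 * A + 1) * ∫ x, |f x| := by
    calc ∑ k ∈ translations A T j, |coeff f g j k|
        ≤ ∑ k ∈ translations A T j, ∫ x, |f x * dil g j k x| :=
          Finset.sum_le_sum fun k _ => abs_integral_le_integral_abs
      _ = ∫ x, ∑ k ∈ translations A T j, |f x * dil g j k x| :=
          (integral_finsetSum _ fun k _ => (hg.integrable_mul_dil hf j k).abs).symm
      _ ≤ ∫ x, B * (2 : ℝ) ^ ((j : ℝ) / 2) * (2 * A + 1) * |f x| := by
          refine integral_mono_ae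
            (integrable_finsetSum _ fun k _ => (hg.integrable_mul_dil hf j k).abs)
            (hf.abs.const_mul _) ?_
          filter_upwards [hg.ae_abs_dil_le] with x hx
          have h1 : ∀ k, |dil g j k x| ≤ B * (2 : ℝ) ^ ((j : ℝ) / 2) *
              (cell A j k).indicator (fun _ => (1 : ℝ)) x := by
            intro k
            refine (hx j k).trans_eq ?_
            by_cases hk : x ∈ cell A j k <;> simp [hk]
          calc ∑ k ∈ translations A T j, |f x * dil g j k x|
              ≤ ∑ k ∈ translations A T j, |f x| * (B * (2 : ℝ) ^ ((j : ℝ) / 2) *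
                  (cell A j k).indicator (fun _ => (1 : ℝ)) x) := by
                refine Finset.sum_le_sum fun k _ => ?_
                rw [abs_mul]
                exact mul_le_mul_of_nonneg_left (h1 k) (abs_nonneg _)
            _ = |f x| * (B * (2 : ℝ) ^ ((j : ℝ) / 2)) * ∑ k ∈ translations A T j,
                  (cell A j k).indicator (fun _ => (1 : ℝ)) x := by
                rw [Finset.mul_sum]
                exact Finset.sum_congr rfl fun k _ => by ring
            _ ≤ |f x| * (B * (2 : ℝ) ^ ((j : ℝ) / 2)) * (2 * A + 1) := by
                gcongr
                exact sum_indicator_cell_le hA j x _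
            _ = _ := by ring
      _ = _ := integral_const_mul _ _
  have hf1 : eLpNorm f 1 volume = ENNReal.ofReal (∫ x, |f x|) := by
    rw [eLpNorm_one_eq_lintegral_enorm, ← ofReal_integral_norm_eq_lintegral_enorm hf]
    rfl
  have hs : 0 ≤ synthConst A B 1 := by
    unfold synthConst
    positivity
  rw [hf1, ← ENNReal.ofReal_mul (by positivity)]
  refine ENNReal.ofReal_le_ofReal ?_
  calc synthConst A B 1 * (2 : ℝ) ^ ((j : ℝ) * (1 / 2 - 1)) *
        ∑ k ∈ translations A T j, |coeff f g j k|
      ≤ synthConst A B 1 * (2 : ℝ) ^ ((j : ℝ) * (1 / 2 - 1)) *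
        (B * (2 : ℝ) ^ ((j : ℝ) / 2) * (2 * A + 1) * ∫ x, |f x|) := by gcongr
    _ = synthConst A B 1 * (B * (2 * A + 1)) * (∫ x, |f x|) *
        ((2 : ℝ) ^ ((j : ℝ) * (1 / 2 - 1)) * (2 : ℝ) ^ ((j : ℝ) / 2)) := by ring
    _ = _ := by
        rw [← Real.rpow_add two_pos]
        have : (j : ℝ) * (1 / 2 - 1) + (j : ℝ) / 2 = 0 := by ring
        rw [this, Real.rpow_zero, mul_one]

lemma tendsto_eLpNorm_one_proj_of_memLp_two (hφ : IsAtom A B φ) (hm : GeneratesMRA φ)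
    (hf : MemLp f 2 volume) (hT : Function.support f ⊆ Icc (-T) T) :
    Filter.Tendsto (fun j : ℕ => eLpNorm (fun x => f x - proj A T φ j f x) 1 volume) Filter.atTop
      (nhds 0) := by
  have h := ENNReal.Tendsto.mul_const (b := ENNReal.ofReal (2 * (T + 2 * A)) ^ (1 / 2 : ℝ))
    (tendsto_eLpNorm_two_proj hφ hm hf hT) (Or.inr (by finiteness))
  rw [zero_mul] at h
  refine tendsto_of_tendsto_of_tendsto_of_le_of_le tendsto_const_nhds h (fun _ => zero_le)
    fun j => eLpNorm_one_le_of_support (hf.1.sub (hφ.memLp_two_proj j).1) ?_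
  refine (Function.support_sub _ _).trans (union_subset (hT.trans ?_)
    (hφ.support_proj_subset (by positivity)))
  have := hφ.nonneg
  exact Icc_subset_Icc (by linarith) (by linarith)

lemma IsAtom.proj_sub {g f₁ f₂ : ℝ → ℝ} (hg : IsAtom A B g) (h₁ : Integrable f₁ volume)
    (h₂ : Integrable f₂ volume) (j : ℤ) (x : ℝ) :
    proj A T g j (fun y => f₁ y - f₂ y) x = proj A T g j f₁ x - proj A T g j f₂ x := by
  simp only [proj, ← Finset.sum_sub_distrib]
  refine Finset.sum_congr rfl fun k _ => ?_
  rw [← sub_mul]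
  congr 1
  simp only [coeff, sub_mul]
  exact integral_sub (hg.integrable_mul_dil h₁ j k) (hg.integrable_mul_dil h₂ j k)

lemma tendsto_eLpNorm_one_sub_min (hf : Integrable f volume) (h0 : ∀ x, 0 ≤ f x) :
    Filter.Tendsto (fun m : ℕ => eLpNorm (fun x => f x - min (f x) m) 1 volume) Filter.atTop
      (nhds 0) := by
  simp only [eLpNorm_one_eq_lintegral_enorm]
  have h := tendsto_lintegral_of_dominated_convergence' (μ := volume)
    (F := fun (m : ℕ) x => ‖f x - min (f x) m‖ₑ) (f := fun _ => 0) (fun x => ‖f x‖ₑ)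
    (fun m => ((hf.1.aemeasurable.sub (hf.1.aemeasurable.min aemeasurable_const))).enorm)
    (fun m => ae_of_all _ fun x => ?_) hf.2.ne (ae_of_all _ fun x => ?_)
  · simpa using h
  · simp only [Real.enorm_eq_ofReal_abs]
    refine ENNReal.ofReal_le_ofReal ?_
    have h1 : 0 ≤ min (f x) (m : ℝ) := le_min (h0 x) (by positivity)
    have h2 := min_le_left (f x) (m : ℝ)
    rw [abs_of_nonneg (h0 x), abs_of_nonneg (by linarith)]
    linarith
  · have h1 := ((tendsto_const_nhds (x := f x)).sub (tendsto_min_natCast (f x))).enorm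
    simpa using h1

/-- The wavelet projections of an integrable function with compact support converge in `L¹`. -/
lemma tendsto_eLpNorm_one_proj (hφ : IsAtom A B φ) (hm : GeneratesMRA φ)
    (hf : Integrable f volume) (h0 : ∀ x, 0 ≤ f x) (hT : Function.support f ⊆ Icc (-T) T) :
    Filter.Tendsto (fun j : ℕ => eLpNorm (fun x => proj A T φ j f x - f x) 1 volume) Filter.atTop
      (nhds 0) := by
  set K := ENNReal.ofReal (synthConst A B 1 * (B * (2 * A + 1))) with hK
  have hmin := tendsto_eLpNorm_one_sub_min hf h0
  have hlim : Filter.Tendsto (fun m : ℕ => (1 + K) *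
      eLpNorm (fun x => f x - min (f x) m) 1 volume) Filter.atTop (nhds 0) := by
    have := ENNReal.Tendsto.const_mul (a := 1 + K) hmin (Or.inr (by finiteness))
    rwa [mul_zero] at this
  rw [ENNReal.tendsto_nhds_zero] at hlim ⊢
  intro ε hε
  have hε2 : 0 < ε / 2 := ENNReal.half_pos hε.ne'
  obtain ⟨m, hm'⟩ := (hlim (ε / 2) hε2).exists
  set g : ℝ → ℝ := fun x => min (f x) m with hg
  have hgint : Integrable g volume :=
    hf.mono (hf.1.aemeasurable.min aemeasurable_const).aestronglyMeasurable
      (ae_of_all _ fun x => abs_min_natCast_le (h0 x) m)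
  have h2 := tendsto_eLpNorm_one_proj_of_memLp_two hφ hm (memLp_two_min hf h0 m)
    (support_min_subset hT m)
  rw [ENNReal.tendsto_nhds_zero] at h2
  filter_upwards [h2 (ε / 2) hε2] with j hj
  have hdint : Integrable (fun x => f x - g x) volume := hf.sub hgint
  -- With `g` the truncation, the first and last terms are controlled uniformly in `j` by `(1 + K)
  -- ‖f - g‖₁`, and the middle one tends to `0` by the `L²` theory.
  have hsplit : (fun x => proj A T φ j f x - f x) = (proj A T φ j (fun x => f x - g x) -
      fun x => g x - proj A T φ j g x) - fun x => f x - g x := by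
    ext x
    simp only [Pi.sub_apply, hφ.proj_sub hf hgint]
    ring
  have m1 : AEStronglyMeasurable (proj A T φ j (fun x => f x - g x)) volume :=
    (hφ.memLp_two_proj j).1
  have m2 : AEStronglyMeasurable (fun x => g x - proj A T φ j g x) volume :=
    hgint.1.sub (hφ.memLp_two_proj j).1
  rw [hsplit]
  refine (eLpNorm_sub_le (m1.sub m2) hdint.1 le_rfl).trans ?_
  calc _ ≤ (eLpNorm (proj A T φ j (fun x => f x - g x)) 1 volume +
        eLpNorm (fun x => g x - proj A T φ j g x) 1 volume) +
          eLpNorm (fun x => f x - g x) 1 volume := by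
        gcongr
        exact eLpNorm_sub_le m1 m2 le_rfl
    _ ≤ (K * eLpNorm (fun x => f x - g x) 1 volume + ε / 2) +
          eLpNorm (fun x => f x - g x) 1 volume := by
        gcongr
        exact hφ.eLpNorm_one_proj_le hdint j
    _ = (1 + K) * eLpNorm (fun x => f x - g x) 1 volume + ε / 2 := by ring
    _ ≤ ε / 2 + ε / 2 := by gcongr
    _ = ε := ENNReal.add_halves ε

end

/-! ### The approximation error -/

lemma synthConst_nonneg {A B : ℝ} (hA : 0 ≤ A) (hB : 0 ≤ B) (p : ℝ) : 0 ≤ synthConst A B p := by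
  unfold synthConst
  positivity

lemma ofReal_sum_rpow_le_eLpNorm_count {p : ℝ} (hp : 0 < p) (a : ℤ → ℝ) (S : Finset ℤ) :
    ENNReal.ofReal ((∑ k ∈ S, |a k| ^ p) ^ (1 / p)) ≤
      eLpNorm a (ENNReal.ofReal p) Measure.count := by
  rw [eLpNorm_eq_lintegral_rpow_enorm_toReal (by simpa using hp) ENNReal.ofReal_ne_top,
    ENNReal.toReal_ofReal hp.le, lintegral_count,
    ← ENNReal.ofReal_rpow_of_nonneg (Finset.sum_nonneg fun k _ => by positivity) (by positivity)]
  gcongr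
  rw [ENNReal.ofReal_sum_of_nonneg fun k _ => by positivity]
  refine le_trans (Finset.sum_le_sum fun k _ => ?_) (ENNReal.sum_le_tsum S)
  rw [Real.enorm_eq_ofReal_abs, ENNReal.ofReal_rpow_of_nonneg (abs_nonneg _) hp.le]

section

variable {φ ψ f : ℝ → ℝ} {A B B' T s p L : ℝ} {q : ℝ≥0∞}

lemma father_coeff_le_of_besovJ_le (hp : 0 < p) (hL : 0 ≤ L)
    (hf : besovJ φ ψ s p q f ≤ ENNReal.ofReal L) (S : Finset ℤ) :
    (∑ k ∈ S, |coeff f φ 0 k| ^ p) ^ (1 / p) ≤ L := by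
  rw [← ENNReal.ofReal_le_ofReal_iff hL]
  exact (ofReal_sum_rpow_le_eLpNorm_count hp _ S).trans (le_self_add.trans hf)

/-- A single term of a sequence is at most its `ℓ^q` norm, also for `q = ∞`. -/
lemma mother_coeff_le_of_besovJ_le (hp : 0 < p) (hq : 1 ≤ q) (hL : 0 ≤ L)
    (hf : besovJ φ ψ s p q f ≤ ENNReal.ofReal L) (j : ℕ) (S : Finset ℤ) :
    (2 : ℝ) ^ ((j : ℝ) * (s + 1 / 2 - 1 / p)) * (∑ k ∈ S, |coeff f ψ j k| ^ p) ^ (1 / p) ≤ L := by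
  rw [← ENNReal.ofReal_le_ofReal_iff hL, ENNReal.ofReal_mul (by positivity)]
  have h1 := enorm_le_eLpNorm_count (p := q) (fun j : ℕ =>
    ENNReal.ofReal ((2 : ℝ) ^ ((j : ℝ) * (s + 1 / 2 - 1 / p))) *
      eLpNorm (fun k : ℤ => coeff f ψ j k) (ENNReal.ofReal p) Measure.count) j
      (zero_lt_one.trans_le hq).ne'
  rw [enorm_eq_self] at h1
  calc _ ≤ ENNReal.ofReal ((2 : ℝ) ^ ((j : ℝ) * (s + 1 / 2 - 1 / p))) *
        eLpNorm (fun k : ℤ => coeff f ψ j k) (ENNReal.ofReal p) Measure.count := by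
        gcongr
        exact ofReal_sum_rpow_le_eLpNorm_count hp _ S
    _ ≤ _ := h1
    _ ≤ besovJ φ ψ s p q f := le_add_self
    _ ≤ _ := hf

lemma eLpNorm_proj_father_le (hφ : IsAtom A B φ) (hp : 1 ≤ p) (hL : 0 ≤ L)
    (hf : besovJ φ ψ s p q f ≤ ENNReal.ofReal L) :
    eLpNorm (proj A T φ 0 f) (ENNReal.ofReal p) volume ≤
      ENNReal.ofReal (synthConst A B p * L) := by
  refine (hφ.eLpNorm_sum_dil_le hp 0 _ _).trans (ENNReal.ofReal_le_ofReal ?_)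
  have := synthConst_nonneg hφ.nonneg hφ.bound_nonneg p
  have h := father_coeff_le_of_besovJ_le (by linarith) hL hf (translations A T 0)
  simp only [Int.cast_zero, zero_mul, Real.rpow_zero, mul_one]
  gcongr

/-- Synthesis costs `2^{j(1/2-1/p)}` and the Besov weight is `2^{j(s+1/2-1/p)}`; the quotient is
`2^{-js}`. -/
lemma eLpNorm_proj_mother_le (hψ : IsAtom A B' ψ) (hp : 1 ≤ p) (hq : 1 ≤ q) (hL : 0 ≤ L)
    (hf : besovJ φ ψ s p q f ≤ ENNReal.ofReal L) (j : ℕ) :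
    eLpNorm (proj A T ψ j f) (ENNReal.ofReal p) volume ≤
      ENNReal.ofReal (synthConst A B' p * L * (2 : ℝ) ^ (-(j * s))) := by
  refine (hψ.eLpNorm_sum_dil_le hp j _ _).trans (ENNReal.ofReal_le_ofReal ?_)
  have := synthConst_nonneg hψ.nonneg hψ.bound_nonneg p
  have h := mother_coeff_le_of_besovJ_le (by linarith) hq hL hf j (translations A T j)
  have e : (2 : ℝ) ^ (((j : ℤ) : ℝ) * (1 / 2 - 1 / p)) =
      (2 : ℝ) ^ (-(j * s)) * (2 : ℝ) ^ ((j : ℝ) * (s + 1 / 2 - 1 / p)) := by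
    rw [← Real.rpow_add two_pos, Int.cast_natCast]
    congr 1
    ring
  rw [e]
  calc _ = synthConst A B' p * (2 : ℝ) ^ (-(j * s)) * ((2 : ℝ) ^ ((j : ℝ) * (s + 1 / 2 - 1 / p)) *
        (∑ k ∈ translations A T j, |coeff f ψ j k| ^ p) ^ (1 / p)) := by ring
    _ ≤ synthConst A B' p * (2 : ℝ) ^ (-(j * s)) * L := by gcongr
    _ = _ := by ring

/-- The constant in the bound of the approximation error. -/
noncomputable def biasConst (A B s p L : ℝ) : ℝ := synthConst A B p * L * (1 - (2 : ℝ) ^ (-s))⁻¹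

lemma two_rpow_neg_lt_one (hs : 0 < s) : (2 : ℝ) ^ (-s) < 1 :=
  Real.rpow_lt_one_of_one_lt_of_neg one_lt_two (by linarith)

lemma biasConst_nonneg (hA : 0 ≤ A) (hB : 0 ≤ B) (hs : 0 < s) (hL : 0 ≤ L) :
    0 ≤ biasConst A B s p L := by
  have := synthConst_nonneg hA hB p
  have : 0 < 1 - (2 : ℝ) ^ (-s) := by linarith [two_rpow_neg_lt_one hs]
  unfold biasConst
  positivity

lemma sum_two_rpow_neg_le (hs : 0 < s) (j m : ℕ) :
    ∑ i ∈ Finset.range m, (2 : ℝ) ^ (-(((j + i : ℕ) : ℝ) * s)) ≤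
      (2 : ℝ) ^ (-((j : ℝ) * s)) * (1 - (2 : ℝ) ^ (-s))⁻¹ := by
  have h0 : (0 : ℝ) ≤ (2 : ℝ) ^ (-s) := by positivity
  have e : ∀ i : ℕ, (2 : ℝ) ^ (-(((j + i : ℕ) : ℝ) * s)) =
      (2 : ℝ) ^ (-((j : ℝ) * s)) * ((2 : ℝ) ^ (-s)) ^ i := by
    intro i
    rw [← Real.rpow_natCast, ← Real.rpow_mul two_pos.le, ← Real.rpow_add two_pos]
    congr 1
    push_cast
    ring
  simp only [e, ← Finset.mul_sum]
  gcongr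
  have hs1 := two_rpow_neg_lt_one hs
  have h := (summable_geometric_of_lt_one h0 hs1).sum_le_tsum (Finset.range m)
    (fun i _ => by positivity)
  rwa [tsum_geometric_of_lt_one h0 hs1] at h

/-- The approximation error of the wavelet projections in a Besov ball. -/
lemma eLpNorm_sub_proj_le (hφ : IsAtom A B φ) (hψ : IsAtom A B' ψ) (hm : GeneratesMRA φ)
    (hw : IsMotherWavelet φ ψ) (hs : 0 < s) (hp : 1 ≤ p) (hq : 1 ≤ q) (hL : 0 ≤ L)
    (hf : MemDensityClass φ ψ s p q L T f) (j : ℕ) :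
    eLpNorm (fun x => f x - proj A T φ j f x) (ENNReal.ofReal p) volume ≤
      ENNReal.ofReal (biasConst A B' s p L * (2 : ℝ) ^ (-(j * s))) := by
  have hK := synthConst_nonneg hψ.nonneg hψ.bound_nonneg p
  have hpm : ∀ i : ℤ, AEStronglyMeasurable (proj A T φ i f) volume := fun i =>
    (hφ.memLp_two_proj i).1
  have hpm' : ∀ i : ℤ, AEStronglyMeasurable (proj A T ψ i f) volume := fun i =>
    (hψ.memLp_two_proj i).1
  have hlim := tendsto_eLpNorm_one_proj hφ hm hf.integrable hf.nonneg hf.support_subset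
  -- `L¹` convergence gives convergence in measure, along which the `L^p` norm is lower
  -- semicontinuous. A uniform bound for the partial sums thus passes to the limit, without knowing
  -- in advance that `f` is in `L^p`.
  have hmeas : TendstoInMeasure volume
      (fun (m : ℕ) x => proj A T φ (j + m : ℕ) f x - proj A T φ j f x) Filter.atTop
      (fun x => f x - proj A T φ j f x) := by
    refine tendstoInMeasure_of_tendsto_eLpNorm one_ne_zero (fun m => (hpm _).sub (hpm _))
      (hf.integrable.1.sub (hpm _)) ?_
    have h := hlim.comp (Filter.tendsto_add_atTop_nat j)
    refine h.congr fun m => ?_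
    simp only [Function.comp_apply]
    congr 1
    ext x
    simp only [Pi.sub_apply, add_comm m j]
    ring
  refine eLpNorm_le_of_tendstoInMeasure (Filter.Eventually.of_forall fun m => ?_) hmeas
    (fun m => (hpm _).sub (hpm _))
  have hae : (fun x => proj A T φ (j + m : ℕ) f x - proj A T φ j f x) =ᵐ[volume]
      ∑ i ∈ Finset.range m, proj A T ψ (j + i : ℕ) f := by
    filter_upwards [proj_add_ae_eq_sum hφ hψ hm hw hf.integrable hf.nonneg hf.support_subset j m]
      with x hx
    rw [hx, Finset.sum_apply]
    ring
  rw [eLpNorm_congr_ae hae]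
  refine (eLpNorm_sum_le (fun i _ => hpm' _) (by
    rw [← ENNReal.ofReal_one]; exact ENNReal.ofReal_le_ofReal hp)).trans ?_
  refine (Finset.sum_le_sum fun i _ => eLpNorm_proj_mother_le hψ hp hq hL hf.besov (j + i)).trans ?_
  rw [← ENNReal.ofReal_sum_of_nonneg fun i _ => by positivity, ← Finset.mul_sum]
  refine ENNReal.ofReal_le_ofReal ?_
  calc _ ≤ synthConst A B' p * L * ((2 : ℝ) ^ (-((j : ℝ) * s)) * (1 - (2 : ℝ) ^ (-s))⁻¹) := by
        gcongr
        exact sum_two_rpow_neg_le hs j m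
    _ = _ := by
        rw [biasConst]
        ring

/-- The densities in a Besov ball are bounded in `L^p`. -/
lemma eLpNorm_density_le (hφ : IsAtom A B φ) (hψ : IsAtom A B' ψ) (hm : GeneratesMRA φ)
    (hw : IsMotherWavelet φ ψ) (hs : 0 < s) (hp : 1 ≤ p) (hq : 1 ≤ q) (hL : 0 ≤ L)
    (hf : MemDensityClass φ ψ s p q L T f) :
    eLpNorm f (ENNReal.ofReal p) volume ≤
      ENNReal.ofReal (biasConst A B' s p L + synthConst A B p * L) := by
  have hK := synthConst_nonneg hφ.nonneg hφ.bound_nonneg p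
  have e : f = (fun x => f x - proj A T φ (0 : ℕ) f x) + proj A T φ 0 f := by
    ext x
    simp
  have hm0 : AEStronglyMeasurable (proj A T φ 0 f) volume := (hφ.memLp_two_proj 0).1
  rw [e, ENNReal.ofReal_add (biasConst_nonneg hψ.nonneg hψ.bound_nonneg hs hL) (by positivity)]
  refine (eLpNorm_add_le (hf.integrable.1.sub (by simpa using hm0)) hm0 (by
    rw [← ENNReal.ofReal_one]; exact ENNReal.ofReal_le_ofReal hp)).trans ?_
  refine add_le_add ?_ (eLpNorm_proj_father_le hφ hp hL hf.besov)
  have h0 : eLpNorm (fun x => f x - proj A T φ (0 : ℕ) f x) (ENNReal.ofReal p) volume ≤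
      ENNReal.ofReal (biasConst A B' s p L) := by
    simpa using eLpNorm_sub_proj_le hφ hψ hm hw hs hp hq hL hf 0
  exact h0

end

/-! ### The stochastic error of one empirical coefficient -/

lemma add_rpow_le_two_rpow_mul {x y r : ℝ} (hx : 0 ≤ x) (hy : 0 ≤ y) (hr : 0 ≤ r) :
    (x + y) ^ r ≤ 2 ^ r * (x ^ r + y ^ r) := by
  have hm : 0 ≤ max x y := le_max_of_le_left hx
  calc (x + y) ^ r ≤ (2 * max x y) ^ r := by
        gcongr
        linarith [le_max_left x y, le_max_right x y]
    _ = 2 ^ r * (max x y) ^ r := Real.mul_rpow two_pos.le hm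
    _ ≤ 2 ^ r * (x ^ r + y ^ r) := by
        gcongr
        have := Real.rpow_nonneg hx r
        have := Real.rpow_nonneg hy r
        rcases max_cases x y with ⟨h, -⟩ | ⟨h, -⟩ <;> rw [h] <;> linarith

section

variable {Ω : Type*} [MeasurableSpace Ω] {P : Measure Ω}
  {f h : ℝ → ℝ} {E : Set ℝ} {b : ℝ} {X : Ω → ℝ}

lemma integral_comp_of_hasLaw_density (hX : HasLaw X (volume.withDensity fun x => ENNReal.ofReal (f x)) P)
    (hf : Integrable f volume) (h0 : ∀ x, 0 ≤ f x) {F : ℝ → ℝ}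
    (hF : AEStronglyMeasurable F volume) : ∫ ω, F (X ω) ∂P = ∫ x, f x * F x := by
  have h1 := hX.integral_comp (hF.mono_ac (withDensity_absolutelyContinuous _ _))
  simp only [Function.comp_def] at h1
  rw [h1, integral_withDensity_eq_integral_toReal_smul₀ hf.1.aemeasurable.ennreal_ofReal
    (ae_of_all _ fun x => ENNReal.ofReal_lt_top)]
  simp only [ENNReal.toReal_ofReal (h0 _), smul_eq_mul]

lemma aemeasurable_comp_of_hasLaw_density
    (hX : HasLaw X (volume.withDensity fun x => ENNReal.ofReal (f x)) P)
    (hh : AEStronglyMeasurable h volume) : AEMeasurable h (P.map X) := by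
  rw [hX.map_eq]
  exact (hh.mono_ac (withDensity_absolutelyContinuous _ _)).aemeasurable

/-- The mass of `E` is kept rather than bounded by `1`: for the cells at one level it is what makes
the sum over `k` small. -/
lemma integral_abs_comp_rpow_le
    (hX : HasLaw X (volume.withDensity fun x => ENNReal.ofReal (f x)) P)
    (hf : Integrable f volume) (h0 : ∀ x, 0 ≤ f x)
    (hh : AEStronglyMeasurable h volume) (hE : MeasurableSet E)
    (hbd : ∀ᵐ x, |h x| ≤ E.indicator (fun _ => b) x) {r : ℝ} (hr : 0 < r) :
    ∫ ω, |h (X ω)| ^ r ∂P ≤ b ^ r * ∫ x in E, f x := by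
  have hm : AEStronglyMeasurable (fun x => |h x| ^ r) volume :=
    (hh.norm.aemeasurable.pow_const r).aestronglyMeasurable
  rw [integral_comp_of_hasLaw_density (F := fun x => |h x| ^ r) hX hf h0 hm, ← integral_indicator hE,
    ← integral_const_mul]
  refine integral_mono_of_nonneg (ae_of_all _ fun x => mul_nonneg (h0 x) (by positivity))
    ((hf.indicator hE).const_mul _) ?_
  filter_upwards [hbd] with x hx
  by_cases hxE : x ∈ E
  · rw [indicator_of_mem hxE] at hx ⊢
    rw [mul_comm]
    exact mul_le_mul_of_nonneg_right (Real.rpow_le_rpow (abs_nonneg _) hx hr.le) (h0 x)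
  · rw [indicator_of_notMem hxE] at hx ⊢
    have : |h x| = 0 := le_antisymm hx (abs_nonneg _)
    rw [this, Real.zero_rpow hr.ne']
    simp

variable [IsProbabilityMeasure P]

lemma memLp_comp_of_hasLaw_density
    (hX : HasLaw X (volume.withDensity fun x => ENNReal.ofReal (f x)) P)
    (hh : AEStronglyMeasurable h volume) (hb : 0 ≤ b) (hbd : ∀ᵐ x, |h x| ≤ E.indicator (fun _ => b) x)
    (r : ℝ≥0∞) : MemLp (fun ω => h (X ω)) r P := by
  refine MemLp.of_bound ((aemeasurable_comp_of_hasLaw_density hX hh).comp_aemeasurable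
    hX.aemeasurable).aestronglyMeasurable b ?_
  have h1 : ∀ᵐ x ∂(P.map X), |h x| ≤ b := by
    rw [hX.map_eq]
    refine (withDensity_absolutelyContinuous _ _).ae_le ?_
    filter_upwards [hbd] with x hx
    exact hx.trans (indicator_le_self' (fun _ _ => hb) x)
  exact ae_of_ae_map hX.aemeasurable h1

/-- Jensen's inequality bounds `|E Y|^p` by `E|Y|^p`, so centring costs only a constant. -/
lemma integral_abs_sub_integral_rpow_le {Y : Ω → ℝ} {p : ℝ} (hp : 1 ≤ p)
    (hY : MemLp Y (ENNReal.ofReal p) P) :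
    ∫ ω, |Y ω - ∫ ω', Y ω' ∂P| ^ p ∂P ≤ 2 ^ p * (2 * ∫ ω, |Y ω| ^ p ∂P) := by
  have hp0 : 0 < p := by linarith
  set m := ∫ ω', Y ω' ∂P
  have hYp := (integral_abs_rpow_le_of_memLp hp0.le le_rfl hp0 hY).1
  have hY1 := (integral_abs_rpow_le_of_memLp zero_le_one hp hp0 hY).2
  simp only [Real.rpow_one] at hY1
  have hm : |m| ^ p ≤ ∫ ω, |Y ω| ^ p ∂P := by
    have hnn : 0 ≤ ∫ ω, |Y ω| ^ p ∂P := integral_nonneg fun ω => by positivity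
    calc |m| ^ p ≤ ((∫ ω, |Y ω| ^ p ∂P) ^ (1 / p)) ^ p := by
          gcongr
          exact abs_integral_le_integral_abs.trans hY1
      _ = _ := by rw [← Real.rpow_mul hnn, one_div_mul_cancel hp0.ne', Real.rpow_one]
  calc ∫ ω, |Y ω - m| ^ p ∂P ≤ ∫ ω, 2 ^ p * (|Y ω| ^ p + |m| ^ p) ∂P := by
        refine integral_mono_of_nonneg (ae_of_all _ fun ω => by positivity)
          ((hYp.add (integrable_const _)).const_mul _) (ae_of_all _ fun ω => ?_)
        refine le_trans ?_ (add_rpow_le_two_rpow_mul (abs_nonneg _) (abs_nonneg _) hp0.le)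
        exact Real.rpow_le_rpow (abs_nonneg _) (abs_sub _ _) hp0.le
    _ = 2 ^ p * (∫ ω, |Y ω| ^ p ∂P + |m| ^ p) := by
        rw [integral_const_mul, integral_add hYp (integrable_const _)]
        simp
    _ ≤ _ := by
        gcongr
        linarith

/-- The bound for the moment of order `p` of the error of an empirical coefficient based on `n`
private views, in terms of the bound `b` for the basis function, the mass `a` of its support and
the noise level `τ`. -/
noncomputable def coeffErrorBound (p : ℝ) (n : ℕ) (b a τ : ℝ) : ℝ :=
  (1 + momentConst p ^ (p / 2)) * ((b ^ 2 * a + τ ^ 2 * laplaceMoment 2) / n) ^ (p / 2) +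
    if p ≤ 2 then 0 else momentConst p * ((n : ℝ) ^ (1 - p) *
      (2 ^ p * (2 * (b ^ p * a)) + |τ| ^ p * laplaceMoment p))

/-- The error is a sum of `2n` independent centred variables, `(h(X_i) - β)/n` and `τ Y_i/n`, to
which the moment inequalities apply. For `p ≤ 2` only the variance matters. -/
lemma integral_abs_coeff_error_rpow_le {n : ℕ} (hn : 1 ≤ n) {p : ℝ} (hp : 1 ≤ p)
    {X Y : Fin n → Ω → ℝ}
    (hX : ∀ i, HasLaw (X i) (volume.withDensity fun x => ENNReal.ofReal (f x)) P)
    (hY : ∀ i, HasLaw (Y i) laplaceOne P)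
    (hind : iIndepFun (β := fun _ : Fin n ⊕ Fin n => ℝ) (Sum.elim X Y) P)
    (hf : Integrable f volume) (h0 : ∀ x, 0 ≤ f x)
    (hh : AEStronglyMeasurable h volume) (hE : MeasurableSet E) (hb : 0 ≤ b)
    (hbd : ∀ᵐ x, |h x| ≤ E.indicator (fun _ => b) x) (τ : ℝ) :
    Integrable (fun ω => |(1 / (n : ℝ)) * ∑ i, (h (X i ω) + τ * Y i ω) - ∫ x, f x * h x| ^ p) P ∧
    ∫ ω, |(1 / (n : ℝ)) * ∑ i, (h (X i ω) + τ * Y i ω) - ∫ x, f x * h x| ^ p ∂P ≤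
      coeffErrorBound p n b (∫ x in E, f x) τ := by
  have hn0 : (0 : ℝ) < n := by exact_mod_cast hn
  have hp0 : 0 < p := by linarith
  set β := ∫ x, f x * h x with hβ
  set a := ∫ x in E, f x with ha
  have ha0 : 0 ≤ a := integral_nonneg fun x => h0 x
  have hXm : ∀ i r, MemLp (fun ω => h (X i ω)) r P := fun i r =>
    memLp_comp_of_hasLaw_density (hX i) hh hb hbd r
  have hXβ : ∀ i, ∫ ω, h (X i ω) ∂P = β := fun i =>
    integral_comp_of_hasLaw_density (hX i) hf h0 hh
  let G : Fin n ⊕ Fin n → ℝ → ℝ := Sum.elim (fun _ x => (1 / (n : ℝ)) * (h x - β))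
    (fun _ y => (1 / (n : ℝ)) * (τ * y))
  let ξ : Fin n ⊕ Fin n → Ω → ℝ := fun t ω => G t (Sum.elim X Y t ω)
  have hξind : iIndepFun ξ P := by
    refine hind.comp₀ G ?_ ?_
    · rintro (i | i)
      · exact (hX i).aemeasurable
      · exact (hY i).aemeasurable
    · rintro (i | i)
      · exact ((aemeasurable_comp_of_hasLaw_density (hX i) hh).sub_const β).const_mul _
      · exact (Measurable.aemeasurable (by fun_prop : Measurable fun y : ℝ => (1 / (n : ℝ)) * (τ * y)))
  have hξmem : ∀ r : ℝ, 0 < r → ∀ t, MemLp (ξ t) (ENNReal.ofReal r) P := by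
    rintro r hr (i | i)
    · exact ((hXm i _).sub (memLp_const β)).const_mul _
    · exact ((memLp_of_hasLaw_laplaceOne (hY i) hr).const_mul τ).const_mul _
  have hξmean : ∀ t, ∫ ω, ξ t ω ∂P = 0 := by
    rintro (i | i)
    · change ∫ ω, (1 / (n : ℝ)) * (h (X i ω) - β) ∂P = 0
      rw [integral_const_mul, integral_sub ((hXm i 1).integrable le_rfl) (integrable_const _), hXβ]
      simp
    · change ∫ ω, (1 / (n : ℝ)) * (τ * Y i ω) ∂P = 0
      rw [integral_const_mul, integral_const_mul, integral_of_hasLaw_laplaceOne (hY i)]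
      simp
  have hsum : ∀ ω, (1 / (n : ℝ)) * ∑ i, (h (X i ω) + τ * Y i ω) - β = ∑ t, ξ t ω := by
    intro ω
    rw [Fintype.sum_sum_type]
    change _ = ∑ i, (1 / (n : ℝ)) * (h (X i ω) - β) + ∑ i, (1 / (n : ℝ)) * (τ * Y i ω)
    rw [← Finset.mul_sum, ← Finset.mul_sum, ← mul_add, Finset.sum_add_distrib,
      Finset.sum_sub_distrib]
    simp only [Finset.sum_const, Finset.card_univ, Fintype.card_fin, nsmul_eq_mul]
    field_simp
    ring
  simp only [hsum]
  have hV : ∑ t, ∫ ω, ξ t ω ^ 2 ∂P ≤ (b ^ 2 * a + τ ^ 2 * laplaceMoment 2) / n := by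
    rw [Fintype.sum_sum_type]
    have h1 : ∀ i : Fin n, ∫ ω, ξ (Sum.inl i) ω ^ 2 ∂P ≤ (1 / (n : ℝ)) ^ 2 * (b ^ 2 * a) := by
      intro i
      change ∫ ω, ((1 / (n : ℝ)) * (h (X i ω) - β)) ^ 2 ∂P ≤ _
      simp only [mul_pow]
      rw [integral_const_mul]
      gcongr
      -- The variance is at most the second moment, so the centring is dropped without loss.
      have hv := variance_le_expectation_sq (hXm i 2).1
      rw [variance_eq_integral (hXm i 2).1.aemeasurable] at hv
      rw [hXβ] at hv
      refine hv.trans ?_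
      have := integral_abs_comp_rpow_le (hX i) hf h0 hh hE hbd (r := 2) two_pos
      simpa [Real.rpow_two, sq_abs] using this
    have h2 : ∀ i : Fin n, ∫ ω, ξ (Sum.inr i) ω ^ 2 ∂P =
        (1 / (n : ℝ)) ^ 2 * (τ ^ 2 * laplaceMoment 2) := by
      intro i
      change ∫ ω, ((1 / (n : ℝ)) * (τ * Y i ω)) ^ 2 ∂P = _
      simp only [mul_pow]
      rw [integral_const_mul, integral_const_mul,
        ← integral_abs_rpow_of_hasLaw_laplaceOne (hY i) 2]
      simp only [Real.rpow_two, sq_abs]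
    refine (add_le_add (Finset.sum_le_sum fun i _ => h1 i)
      (Finset.sum_le_sum fun i _ => (h2 i).le)).trans_eq ?_
    simp only [Finset.sum_const, Finset.card_univ, Fintype.card_fin, nsmul_eq_mul]
    field_simp
  have hVn : 0 ≤ ∑ t, ∫ ω, ξ t ω ^ 2 ∂P :=
    Finset.sum_nonneg fun t _ => integral_nonneg fun ω => sq_nonneg _
  have hVp := Real.rpow_le_rpow hVn hV (by positivity : 0 ≤ p / 2)
  have hB0 : 0 ≤ ((b ^ 2 * a + τ ^ 2 * laplaceMoment 2) / n) ^ (p / 2) := (Real.rpow_nonneg hVn _).trans hVp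
  refine ⟨?_, ?_⟩
  · have hm : MemLp (fun ω => ∑ t, ξ t ω) (ENNReal.ofReal p) P :=
      memLp_finsetSum _ fun t _ => hξmem p hp0 t
    exact (integral_abs_rpow_le_of_memLp hp0.le le_rfl hp0 hm).1
  have hMc : 0 ≤ momentConst p := by
    unfold momentConst
    have : 0 ≤ p - 1 := by linarith
    positivity
  rw [coeffErrorBound]
  -- The factor `1 + momentConst p ^ (p / 2)` serves both cases: the summand `1` is for `p ≤ 2`, the
  -- other for Rosenthal's inequality.
  split_ifs with hp2
  · have h2 : (2 : ℝ≥0∞) = ENNReal.ofReal 2 := by simp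
    refine (integral_abs_sum_rpow_le_of_le_two hp0 hp2 hξind
      (fun t => h2 ▸ hξmem 2 two_pos t) hξmean).trans ?_
    refine hVp.trans ?_
    rw [add_zero]
    refine le_mul_of_one_le_left hB0 ?_
    linarith [Real.rpow_nonneg hMc (p / 2)]
  · push Not at hp2
    refine (integral_abs_sum_rpow_le hp2.le hξind (hξmem p hp0) hξmean).trans ?_
    have hR : ∑ t, ∫ ω, |ξ t ω| ^ p ∂P ≤ (n : ℝ) ^ (1 - p) *
        (2 ^ p * (2 * (b ^ p * a)) + |τ| ^ p * laplaceMoment p) := by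
      rw [Fintype.sum_sum_type]
      have hnp : (n : ℝ) * (1 / (n : ℝ)) ^ p = (n : ℝ) ^ (1 - p) := by
        rw [one_div, Real.inv_rpow hn0.le, Real.rpow_sub hn0, Real.rpow_one]
        rfl
      have h1 : ∀ i : Fin n, ∫ ω, |ξ (Sum.inl i) ω| ^ p ∂P ≤
          (1 / (n : ℝ)) ^ p * (2 ^ p * (2 * (b ^ p * a))) := by
        intro i
        change ∫ ω, |(1 / (n : ℝ)) * (h (X i ω) - β)| ^ p ∂P ≤ _
        have e : ∀ ω, |(1 / (n : ℝ)) * (h (X i ω) - β)| ^ p =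
            (1 / (n : ℝ)) ^ p * |h (X i ω) - β| ^ p := by
          intro ω
          rw [abs_mul, Real.mul_rpow (abs_nonneg _) (abs_nonneg _), abs_of_pos (by positivity)]
        simp only [e]
        rw [integral_const_mul]
        gcongr
        have := integral_abs_sub_integral_rpow_le hp (hXm i (ENNReal.ofReal p))
        rw [hXβ] at this
        refine this.trans ?_
        gcongr
        exact integral_abs_comp_rpow_le (hX i) hf h0 hh hE hbd hp0
      have h2 : ∀ i : Fin n, ∫ ω, |ξ (Sum.inr i) ω| ^ p ∂P =
          (1 / (n : ℝ)) ^ p * (|τ| ^ p * laplaceMoment p) := by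
        intro i
        change ∫ ω, |(1 / (n : ℝ)) * (τ * Y i ω)| ^ p ∂P = _
        have e : ∀ ω, |(1 / (n : ℝ)) * (τ * Y i ω)| ^ p =
            (1 / (n : ℝ)) ^ p * (|τ| ^ p * |Y i ω| ^ p) := by
          intro ω
          rw [abs_mul, abs_mul, Real.mul_rpow (abs_nonneg _) (by positivity),
            Real.mul_rpow (abs_nonneg _) (abs_nonneg _), abs_of_pos (by positivity : 0 < 1 / (n : ℝ))]
        simp only [e]
        rw [integral_const_mul, integral_const_mul,
          ← integral_abs_rpow_of_hasLaw_laplaceOne (hY i) p]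
      refine (add_le_add (Finset.sum_le_sum fun i _ => h1 i)
        (Finset.sum_le_sum fun i _ => (h2 i).le)).trans_eq ?_
      simp only [Finset.sum_const, Finset.card_univ, Fintype.card_fin, nsmul_eq_mul]
      rw [← hnp]
      ring
    refine add_le_add ?_ (mul_le_mul_of_nonneg_left hR hMc)
    have h3 : 0 ≤ momentConst p ^ (p / 2) := Real.rpow_nonneg hMc _
    calc _ ≤ momentConst p ^ (p / 2) * ((b ^ 2 * a + τ ^ 2 * laplaceMoment 2) / n) ^ (p / 2) := by
          gcongr
      _ ≤ _ := by
          refine mul_le_mul_of_nonneg_right ?_ hB0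
          linarith

end

/-! ### The stochastic error of all empirical coefficients at one level -/

section

variable {f : ℝ → ℝ} {A T F p : ℝ}

lemma card_translations_le (hA : 0 ≤ A) (hT : 0 ≤ T) (j : ℤ) :
    ((translations A T j).card : ℝ) ≤ (2 : ℝ) ^ (max j 0) * (2 * T + 2 * A + 1) := by
  have h1 : (1 : ℝ) ≤ 2 ^ (max j 0) := one_le_zpow₀ one_le_two (le_max_right _ _)
  set y := (2 : ℝ) ^ (max j 0) * T + A with hy
  have hy0 : 0 ≤ y := by positivity
  have hfl : 0 ≤ ⌊y⌋ := Int.floor_nonneg.2 hy0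
  rw [translations, Int.card_Icc, ← hy]
  have : (((⌊y⌋ + 1 - -⌊y⌋).toNat : ℤ) : ℝ) = ((⌊y⌋ + 1 - -⌊y⌋ : ℤ) : ℝ) := by
    rw [Int.toNat_of_nonneg (by lia)]
  rw [Int.cast_natCast] at this
  rw [this]
  push_cast
  have h2 := Int.floor_le y
  nlinarith

/-- The mass of `f` in a cell. -/
noncomputable def cellMass (A : ℝ) (f : ℝ → ℝ) (j k : ℤ) : ℝ := ∫ x in cell A j k, f x

lemma cellMass_nonneg (h0 : ∀ x, 0 ≤ f x) (j k : ℤ) : 0 ≤ cellMass A f j k :=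
  integral_nonneg fun x => h0 x

/-- Each point lies in at most `2A + 1` cells and `f` has total mass one. -/
lemma sum_cellMass_le (hA : 0 ≤ A) (hf : Integrable f volume) (h0 : ∀ x, 0 ≤ f x)
    (h1 : ∫ x, f x = 1) (j : ℤ) (S : Finset ℤ) : ∑ k ∈ S, cellMass A f j k ≤ 2 * A + 1 := by
  have e : ∀ k, cellMass A f j k = ∫ x, f x * (cell A j k).indicator (fun _ => (1 : ℝ)) x := by
    intro k
    rw [cellMass, ← integral_indicator (measurableSet_cell A j k)]
    congr with x
    by_cases hx : x ∈ cell A j k <;> simp [hx]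
  have hi : ∀ k, Integrable (fun x => f x * (cell A j k).indicator (fun _ => (1 : ℝ)) x) volume := by
    intro k
    refine (hf.indicator (measurableSet_cell A j k)).congr (ae_of_all _ fun x => ?_)
    by_cases hx : x ∈ cell A j k <;> simp [hx]
  simp only [e]
  rw [← integral_finsetSum _ fun k _ => hi k]
  calc ∫ x, ∑ k ∈ S, f x * (cell A j k).indicator (fun _ => (1 : ℝ)) x
      ≤ ∫ x, f x * (2 * A + 1) := by
        refine integral_mono (integrable_finsetSum _ fun k _ => hi k) (hf.mul_const _) fun x => ?_
        simp only
        rw [← Finset.mul_sum]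
        exact mul_le_mul_of_nonneg_left (sum_indicator_cell_le hA j x S) (h0 x)
    _ = 2 * A + 1 := by rw [integral_mul_const, h1, one_mul]

/-- Hölder's inequality on a cell, whose length is `2A 2^{-j}`. -/
lemma ofReal_cellMass_rpow_le (hf : Integrable f volume) (h0 : ∀ x, 0 ≤ f x) (hp : 1 ≤ p)
    (j k : ℤ) : ENNReal.ofReal (cellMass A f j k) ^ p ≤
      ENNReal.ofReal (2 * A * (2 : ℝ) ^ (-j)) ^ (p - 1) * ∫⁻ x in cell A j k, ‖f x‖ₑ ^ p := by
  have hp0 : 0 < p := by linarith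
  have hp1 : (1 : ℝ≥0∞) ≤ ENNReal.ofReal p := by
    rw [← ENNReal.ofReal_one]
    exact ENNReal.ofReal_le_ofReal hp
  have h1 : ENNReal.ofReal (cellMass A f j k) = eLpNorm f 1 (volume.restrict (cell A j k)) := by
    rw [eLpNorm_one_eq_lintegral_enorm, cellMass,
      ofReal_integral_eq_lintegral_ofReal hf.integrableOn (ae_of_all _ h0)]
    refine lintegral_congr fun x => ?_
    rw [Real.enorm_eq_ofReal_abs, abs_of_nonneg (h0 x)]
  have h2 := eLpNorm_le_eLpNorm_mul_rpow_measure_univ (μ := volume.restrict (cell A j k)) hp1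
    hf.1.restrict
  rw [← h1, Measure.restrict_apply_univ, volume_cell,
    eLpNorm_eq_lintegral_rpow_enorm_toReal (by simpa using hp0) ENNReal.ofReal_ne_top,
    ENNReal.toReal_ofReal hp0.le, ENNReal.toReal_one] at h2
  refine (ENNReal.rpow_le_rpow h2 hp0.le).trans_eq ?_
  rw [ENNReal.mul_rpow_of_nonneg _ _ hp0.le, ← ENNReal.rpow_mul, ← ENNReal.rpow_mul,
    one_div_mul_cancel hp0.ne', ENNReal.rpow_one, mul_comm]
  congr 2
  field_simp

lemma sum_cellMass_rpow_le (hA : 0 ≤ A) (hf : Integrable f volume) (h0 : ∀ x, 0 ≤ f x)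
    (hp : 1 ≤ p) (hF : 0 ≤ F) (hfF : eLpNorm f (ENNReal.ofReal p) volume ≤ ENNReal.ofReal F)
    (j : ℤ) (S : Finset ℤ) :
    ∑ k ∈ S, cellMass A f j k ^ p ≤ (2 * A * (2 : ℝ) ^ (-j)) ^ (p - 1) * ((2 * A + 1) * F ^ p) := by
  have hp0 : 0 < p := by linarith
  have hL : ∫⁻ x, ‖f x‖ₑ ^ p ≤ ENNReal.ofReal (F ^ p) := by
    rw [eLpNorm_eq_lintegral_rpow_enorm_toReal (by simpa using hp0) ENNReal.ofReal_ne_top,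
      ENNReal.toReal_ofReal hp0.le] at hfF
    have := ENNReal.rpow_le_rpow hfF hp0.le
    rwa [← ENNReal.rpow_mul, one_div_mul_cancel hp0.ne', ENNReal.rpow_one,
      ENNReal.ofReal_rpow_of_nonneg hF hp0.le] at this
  have hS : ∑ k ∈ S, ∫⁻ x in cell A j k, ‖f x‖ₑ ^ p ≤ ENNReal.ofReal (2 * A + 1) * ∫⁻ x, ‖f x‖ₑ ^ p := by
    have hm : AEMeasurable (fun x => ‖f x‖ₑ ^ p) volume := hf.1.enorm.pow_const p
    simp only [← lintegral_indicator (measurableSet_cell A j _)]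
    rw [← lintegral_finsetSum' _ fun k _ => hm.indicator (measurableSet_cell A j k),
      ← lintegral_const_mul'' _ hm]
    refine lintegral_mono fun x => ?_
    have e : ∀ k, (cell A j k).indicator (fun x => ‖f x‖ₑ ^ p) x =
        ENNReal.ofReal ((cell A j k).indicator (fun _ => (1 : ℝ)) x) * ‖f x‖ₑ ^ p := by
      intro k
      by_cases hx : x ∈ cell A j k <;> simp [hx]
    simp only [e]
    rw [← Finset.sum_mul, ← ENNReal.ofReal_sum_of_nonneg fun k _ =>
      indicator_nonneg (fun _ _ => zero_le_one) x]
    gcongr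
    exact sum_indicator_cell_le hA j x S
  have hcm : ∀ k, 0 ≤ cellMass A f j k := cellMass_nonneg h0 j
  rw [← ENNReal.ofReal_le_ofReal_iff (by positivity),
    ENNReal.ofReal_sum_of_nonneg fun k _ => Real.rpow_nonneg (hcm k) _]
  calc ∑ k ∈ S, ENNReal.ofReal (cellMass A f j k ^ p)
      = ∑ k ∈ S, ENNReal.ofReal (cellMass A f j k) ^ p :=
        Finset.sum_congr rfl fun k _ => (ENNReal.ofReal_rpow_of_nonneg (hcm k) hp0.le).symm
    _ ≤ ∑ k ∈ S, ENNReal.ofReal (2 * A * (2 : ℝ) ^ (-j)) ^ (p - 1) *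
          ∫⁻ x in cell A j k, ‖f x‖ₑ ^ p :=
        Finset.sum_le_sum fun k _ => ofReal_cellMass_rpow_le hf h0 hp j k
    _ ≤ ENNReal.ofReal (2 * A * (2 : ℝ) ^ (-j)) ^ (p - 1) *
          (ENNReal.ofReal (2 * A + 1) * ENNReal.ofReal (F ^ p)) := by
        rw [← Finset.mul_sum]
        gcongr
        exact hS.trans (by gcongr)
    _ = _ := by
        rw [ENNReal.ofReal_rpow_of_nonneg (by positivity) (by linarith),
          ← ENNReal.ofReal_mul (by positivity), ← ENNReal.ofReal_mul (by positivity)]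

/-- The constant in `sum_cellMass_rpow_half_le`. -/
noncomputable def massConst (A T F p : ℝ) : ℝ :=
  √((2 * T + 2 * A + 1) * ((2 * A) ^ (p - 1) * ((2 * A + 1) * F ^ p)))

/-- Cauchy–Schwarz, for all `p ≥ 1` at once: about `2^j` cells times a sum of masses to the power
`p` of order `2^{-j(p-1)}` gives `2^{j(2-p)}`, and the square root is the claim. The uniform `L^p`
bound on the densities is needed here. -/
lemma sum_cellMass_rpow_half_le (hA : 0 ≤ A) (hT : 0 ≤ T) (hf : Integrable f volume)
    (h0 : ∀ x, 0 ≤ f x) (hp : 1 ≤ p) (hF : 0 ≤ F)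
    (hfF : eLpNorm f (ENNReal.ofReal p) volume ≤ ENNReal.ofReal F) {j : ℤ} (hj : 0 ≤ j) :
    ∑ k ∈ translations A T j, cellMass A f j k ^ (p / 2) ≤
      massConst A T F p * (2 : ℝ) ^ ((j : ℝ) * (1 - p / 2)) := by
  have hcm : ∀ k, 0 ≤ cellMass A f j k := cellMass_nonneg h0 j
  have hcs := sq_sum_le_card_mul_sum_sq (s := translations A T j)
    (f := fun k => cellMass A f j k ^ (p / 2))
  have e1 : ∀ k, (cellMass A f j k ^ (p / 2)) ^ 2 = cellMass A f j k ^ p := by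
    intro k
    rw [← Real.rpow_natCast, ← Real.rpow_mul (hcm k)]
    congr 1
    push_cast
    ring
  simp only [e1] at hcs
  have hcard := card_translations_le hA hT j
  rw [max_eq_left hj] at hcard
  have hpow := sum_cellMass_rpow_le hA hf h0 hp hF hfF j (translations A T j)
  have hpow0 : 0 ≤ ∑ k ∈ translations A T j, cellMass A f j k ^ p :=
    Finset.sum_nonneg fun k _ => Real.rpow_nonneg (hcm k) _
  have h1 := hcs.trans (mul_le_mul hcard hpow hpow0 (by positivity))
  refine (abs_le_of_sq_le_sq' ?_ (by unfold massConst; positivity)).2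
  refine h1.trans_eq ?_
  rw [massConst, mul_pow, Real.sq_sqrt (by positivity), Real.mul_rpow (by positivity)
    (by positivity)]
  have e2 : ((2 : ℝ) ^ ((j : ℝ) * (1 - p / 2))) ^ 2 =
      (2 : ℝ) ^ j * ((2 : ℝ) ^ (-j)) ^ (p - 1) := by
    rw [← Real.rpow_natCast, ← Real.rpow_intCast, ← Real.rpow_intCast, ← Real.rpow_mul two_pos.le,
      ← Real.rpow_mul two_pos.le, ← Real.rpow_add two_pos]
    congr 1
    push_cast
    ring
  rw [e2]
  ring

/-- The constant in `sum_coeffErrorBound_le`. -/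
noncomputable def levelConst (A B T F p : ℝ) : ℝ :=
  (1 + momentConst p ^ (p / 2)) * 2 ^ (p / 2) *
      (B ^ p * massConst A T F p + (2 * T + 2 * A + 1) * laplaceMoment 2 ^ (p / 2)) +
    momentConst p * (2 ^ p * 2 * B ^ p * (2 * A + 1) + (2 * T + 2 * A + 1) * laplaceMoment p)

/-- The contribution of the moments of order `p > 2` to the risk. -/
noncomputable def highMoment (p : ℝ) (n j₁ : ℕ) : ℝ :=
  if p ≤ 2 then 0 else ((2 : ℝ) ^ j₁ / n) ^ (p / 2 - 1)

lemma highMoment_nonneg (p : ℝ) (n j₁ : ℕ) : 0 ≤ highMoment p n j₁ := by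
  unfold highMoment
  split_ifs <;> positivity

lemma momentConst_nonneg (hp : 1 ≤ p) : 0 ≤ momentConst p := by
  unfold momentConst
  have : 0 ≤ p - 1 := by linarith
  positivity

lemma levelConst_nonneg {B : ℝ} (hA : 0 ≤ A) (hB : 0 ≤ B) (hT : 0 ≤ T) (hp : 1 ≤ p) :
    0 ≤ levelConst A B T F p := by
  have := momentConst_nonneg hp
  have := laplaceMoment_nonneg 2
  have := laplaceMoment_nonneg p
  have : 0 ≤ massConst A T F p := Real.sqrt_nonneg _
  unfold levelConst
  positivity

/-- In the variance term the amplitude `2^{lp/2}` meets the mass sum `2^{l(1-p/2)}` and leaves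
`2^l`; the noise is the same in each of the about `2^l` cells and leaves `2^l` as well. The
remaining Rosenthal term for the observations uses only the total mass and produces `highMoment`. -/
lemma sum_coeffErrorBound_le {B : ℝ} (hA : 0 ≤ A) (hB : 0 ≤ B) (hT : 0 ≤ T)
    (hf : Integrable f volume) (h0 : ∀ x, 0 ≤ f x) (hf1 : ∫ x, f x = 1) (hp : 1 ≤ p) (hF : 0 ≤ F)
    (hfF : eLpNorm f (ENNReal.ofReal p) volume ≤ ENNReal.ofReal F) {n : ℕ} (hn : 1 ≤ n)
    {l j₁ : ℕ} (hl : l ≤ j₁) (τ : ℝ) :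
    ∑ k ∈ translations A T l,
        coeffErrorBound p n (B * (2 : ℝ) ^ ((l : ℝ) / 2)) (cellMass A f l k) τ ≤
      levelConst A B T F p * (1 + |τ| ^ p + highMoment p n j₁) *
        ((n : ℝ) ^ (-(p / 2)) * (2 : ℝ) ^ l) := by
  have hn0 : (0 : ℝ) < n := by exact_mod_cast hn
  have hp0 : 0 < p := by linarith
  have hM := momentConst_nonneg hp
  have hm2 := laplaceMoment_nonneg 2
  have hmp := laplaceMoment_nonneg p
  have hK1 : 0 ≤ massConst A T F p := Real.sqrt_nonneg _
  have hcm : ∀ k, 0 ≤ cellMass A f l k := cellMass_nonneg h0 l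
  have hcard := card_translations_le hA hT (l : ℤ)
  rw [max_eq_left (by positivity), zpow_natCast] at hcard
  set K := 2 * T + 2 * A + 1
  have hK : 0 ≤ K := by positivity
  set S := translations A T l
  set b := B * (2 : ℝ) ^ ((l : ℝ) / 2) with hb
  have hb0 : 0 ≤ b := by positivity
  set Nn := (n : ℝ) ^ (-(p / 2)) with hNn
  have hNn0 : 0 < Nn := Real.rpow_pos_of_pos hn0 _
  have hbp : b ^ p = B ^ p * (2 : ℝ) ^ ((l : ℝ) * (p / 2)) := by
    rw [hb, Real.mul_rpow hB (by positivity), ← Real.rpow_mul two_pos.le]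
    ring_nf
  have hτ : (τ ^ 2) ^ (p / 2) = |τ| ^ p := by
    rw [← sq_abs, ← Real.rpow_natCast, ← Real.rpow_mul (abs_nonneg _)]
    congr 1
    push_cast
    ring
  have hbb : (b ^ 2) ^ (p / 2) = b ^ p := by
    rw [← Real.rpow_natCast, ← Real.rpow_mul hb0]
    congr 1
    push_cast
    ring
  have hl2 : (2 : ℝ) ^ ((l : ℝ) * (p / 2)) * (2 : ℝ) ^ ((l : ℝ) * (1 - p / 2)) = 2 ^ l := by
    rw [← Real.rpow_add two_pos, ← Real.rpow_natCast]
    congr 1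
    ring
  have hfirst : ∑ k ∈ S, ((b ^ 2 * cellMass A f l k + τ ^ 2 * laplaceMoment 2) / n) ^ (p / 2) ≤
      2 ^ (p / 2) * (B ^ p * massConst A T F p + K * laplaceMoment 2 ^ (p / 2) * |τ| ^ p) *
        (Nn * 2 ^ l) := by
    have h1 : ∀ k ∈ S, ((b ^ 2 * cellMass A f l k + τ ^ 2 * laplaceMoment 2) / n) ^ (p / 2) ≤
        Nn * 2 ^ (p / 2) * (b ^ p * cellMass A f l k ^ (p / 2) +
          |τ| ^ p * laplaceMoment 2 ^ (p / 2)) := by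
      intro k _
      have hck := hcm k
      rw [Real.div_rpow (by positivity) hn0.le, div_eq_mul_inv, ← Real.rpow_neg hn0.le, mul_comm,
        mul_assoc]
      refine mul_le_mul_of_nonneg_left ?_ hNn0.le
      refine (add_rpow_le_two_rpow_mul (by positivity) (by positivity) (by positivity)).trans_eq ?_
      rw [Real.mul_rpow (by positivity) hck, Real.mul_rpow (by positivity) hm2, hτ, hbb]
    have h2 := sum_cellMass_rpow_half_le (j := (l : ℤ)) hA hT hf h0 hp hF hfF (by positivity)
    rw [Int.cast_natCast] at h2
    refine (Finset.sum_le_sum h1).trans ?_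
    rw [← Finset.mul_sum, Finset.sum_add_distrib, ← Finset.mul_sum, Finset.sum_const, nsmul_eq_mul]
    calc _ ≤ Nn * 2 ^ (p / 2) * (b ^ p * (massConst A T F p * (2 : ℝ) ^ ((l : ℝ) * (1 - p / 2))) +
          (2 ^ l * K) * (|τ| ^ p * laplaceMoment 2 ^ (p / 2))) := by gcongr
      _ = Nn * 2 ^ (p / 2) * (B ^ p * massConst A T F p *
            ((2 : ℝ) ^ ((l : ℝ) * (p / 2)) * (2 : ℝ) ^ ((l : ℝ) * (1 - p / 2))) +
          (2 ^ l * K) * (|τ| ^ p * laplaceMoment 2 ^ (p / 2))) := by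
          rw [hbp]
          ring
      _ = _ := by
          rw [hl2]
          ring
  have hsecond : ∑ k ∈ S, (if p ≤ 2 then (0 : ℝ) else momentConst p * ((n : ℝ) ^ (1 - p) *
        (2 ^ p * (2 * (b ^ p * cellMass A f l k)) + |τ| ^ p * laplaceMoment p))) ≤
      momentConst p * (2 ^ p * 2 * B ^ p * (2 * A + 1) * highMoment p n j₁ +
        K * laplaceMoment p * |τ| ^ p) * (Nn * 2 ^ l) := by
    unfold highMoment
    split_ifs with hp2
    · simp only [Finset.sum_const_zero, mul_zero, zero_add]
      positivity
    · push Not at hp2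
      have h1 := sum_cellMass_le hA hf h0 hf1 (l : ℤ) S
      -- As `p > 2`, the high moments of the noise are of smaller order in `n` than its variance
      -- term.
      have h2 : (n : ℝ) ^ (1 - p) ≤ Nn :=
        Real.rpow_le_rpow_of_exponent_le (by exact_mod_cast hn) (by linarith)
      -- The quotient by `n^{-p/2} 2^l` is `(2^l/n)^{p/2-1}`, which increases with `l`, so `l` may
      -- be replaced by `j₁`.
      have h3 : (n : ℝ) ^ (1 - p) * (2 : ℝ) ^ ((l : ℝ) * (p / 2)) ≤
          Nn * 2 ^ l * ((2 : ℝ) ^ j₁ / n) ^ (p / 2 - 1) := by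
        have e1 : (n : ℝ) ^ (1 - p) * (2 : ℝ) ^ ((l : ℝ) * (p / 2)) =
            Nn * 2 ^ l * ((2 : ℝ) ^ l / n) ^ (p / 2 - 1) := by
          rw [Real.div_rpow (by positivity) hn0.le, div_eq_mul_inv (((2 : ℝ) ^ l) ^ (p / 2 - 1)),
            ← Real.rpow_neg hn0.le, ← Real.rpow_natCast, ← Real.rpow_mul two_pos.le]
          have e3 : (n : ℝ) ^ (1 - p) = Nn * (n : ℝ) ^ (-(p / 2 - 1)) := by
            rw [hNn, ← Real.rpow_add hn0]
            congr 1
            ring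
          have e4 : (2 : ℝ) ^ ((l : ℝ) * (p / 2)) =
              (2 : ℝ) ^ (l : ℝ) * (2 : ℝ) ^ ((l : ℝ) * (p / 2 - 1)) := by
            rw [← Real.rpow_add two_pos]
            congr 1
            ring
          rw [e3, e4]
          ring
        rw [e1]
        have hpp : 0 ≤ p / 2 - 1 := by linarith
        gcongr
        exact one_le_two
      rw [← Finset.mul_sum, ← Finset.mul_sum, Finset.sum_add_distrib, ← Finset.mul_sum,
        ← Finset.mul_sum, ← Finset.mul_sum, Finset.sum_const, nsmul_eq_mul, hbp]
      rw [mul_assoc (momentConst p)]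
      refine mul_le_mul_of_nonneg_left ?_ hM
      calc _ ≤ (n : ℝ) ^ (1 - p) * (2 ^ p * (2 * (B ^ p * (2 : ℝ) ^ ((l : ℝ) * (p / 2)) *
              (2 * A + 1))) + (2 ^ l * K) * (|τ| ^ p * laplaceMoment p)) := by gcongr
        _ = 2 ^ p * 2 * B ^ p * (2 * A + 1) * ((n : ℝ) ^ (1 - p) * (2 : ℝ) ^ ((l : ℝ) * (p / 2))) +
              (n : ℝ) ^ (1 - p) * ((2 ^ l * K) * (|τ| ^ p * laplaceMoment p)) := by ring
        _ ≤ 2 ^ p * 2 * B ^ p * (2 * A + 1) * (Nn * 2 ^ l * ((2 : ℝ) ^ j₁ / n) ^ (p / 2 - 1)) +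
              Nn * ((2 ^ l * K) * (|τ| ^ p * laplaceMoment p)) := by gcongr
        _ = _ := by ring
  simp only [coeffErrorBound]
  rw [Finset.sum_add_distrib, ← Finset.mul_sum]
  set R := highMoment p n j₁
  have hR : 0 ≤ R := highMoment_nonneg p n j₁
  have ht : 0 ≤ |τ| ^ p := by positivity
  have hM2 : 0 ≤ 1 + momentConst p ^ (p / 2) := by positivity
  have hm2p : 0 ≤ laplaceMoment 2 ^ (p / 2) := by positivity
  refine (add_le_add (mul_le_mul_of_nonneg_left hfirst hM2) hsecond).trans ?_
  calc _ = ((1 + momentConst p ^ (p / 2)) * 2 ^ (p / 2) * (B ^ p * massConst A T F p * 1 +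
          K * laplaceMoment 2 ^ (p / 2) * |τ| ^ p) + momentConst p *
          (2 ^ p * 2 * B ^ p * (2 * A + 1) * R + K * laplaceMoment p * |τ| ^ p)) *
          (Nn * 2 ^ l) := by ring
    _ ≤ ((1 + momentConst p ^ (p / 2)) * 2 ^ (p / 2) * (B ^ p * massConst A T F p *
          (1 + |τ| ^ p + R) + K * laplaceMoment 2 ^ (p / 2) * (1 + |τ| ^ p + R)) +
          momentConst p * (2 ^ p * 2 * B ^ p * (2 * A + 1) * (1 + |τ| ^ p + R) +
          K * laplaceMoment p * (1 + |τ| ^ p + R))) * (Nn * 2 ^ l) := by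
        gcongr <;> linarith
    _ = _ := by
        rw [levelConst]
        ring

end

/-! ### The risk of the linear estimator -/

lemma IsAtom.mono {A B B' : ℝ} {g : ℝ → ℝ} (hg : IsAtom A B g) (h : B ≤ B') : IsAtom A B' g where
  nonneg := hg.nonneg
  bound_nonneg := hg.bound_nonneg.trans h
  aesm := hg.aesm
  bound := by
    filter_upwards [hg.bound] with x hx
    exact hx.trans h
  supp := hg.supp

/-- The generator of the basis functions at level `j`, with the convention that `j = -1` stands for
the father wavelet. -/
def generator (φ ψ : ℝ → ℝ) (j : ℤ) : ℝ → ℝ := if j = -1 then φ else ψ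

/-- Since `toNat` sends `-1` to `0`, the scale of `φ_{0k}`, all levels from `-1` on can be treated
alike. -/
lemma basisFun_eq_dil (φ ψ : ℝ → ℝ) {j : ℤ} (hj : -1 ≤ j) (k : ℤ) :
    basisFun φ ψ j k = dil (generator φ ψ j) (j.toNat : ℤ) k := by
  unfold basisFun generator
  split_ifs with h
  · subst h
    rfl
  · rw [Int.toNat_of_nonneg (by lia)]

lemma translations_toNat (A T : ℝ) (j : ℤ) : translations A T (j.toNat : ℤ) = translations A T j := by
  ext k
  rw [mem_translations, mem_translations, Int.toNat_eq_max, max_eq_left (le_max_right j 0)]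

lemma sum_Icc_neg_one {M : Type*} [AddCommMonoid M] (F : ℤ → M) (m : ℕ) :
    ∑ j ∈ Finset.Icc (-1 : ℤ) m, F j = F (-1) + ∑ l ∈ Finset.range (m + 1), F l := by
  induction m with
  | zero =>
    have : Finset.Icc (-1 : ℤ) ((0 : ℕ) : ℤ) = {-1, 0} := by
      ext x
      simp only [Finset.mem_Icc, Finset.mem_insert, Finset.mem_singleton]
      lia
    rw [this, Finset.sum_pair (by norm_num)]
    simp
  | succ m ih =>
    have : Finset.Icc (-1 : ℤ) ((m + 1 : ℕ) : ℤ) =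
        insert ((m + 1 : ℕ) : ℤ) (Finset.Icc (-1 : ℤ) m) := by
      ext x
      simp only [Finset.mem_Icc, Finset.mem_insert]
      lia
    rw [this, Finset.sum_insert (by simp), ih, Finset.sum_range_succ _ (m + 1)]
    abel

/-- The constant in `sum_two_rpow_half_le`. -/
noncomputable def geomConst : ℝ := 1 + √2 / (√2 - 1)

lemma one_lt_sqrt_two : 1 < √2 := by
  rw [Real.lt_sqrt zero_le_one]
  norm_num

lemma geomConst_nonneg : 0 ≤ geomConst := by
  have : 0 < √2 - 1 := by linarith [one_lt_sqrt_two]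
  unfold geomConst
  positivity

lemma two_rpow_half_natCast (l : ℕ) : (2 : ℝ) ^ ((l : ℝ) / 2) = √2 ^ l := by
  rw [Real.sqrt_eq_rpow, ← Real.rpow_natCast, ← Real.rpow_mul two_pos.le]
  ring_nf

/-- A geometric sum of ratio `√2` is dominated by its last term; the `1` in `geomConst` pays for the
level `-1`. -/
lemma sum_two_rpow_half_le (j₁ : ℕ) :
    ∑ j ∈ Finset.Icc (-1 : ℤ) j₁, (2 : ℝ) ^ ((j.toNat : ℝ) / 2) ≤
      geomConst * (2 : ℝ) ^ ((j₁ : ℝ) / 2) := by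
  have h1 := one_lt_sqrt_two
  have h2 : 0 < √2 - 1 := by linarith
  rw [sum_Icc_neg_one]
  simp only [Int.toNat_natCast, two_rpow_half_natCast]
  rw [geom_sum_eq h1.ne', show (-1 : ℤ).toNat = 0 from rfl, pow_zero, geomConst, add_mul, one_mul]
  refine add_le_add (one_le_pow₀ h1.le) ?_
  rw [div_mul_eq_mul_div, pow_succ]
  gcongr
  linarith

section

variable {φ ψ f : ℝ → ℝ} {A B T F s p L α : ℝ} {q : ℝ≥0∞} {n j₁ : ℕ}

lemma generator_isAtom (hφ : IsAtom A B φ) (hψ : IsAtom A B ψ) (j : ℤ) :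
    IsAtom A B (generator φ ψ j) := by
  unfold generator
  split_ifs
  exacts [hφ, hψ]

/-- The sum of the expansions up to level `j₁` is the projection at level `j₁ + 1`. -/
lemma sum_proj_ae_eq (hφ : IsAtom A B φ) (hψ : IsAtom A B ψ) (hm : GeneratesMRA φ)
    (hw : IsMotherWavelet φ ψ) (hf : Integrable f volume) (h0 : ∀ x, 0 ≤ f x)
    (hT : Function.support f ⊆ Icc (-T) T) (j₁ : ℕ) :
    ∀ᵐ x, ∑ j ∈ Finset.Icc (-1 : ℤ) j₁, proj A T (generator φ ψ j) (j.toNat : ℤ) f x =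
      proj A T φ (j₁ + 1 : ℕ) f x := by
  filter_upwards [proj_add_ae_eq_sum hφ hψ hm hw hf h0 hT 0 (j₁ + 1)] with x hx
  rw [zero_add] at hx
  rw [sum_Icc_neg_one, hx]
  congr 1
  refine Finset.sum_congr rfl fun l _ => ?_
  have : generator φ ψ (l : ℤ) = ψ := if_neg (by lia)
  rw [this, Int.toNat_natCast, zero_add]

/-- The error of an empirical wavelet coefficient. -/
noncomputable def coeffError {Ω : Type*} (φ ψ : ℝ → ℝ) (A α : ℝ) (j₁ n : ℕ) (f : ℝ → ℝ)
    (X : Fin n → Ω → ℝ) (W : Fin n → ℤ → ℤ → Ω → ℝ) (j k : ℤ) (ω : Ω) : ℝ :=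
  (1 / (n : ℝ)) * ∑ i, privateView φ ψ A α j₁ j k (X i ω) (W i j k ω) -
    coeff f (generator φ ψ j) (j.toNat : ℤ) k

section Sample

variable {Ω : Type*} {X : Fin n → Ω → ℝ} {W : Fin n → ℤ → ℤ → Ω → ℝ}

/-- For fixed `ω`, add and subtract the expansion of `f` up to level `j₁`, which is its projection
at level `j₁ + 1`. Then use Minkowski's inequality over the levels and the synthesis bound at each
of them. -/
lemma eLpNorm_linEstimator_sub_le (hφ : IsAtom A B φ) (hψ : IsAtom A B ψ) (hm : GeneratesMRA φ)
    (hw : IsMotherWavelet φ ψ) (hs : 0 < s) (hp : 1 ≤ p) (hq : 1 ≤ q) (hL : 0 ≤ L)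
    (hf : MemDensityClass φ ψ s p q L T f) (ω : Ω) :
    eLpNorm (fun x => linEstimator φ ψ A T j₁ n
        (fun i j k => privateView φ ψ A α j₁ j k (X i ω) (W i j k ω)) x - f x)
      (ENNReal.ofReal p) volume ≤
    ENNReal.ofReal (biasConst A B s p L * (2 : ℝ) ^ (-(j₁ * s)) +
      ∑ j ∈ Finset.Icc (-1 : ℤ) j₁, synthConst A B p *
        (2 : ℝ) ^ ((j.toNat : ℝ) * (1 / 2 - 1 / p)) *
        (∑ k ∈ translations A T j, |coeffError φ ψ A α j₁ n f X W j k ω| ^ p) ^ (1 / p)) := by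
  have hp1 : (1 : ℝ≥0∞) ≤ ENNReal.ofReal p := by
    rw [← ENNReal.ofReal_one]
    exact ENNReal.ofReal_le_ofReal hp
  have hSc := synthConst_nonneg hφ.nonneg hφ.bound_nonneg p
  have hBc := biasConst_nonneg (p := p) hφ.nonneg hφ.bound_nonneg hs hL
  have hg := generator_isAtom hφ hψ
  set D : ℤ → ℤ → ℝ := fun j k => coeffError φ ψ A α j₁ n f X W j k ω
  set S : ℤ → ℝ → ℝ := fun j x =>
    ∑ k ∈ translations A T j, D j k * dil (generator φ ψ j) (j.toNat : ℤ) k x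
  have hSm : ∀ j, AEStronglyMeasurable (S j) volume := fun j =>
    Finset.aestronglyMeasurable_fun_sum _
      fun k _ => ((hg j).aestronglyMeasurable_dil _ k).const_mul _
  have hsplit : (fun x => linEstimator φ ψ A T j₁ n
        (fun i j k => privateView φ ψ A α j₁ j k (X i ω) (W i j k ω)) x - f x) =ᵐ[volume]
      ∑ j ∈ Finset.Icc (-1 : ℤ) j₁, S j -
        fun x => f x - proj A T φ (j₁ + 1 : ℕ) f x := by
    filter_upwards [sum_proj_ae_eq hφ hψ hm hw hf.integrable hf.nonneg hf.support_subset j₁]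
      with x hx
    rw [Pi.sub_apply, Finset.sum_apply, ← hx, linEstimator, sub_sub_eq_add_sub,
      ← Finset.sum_add_distrib]
    congr 1
    refine Finset.sum_congr rfl fun j hj => ?_
    simp only [S, proj]
    rw [translations_toNat, ← Finset.sum_add_distrib]
    refine Finset.sum_congr rfl fun k _ => ?_
    rw [basisFun_eq_dil φ ψ (Finset.mem_Icc.1 hj).1, ← add_mul]
    congr 1
    simp only [D, coeffError]
    ring
  rw [eLpNorm_congr_ae hsplit, add_comm (biasConst A B s p L * _)]
  have hfm : AEStronglyMeasurable (fun x => f x - proj A T φ (j₁ + 1 : ℕ) f x) volume :=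
    hf.integrable.1.sub (hφ.memLp_two_proj _).1
  refine (eLpNorm_sub_le (Finset.aestronglyMeasurable_sum _ fun j _ => hSm j) hfm hp1).trans ?_
  rw [ENNReal.ofReal_add (Finset.sum_nonneg fun j _ => by positivity) (by positivity),
    ENNReal.ofReal_sum_of_nonneg fun j _ => by positivity]
  refine add_le_add ((eLpNorm_sum_le (fun j _ => hSm j) hp1).trans
    (Finset.sum_le_sum fun j _ => ?_)) ?_
  · have := (hg j).eLpNorm_sum_dil_le hp (j.toNat : ℤ) (translations A T j) (D j)
    rwa [Int.cast_natCast] at this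
  -- The bias belongs to level `j₁ + 1`; it is weakened to `j₁`.
  · refine (eLpNorm_sub_proj_le hφ hψ hm hw hs hp hq hL hf (j₁ + 1)).trans
      (ENNReal.ofReal_le_ofReal ?_)
    gcongr
    · exact one_le_two
    · linarith

variable [MeasurableSpace Ω] {P : Measure Ω}

/-- For one coefficient only the noise variables with this `(j, k)` matter; they form, with the
`X_i`, a subfamily of the independent family. -/
lemma IsSample.iIndepFun_coeff {I : Set (ℤ × ℤ)} (hs : IsSample P f n I X W) {j k : ℤ}
    (h : (j, k) ∈ I) :
    iIndepFun (β := fun _ : Fin n ⊕ Fin n => ℝ) (Sum.elim X fun i => W i j k) P := by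
  have hinj : Function.Injective
      (Sum.map id fun i => (i, ⟨(j, k), h⟩) : Fin n ⊕ Fin n → Fin n ⊕ (Fin n × I)) :=
    Function.Injective.sumMap Function.injective_id fun a b hab => (Prod.mk.inj hab).1
  have := hs.indep.precomp hinj
  convert this using 1
  ext (i | i) <;> rfl

variable [IsProbabilityMeasure P]

lemma integral_coeffError_rpow_le (hφ : IsAtom A B φ) (hψ : IsAtom A B ψ) (hn : 1 ≤ n) (hp : 1 ≤ p)
    (hf : Integrable f volume) (h0 : ∀ x, 0 ≤ f x)
    (hs : IsSample P f n (indexSet A T j₁) X W) {j k : ℤ} (hj : j ∈ Finset.Icc (-1 : ℤ) j₁)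
    (hk : k ∈ translations A T j) :
    Integrable (fun ω => |coeffError φ ψ A α j₁ n f X W j k ω| ^ p) P ∧
    ∫ ω, |coeffError φ ψ A α j₁ n f X W j k ω| ^ p ∂P ≤
      coeffErrorBound p n (B * (2 : ℝ) ^ ((j.toNat : ℝ) / 2)) (cellMass A f j.toNat k)
        (noiseLevel φ ψ A α j₁ j) := by
  have hI : (j, k) ∈ indexSet A T j₁ := ⟨hj, hk⟩
  have hg := generator_isAtom hφ hψ j
  have hB := hφ.bound_nonneg
  have hbd : ∀ᵐ x, |dil (generator φ ψ j) (j.toNat : ℤ) k x| ≤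
      (cell A (j.toNat : ℤ) k).indicator (fun _ => B * (2 : ℝ) ^ ((j.toNat : ℝ) / 2)) x := by
    filter_upwards [hg.ae_abs_dil_le] with x hx
    have := hx (j.toNat : ℤ) k
    rwa [Int.cast_natCast] at this
  have h := integral_abs_coeff_error_rpow_le hn hp hs.law_X (fun i => hs.law_W i (j, k) hI)
    (hs.iIndepFun_coeff hI) hf h0 (hg.aestronglyMeasurable_dil (j.toNat : ℤ) k)
    (measurableSet_cell A (j.toNat : ℤ) k) (by positivity) hbd (noiseLevel φ ψ A α j₁ j)
  simpa only [coeffError, coeff, cellMass, privateView, basisFun_eq_dil φ ψ (Finset.mem_Icc.1 hj).1] using h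

/-- The constant in `eLpNorm_levelError_le`. -/
noncomputable def stochConst (A B T F p : ℝ) : ℝ :=
  synthConst A B p * levelConst A B T F p ^ (1 / p)

/-- By linearity of the expectation the moments of order `p` are summed over `k`. The factors
`2^{l(1/2-1/p)}` from synthesis and `(2^l)^{1/p}` from that sum combine to `2^{l/2}`. -/
lemma eLpNorm_levelError_le (hφ : IsAtom A B φ) (hψ : IsAtom A B ψ) (hT : 0 ≤ T) (hn : 1 ≤ n)
    (hp : 1 ≤ p) (hf : MemDensityClass φ ψ s p q L T f) (hF : 0 ≤ F)
    (hfF : eLpNorm f (ENNReal.ofReal p) volume ≤ ENNReal.ofReal F)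
    (hs : IsSample P f n (indexSet A T j₁) X W) {j : ℤ} (hj : j ∈ Finset.Icc (-1 : ℤ) j₁) {τ : ℝ}
    (hτ : |noiseLevel φ ψ A α j₁ j| ≤ τ) :
    AEStronglyMeasurable (fun ω => synthConst A B p * (2 : ℝ) ^ ((j.toNat : ℝ) * (1 / 2 - 1 / p)) *
        (∑ k ∈ translations A T j, |coeffError φ ψ A α j₁ n f X W j k ω| ^ p) ^ (1 / p)) P ∧
    eLpNorm (fun ω => synthConst A B p * (2 : ℝ) ^ ((j.toNat : ℝ) * (1 / 2 - 1 / p)) *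
        (∑ k ∈ translations A T j, |coeffError φ ψ A α j₁ n f X W j k ω| ^ p) ^ (1 / p))
      (ENNReal.ofReal p) P ≤
    ENNReal.ofReal (stochConst A B T F p * (1 + τ ^ p + highMoment p n j₁) ^ (1 / p) *
      (n : ℝ) ^ (-(1 / 2) : ℝ) * (2 : ℝ) ^ ((j.toNat : ℝ) / 2)) := by
  have hp0 : 0 < p := by linarith
  have hn0 : (0 : ℝ) < n := by exact_mod_cast hn
  have hA := hφ.nonneg
  have hB := hφ.bound_nonneg
  have hτ0 : 0 ≤ τ := (abs_nonneg _).trans hτ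
  have hSc := synthConst_nonneg hA hB p
  have hLC := levelConst_nonneg (F := F) hA hB hT hp
  have hH := highMoment_nonneg p n j₁
  set l := j.toNat with hl
  have hlj : l ≤ j₁ := by
    have := (Finset.mem_Icc.1 hj).2
    lia
  have hD := fun k hk => integral_coeffError_rpow_le (α := α) hφ hψ hn hp hf.integrable hf.nonneg
    hs hj (k := k) hk
  set D : ℤ → Ω → ℝ := fun k ω => |coeffError φ ψ A α j₁ n f X W j k ω| ^ p with hDdef
  have hD0 : ∀ k ω, 0 ≤ D k ω := fun k ω => by positivity
  have hS0 : ∀ ω, 0 ≤ ∑ k ∈ translations A T j, D k ω := fun ω =>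
    Finset.sum_nonneg fun k _ => hD0 k ω
  have hint : Integrable (fun ω => ∑ k ∈ translations A T j, D k ω) P :=
    integrable_finsetSum _ fun k hk => (hD k hk).1
  set c := synthConst A B p * (2 : ℝ) ^ ((l : ℝ) * (1 / 2 - 1 / p)) with hc
  have hc0 : 0 ≤ c := by positivity
  refine ⟨((hint.1.aemeasurable.pow_const _).const_mul _).aestronglyMeasurable, ?_⟩
  have hsum : ∫ ω, ∑ k ∈ translations A T j, D k ω ∂P ≤
      levelConst A B T F p * (1 + τ ^ p + highMoment p n j₁) *
        ((n : ℝ) ^ (-(p / 2)) * (2 : ℝ) ^ l) := by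
    rw [integral_finsetSum _ fun k hk => (hD k hk).1]
    refine (Finset.sum_le_sum fun k hk => (hD k hk).2).trans ?_
    have h := sum_coeffErrorBound_le hA hB hT hf.integrable hf.nonneg hf.integral_eq_one hp hF hfF hn
      hlj (noiseLevel φ ψ A α j₁ j)
    rw [hl, translations_toNat, ← hl] at h
    refine h.trans ?_
    gcongr
  rw [eLpNorm_eq_lintegral_rpow_enorm_toReal (by simpa using hp0) ENNReal.ofReal_ne_top,
    ENNReal.toReal_ofReal hp0.le]
  have e1 : ∀ ω, ‖c * (∑ k ∈ translations A T j, D k ω) ^ (1 / p)‖ₑ ^ p =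
      ENNReal.ofReal (c ^ p * ∑ k ∈ translations A T j, D k ω) := by
    intro ω
    have hr := Real.rpow_nonneg (hS0 ω) (1 / p)
    rw [Real.enorm_eq_ofReal (by positivity), ENNReal.ofReal_rpow_of_nonneg (by positivity) hp0.le,
      Real.mul_rpow hc0 hr, ← Real.rpow_mul (hS0 ω), one_div_mul_cancel hp0.ne', Real.rpow_one]
  change (∫⁻ ω, ‖c * (∑ k ∈ translations A T j, D k ω) ^ (1 / p)‖ₑ ^ p ∂P) ^ (1 / p) ≤ _
  simp only [e1]
  rw [← ofReal_integral_eq_lintegral_ofReal (hint.const_mul _)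
    (ae_of_all _ fun ω => mul_nonneg (by positivity) (hS0 ω)), integral_const_mul,
    ENNReal.ofReal_rpow_of_nonneg
      (mul_nonneg (by positivity) (integral_nonneg fun ω => hS0 ω)) (by positivity)]
  refine ENNReal.ofReal_le_ofReal ?_
  have hcp : c = (c ^ p) ^ (1 / p) := by
    rw [← Real.rpow_mul hc0, mul_one_div_cancel hp0.ne', Real.rpow_one]
  have hQ : 0 ≤ 1 + τ ^ p + highMoment p n j₁ := by positivity
  calc (c ^ p * ∫ ω, ∑ k ∈ translations A T j, D k ω ∂P) ^ (1 / p)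
      ≤ (c ^ p * (levelConst A B T F p * (1 + τ ^ p + highMoment p n j₁) *
        ((n : ℝ) ^ (-(p / 2)) * (2 : ℝ) ^ l))) ^ (1 / p) := by
        refine Real.rpow_le_rpow (mul_nonneg (by positivity) (integral_nonneg fun ω => hS0 ω)) ?_
          (by positivity)
        gcongr
    _ = c * (levelConst A B T F p ^ (1 / p) * (1 + τ ^ p + highMoment p n j₁) ^ (1 / p) *
        (((n : ℝ) ^ (-(p / 2))) ^ (1 / p) * ((2 : ℝ) ^ l) ^ (1 / p))) := by
        rw [Real.mul_rpow (by positivity) (by positivity), ← hcp,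
          Real.mul_rpow (by positivity) (by positivity), Real.mul_rpow hLC hQ,
          Real.mul_rpow (by positivity) (by positivity)]
    _ = _ := by
        have e2 : ((n : ℝ) ^ (-(p / 2))) ^ (1 / p) = (n : ℝ) ^ (-(1 / 2) : ℝ) := by
          rw [← Real.rpow_mul hn0.le]
          congr 1
          field_simp
        have e3 : (2 : ℝ) ^ ((l : ℝ) * (1 / 2 - 1 / p)) * ((2 : ℝ) ^ l) ^ (1 / p) =
            (2 : ℝ) ^ ((l : ℝ) / 2) := by
          rw [← Real.rpow_natCast, ← Real.rpow_mul two_pos.le, ← Real.rpow_add two_pos]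
          congr 1
          ring
        rw [e2, hc, stochConst, ← e3]
        ring

/-- The risk of the linear estimator: approximation error and stochastic error. -/
lemma linRisk_le (hφ : IsAtom A B φ) (hψ : IsAtom A B ψ) (hm : GeneratesMRA φ)
    (hw : IsMotherWavelet φ ψ) (hs : 0 < s) (hp : 1 ≤ p) (hq : 1 ≤ q) (hL : 0 ≤ L) (hT : 0 ≤ T)
    (hn : 1 ≤ n) (hf : MemDensityClass φ ψ s p q L T f) (hF : 0 ≤ F)
    (hfF : eLpNorm f (ENNReal.ofReal p) volume ≤ ENNReal.ofReal F)
    (hsam : IsSample P f n (indexSet A T j₁) X W) {τ : ℝ}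
    (hτ : ∀ j : ℤ, |noiseLevel φ ψ A α j₁ j| ≤ τ) :
    linRisk P φ ψ A T α p j₁ n f X W ≤ ENNReal.ofReal
      ((biasConst A B s p L * (2 : ℝ) ^ (-(j₁ * s)) +
        stochConst A B T F p * (1 + τ ^ p + highMoment p n j₁) ^ (1 / p) *
          (n : ℝ) ^ (-(1 / 2) : ℝ) * (geomConst * (2 : ℝ) ^ ((j₁ : ℝ) / 2))) ^ p) := by
  have hp0 : 0 < p := by linarith
  have hp1 : (1 : ℝ≥0∞) ≤ ENNReal.ofReal p := by
    rw [← ENNReal.ofReal_one]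
    exact ENNReal.ofReal_le_ofReal hp
  have hA := hφ.nonneg
  have hB := hφ.bound_nonneg
  have hSc := synthConst_nonneg hA hB p
  have hBc := biasConst_nonneg (p := p) hA hB hs hL
  have hLC := levelConst_nonneg (F := F) hA hB hT hp
  have hH := highMoment_nonneg p n j₁
  have hτ0 : 0 ≤ τ := (abs_nonneg _).trans (hτ 0)
  have hst : 0 ≤ stochConst A B T F p := by
    unfold stochConst
    positivity
  have hgc := geomConst_nonneg
  set bias := biasConst A B s p L * (2 : ℝ) ^ (-(j₁ * s))
  have hbias : 0 ≤ bias := by positivity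
  set U : ℤ → Ω → ℝ := fun j ω => synthConst A B p * (2 : ℝ) ^ ((j.toNat : ℝ) * (1 / 2 - 1 / p)) *
        (∑ k ∈ translations A T j, |coeffError φ ψ A α j₁ n f X W j k ω| ^ p) ^ (1 / p)
  have hU0 : ∀ j ω, 0 ≤ U j ω := fun j ω => by positivity
  have hU := fun j hj => eLpNorm_levelError_le hφ hψ hT hn hp hf hF hfF hsam (j := j) hj (hτ j)
  -- `V` dominates the loss for every `ω`, so the second Minkowski inequality is applied to `V`, and
  -- measurability of the loss in `ω` is never needed.
  set V : Ω → ℝ := (fun _ => bias) + ∑ j ∈ Finset.Icc (-1 : ℤ) j₁, U j with hV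
  have hV0 : ∀ ω, 0 ≤ V ω := fun ω => by
    rw [hV, Pi.add_apply, Finset.sum_apply]
    exact add_nonneg hbias (Finset.sum_nonneg fun j _ => hU0 j ω)
  have hrisk : linRisk P φ ψ A T α p j₁ n f X W ≤ eLpNorm V (ENNReal.ofReal p) P ^ p := by
    rw [eLpNorm_eq_lintegral_rpow_enorm_toReal (by simpa using hp0) ENNReal.ofReal_ne_top,
      ENNReal.toReal_ofReal hp0.le, ← ENNReal.rpow_mul, one_div_mul_cancel hp0.ne',
      ENNReal.rpow_one, linRisk]
    refine lintegral_mono fun ω => ENNReal.rpow_le_rpow ?_ hp0.le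
    refine (eLpNorm_linEstimator_sub_le hφ hψ hm hw hs hp hq hL hf ω).trans ?_
    rw [Real.enorm_eq_ofReal (hV0 ω), hV, Pi.add_apply, Finset.sum_apply]
  refine hrisk.trans ?_
  rw [← ENNReal.ofReal_rpow_of_nonneg (by positivity) hp0.le]
  refine ENNReal.rpow_le_rpow ?_ hp0.le
  refine (eLpNorm_add_le aestronglyMeasurable_const
    (Finset.aestronglyMeasurable_sum _ fun j hj => (hU j hj).1) hp1).trans ?_
  rw [ENNReal.ofReal_add hbias (by positivity)]
  refine add_le_add ?_ ?_
  · rw [eLpNorm_const _ (by simpa using hp0) (IsProbabilityMeasure.ne_zero P), measure_univ,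
      ENNReal.one_rpow, mul_one, Real.enorm_eq_ofReal hbias]
  · refine (eLpNorm_sum_le (fun j hj => (hU j hj).1) hp1).trans ?_
    refine (Finset.sum_le_sum fun j hj => (hU j hj).2).trans ?_
    rw [← ENNReal.ofReal_sum_of_nonneg fun j _ => by positivity, ← Finset.mul_sum]
    refine ENNReal.ofReal_le_ofReal ?_
    gcongr
    exact sum_two_rpow_half_le j₁

end Sample

end

/-! ### Rates -/

/-- The constant in `abs_noiseLevel_le`. -/
noncomputable def noiseConst (φ ψ : ℝ → ℝ) (A : ℝ) : ℝ :=
  |4 * (2 * (⌈A⌉ : ℝ) + 1)| * supNorm φ +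
    |4 * (2 * (⌈A⌉ : ℝ) + 1)| * supNorm ψ * (√2 / (√2 - 1))

lemma supNorm_nonneg (g : ℝ → ℝ) : 0 ≤ supNorm g := ENNReal.toReal_nonneg

lemma noiseConst_nonneg (φ ψ : ℝ → ℝ) (A : ℝ) : 0 ≤ noiseConst φ ψ A := by
  have h1 := supNorm_nonneg φ
  have h2 := supNorm_nonneg ψ
  have h3 : 0 < √2 - 1 := by linarith [one_lt_sqrt_two]
  unfold noiseConst
  positivity

/-- One bound for all levels: the noise at level `-1` lacks the factor `2^{j₁/2} ≥ 1`. -/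
lemma abs_noiseLevel_le (φ ψ : ℝ → ℝ) (A : ℝ) {α : ℝ} (hα : 0 < α) (j₁ : ℕ) (j : ℤ) :
    |noiseLevel φ ψ A α j₁ j| ≤ noiseConst φ ψ A * ((2 : ℝ) ^ ((j₁ : ℝ) / 2) / α) := by
  have h1 := supNorm_nonneg φ
  have h2 := supNorm_nonneg ψ
  have h3 : 0 < √2 - 1 := by linarith [one_lt_sqrt_two]
  have h4 : (1 : ℝ) ≤ (2 : ℝ) ^ ((j₁ : ℝ) / 2) := Real.one_le_rpow one_le_two (by positivity)
  unfold noiseLevel noiseConst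
  set c := 4 * (2 * (⌈A⌉ : ℝ) + 1)
  have hc : 0 ≤ |c| := abs_nonneg c
  split_ifs
  · rw [abs_div, abs_mul, abs_of_nonneg h1, abs_of_pos hα]
    calc |c| * supNorm φ / α = |c| * supNorm φ * (1 / α) := by ring
      _ ≤ _ := by
        gcongr
        exact le_add_of_nonneg_right (by positivity)
  · rw [abs_mul, abs_mul, abs_div, abs_mul, abs_of_nonneg h2, abs_of_pos hα,
      abs_of_pos (by positivity : 0 < √2 / (√2 - 1)),
      abs_of_pos (by positivity : 0 < (2 : ℝ) ^ ((j₁ : ℝ) / 2))]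
    calc _ = |c| * supNorm ψ * (√2 / (√2 - 1)) * ((2 : ℝ) ^ ((j₁ : ℝ) / 2) / α) := by ring
      _ ≤ _ := by
        gcongr
        exact le_add_of_nonneg_left (by positivity)

/-- The privacy rate is the classical rate `(2^{j₁}/n)^{p/2}` inflated by the power `p` of the noise
level `2^{j₁/2}/α`. -/
lemma noise_rate_eq {p α : ℝ} (hα : 0 < α) (n j₁ : ℕ) :
    ((2 : ℝ) ^ ((j₁ : ℝ) / 2) / α) ^ p * ((2 : ℝ) ^ j₁ / n) ^ (p / 2) =
      ((2 : ℝ) ^ (2 * j₁) / (n * α ^ 2)) ^ (p / 2) := by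
  have e : ((2 : ℝ) ^ ((j₁ : ℝ) / 2) / α) ^ p =
      (((2 : ℝ) ^ ((j₁ : ℝ) / 2) / α) ^ 2) ^ (p / 2) := by
    rw [← Real.rpow_natCast, ← Real.rpow_mul (by positivity)]
    congr 1
    push_cast
    ring
  have e2 : ((2 : ℝ) ^ ((j₁ : ℝ) / 2)) ^ 2 = 2 ^ j₁ := by
    rw [← Real.rpow_natCast, ← Real.rpow_mul two_pos.le, ← Real.rpow_natCast]
    congr 1
    push_cast
    ring
  rw [e, ← Real.mul_rpow (by positivity) (by positivity), div_pow, e2]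
  congr 1
  rw [two_mul, pow_add]
  rw [div_mul_div_comm, mul_comm (α ^ 2)]

/-- After division by `(2^{j₁}/n)^{p/2}` there are three cases. For `p ≤ 2` the left side is `0`. If
`2^{j₁} ≤ κ n`, it is at most `κ^{p/2-1}`. If `α ≤ κ`, it is at most `2^{j₁p/2} ≤ (κ 2^{j₁/2}/α)^p`,
the inflation due to the noise. -/
lemma highMoment_mul_le {p α κ : ℝ} (hα : 0 < α) (hκ : 0 < κ) {n j₁ : ℕ} (hn : 1 ≤ n)
    (h : p ≤ 2 ∨ (2 : ℝ) ^ j₁ ≤ κ * n ∨ α ≤ κ) :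
    highMoment p n j₁ * ((2 : ℝ) ^ j₁ / n) ^ (p / 2) ≤
      κ ^ (p / 2 - 1) * ((2 : ℝ) ^ j₁ / n) ^ (p / 2) +
        κ ^ p * ((2 : ℝ) ^ (2 * j₁) / (n * α ^ 2)) ^ (p / 2) := by
  have hn1 : (1 : ℝ) ≤ n := by exact_mod_cast hn
  have hn0 : (0 : ℝ) < n := by linarith
  rw [← noise_rate_eq hα, ← mul_assoc, ← add_mul]
  refine mul_le_mul_of_nonneg_right ?_ (by positivity)
  unfold highMoment
  split_ifs with hp
  · positivity
  · push Not at hp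
    rcases h with h | h | h
    · linarith
    · refine le_add_of_le_of_nonneg ?_ (by positivity)
      refine Real.rpow_le_rpow (by positivity) ?_ (by linarith)
      rwa [div_le_iff₀ hn0]
    · refine le_add_of_nonneg_of_le (by positivity) ?_
      have h1 : (1 : ℝ) ≤ 2 ^ j₁ := one_le_pow₀ one_le_two
      calc ((2 : ℝ) ^ j₁ / n) ^ (p / 2 - 1) ≤ ((2 : ℝ) ^ j₁) ^ (p / 2 - 1) :=
            Real.rpow_le_rpow (by positivity) (div_le_self (by positivity) hn1) (by linarith)
        _ ≤ ((2 : ℝ) ^ j₁) ^ (p / 2) := Real.rpow_le_rpow_of_exponent_le h1 (by linarith)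
        _ = ((2 : ℝ) ^ ((j₁ : ℝ) / 2)) ^ p := by
            rw [← Real.rpow_natCast, ← Real.rpow_mul two_pos.le, ← Real.rpow_mul two_pos.le]
            ring_nf
        _ ≤ (κ * ((2 : ℝ) ^ ((j₁ : ℝ) / 2) / α)) ^ p := by
            refine Real.rpow_le_rpow (by positivity) ?_ (by linarith)
            rw [mul_div_assoc', le_div_iff₀ hα, mul_comm]
            gcongr
        _ = _ := Real.mul_rpow hκ.le (by positivity)

/-- The constant in `risk_bound_le`. -/
noncomputable def rateConst (p κ b c t : ℝ) : ℝ :=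
  2 ^ p * (b ^ p + c ^ p * (1 + κ ^ (p / 2 - 1) + t ^ p + κ ^ p)) + 1

lemma risk_bound_le {p s α κ b c t : ℝ} (hp : 1 ≤ p) (hα : 0 < α) (hκ : 0 < κ) (hb : 0 ≤ b)
    (hc : 0 ≤ c) (ht : 0 ≤ t) {n j₁ : ℕ} (hn : 1 ≤ n)
    (h : p ≤ 2 ∨ (2 : ℝ) ^ j₁ ≤ κ * n ∨ α ≤ κ) :
    (b * (2 : ℝ) ^ (-(j₁ * s)) +
      c * ((1 + (t * ((2 : ℝ) ^ ((j₁ : ℝ) / 2) / α)) ^ p + highMoment p n j₁) ^ (1 / p) *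
        ((n : ℝ) ^ (-(1 / 2) : ℝ) * (2 : ℝ) ^ ((j₁ : ℝ) / 2)))) ^ p ≤
      rateConst p κ b c t * ((2 : ℝ) ^ (-((j₁ : ℝ) * p * s))
        + ((2 : ℝ) ^ (2 * j₁) / (n * α ^ 2)) ^ (p / 2) + ((2 : ℝ) ^ j₁ / n) ^ (p / 2)) := by
  have hp0 : 0 < p := by linarith
  have hn0 : (0 : ℝ) < n := by exact_mod_cast hn
  have hH := highMoment_nonneg p n j₁
  have hHm := highMoment_mul_le hα hκ hn h
  have hrate := noise_rate_eq (p := p) hα n j₁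
  set t1 := ((2 : ℝ) ^ (2 * j₁) / (n * α ^ 2)) ^ (p / 2)
  have et2 : ((n : ℝ) ^ (-(1 / 2) : ℝ) * (2 : ℝ) ^ ((j₁ : ℝ) / 2)) ^ p =
      ((2 : ℝ) ^ j₁ / n) ^ (p / 2) := by
    rw [Real.mul_rpow (by positivity) (by positivity), Real.div_rpow (by positivity) hn0.le,
      ← Real.rpow_mul hn0.le, ← Real.rpow_mul two_pos.le, ← Real.rpow_natCast,
      ← Real.rpow_mul two_pos.le, div_eq_mul_inv ((2 : ℝ) ^ ((j₁ : ℝ) * (p / 2))),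
      ← Real.rpow_neg hn0.le, mul_comm]
    ring_nf
  have eu : ((2 : ℝ) ^ (-(j₁ * s))) ^ p = (2 : ℝ) ^ (-((j₁ : ℝ) * p * s)) := by
    rw [← Real.rpow_mul two_pos.le]
    ring_nf
  set Q := 1 + (t * ((2 : ℝ) ^ ((j₁ : ℝ) / 2) / α)) ^ p + highMoment p n j₁ with hQ
  have hQ0 : 0 ≤ Q := by positivity
  have eQ : (Q ^ (1 / p)) ^ p = Q := by
    rw [← Real.rpow_mul hQ0, one_div_mul_cancel hp0.ne', Real.rpow_one]
  refine (add_rpow_le_two_rpow_mul (by positivity) (by positivity) hp0.le).trans ?_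
  rw [Real.mul_rpow hb (by positivity), Real.mul_rpow hc (by positivity),
    Real.mul_rpow (Real.rpow_nonneg hQ0 _) (by positivity), eQ, et2, eu]
  set t2 := ((2 : ℝ) ^ j₁ / n) ^ (p / 2)
  set t0 := (2 : ℝ) ^ (-((j₁ : ℝ) * p * s))
  have ht0 : 0 ≤ t0 := by positivity
  have ht1 : 0 ≤ t1 := by positivity
  have ht2 : 0 ≤ t2 := by positivity
  have hκ1 : 0 ≤ κ ^ (p / 2 - 1) := by positivity
  have hκ2 : 0 ≤ κ ^ p := by positivity
  have htp : 0 ≤ t ^ p := by positivity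
  have hQt : Q * t2 ≤ (1 + κ ^ (p / 2 - 1) + t ^ p + κ ^ p) * (t0 + t1 + t2) := by
    have e1 : (t * ((2 : ℝ) ^ ((j₁ : ℝ) / 2) / α)) ^ p * t2 = t ^ p * t1 := by
      rw [Real.mul_rpow ht (by positivity), mul_assoc, hrate]
    calc Q * t2 = t2 + (t * ((2 : ℝ) ^ ((j₁ : ℝ) / 2) / α)) ^ p * t2 + highMoment p n j₁ * t2 := by
          rw [hQ]
          ring
      _ ≤ t2 + t ^ p * t1 + (κ ^ (p / 2 - 1) * t2 + κ ^ p * t1) := by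
          rw [e1]
          gcongr
      _ = 1 * t2 + κ ^ (p / 2 - 1) * t2 + t ^ p * t1 + κ ^ p * t1 := by ring
      _ ≤ 1 * (t0 + t1 + t2) + κ ^ (p / 2 - 1) * (t0 + t1 + t2) + t ^ p * (t0 + t1 + t2) +
          κ ^ p * (t0 + t1 + t2) := by gcongr <;> linarith
      _ = _ := by ring
  have hbp : 0 ≤ b ^ p := by positivity
  have hcp : 0 ≤ c ^ p := by positivity
  calc 2 ^ p * (b ^ p * t0 + c ^ p * (Q * t2))
      ≤ 2 ^ p * (b ^ p * (t0 + t1 + t2) +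
        c ^ p * ((1 + κ ^ (p / 2 - 1) + t ^ p + κ ^ p) * (t0 + t1 + t2))) := by
        gcongr
        linarith
    -- The summand `1` in `rateConst` only ensures that the final constant is positive.
    _ = (rateConst p κ b c t - 1) * (t0 + t1 + t2) := by
        rw [rateConst]
        ring
    _ ≤ _ := by
        gcongr
        linarith

lemma SupRiskLE.mono {φ ψ : ℝ → ℝ} {A s p : ℝ} {q : ℝ≥0∞} {L T : ℝ} {n : ℕ} {α : ℝ} {j₁ : ℕ}
    {C C' : ℝ} (h : SupRiskLE.{u} φ ψ A s p q L T n α j₁ C) (hC : C ≤ C') :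
    SupRiskLE.{u} φ ψ A s p q L T n α j₁ C' := fun f hf Ω _ P _ X W hs =>
  (h f hf Ω P X W hs).trans (ENNReal.ofReal_le_ofReal hC)

theorem exists_supRiskLE {φ ψ : ℝ → ℝ} {A : ℝ} {N : ℕ} {s p : ℝ} {q : ℝ≥0∞} {L T : ℝ}
    (hs : 0 < s) (hp : 1 ≤ p) (hq : 1 ≤ q) (hL : 0 < L) (hT : 0 < T)
    (hφ : FatherAssumption φ N) (hψ : IsMotherWavelet φ ψ)
    (hφA : Function.support φ ⊆ Icc (-A) A) (hψA : Function.support ψ ⊆ Icc (-A) A)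
    {κ : ℝ} (hκ : 0 < κ) : ∃ C : ℝ, 0 < C ∧ ∀ (n : ℕ) (α : ℝ) (j₁ : ℕ), 1 ≤ n → 0 < α →
      (p ≤ 2 ∨ (2 : ℝ) ^ j₁ ≤ κ * n ∨ α ≤ κ) →
      SupRiskLE.{u} φ ψ A s p q L T n α j₁
        (C * ((2 : ℝ) ^ (-((j₁ : ℝ) * p * s))
          + ((2 : ℝ) ^ (2 * j₁) / (n * α ^ 2)) ^ (p / 2)
          + ((2 : ℝ) ^ j₁ / n) ^ (p / 2))) := by
  obtain ⟨B₁, hB₁⟩ := hφ.exists_isAtom hφA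
  obtain ⟨B₂, hB₂⟩ := hψ.exists_isAtom hB₁ hφ.mra.orthonormal hψA
  have h1 : IsAtom A (max B₁ B₂) φ := hB₁.mono (le_max_left _ _)
  have h2 : IsAtom A (max B₁ B₂) ψ := hB₂.mono (le_max_right _ _)
  set B := max B₁ B₂
  have hA := h1.nonneg
  have hB := h1.bound_nonneg
  have hSc := synthConst_nonneg hA hB p
  have hb := biasConst_nonneg (p := p) hA hB hs hL.le
  -- `F` bounds the `L^p` norm of every density of the class, so the constants do not depend on `f`.
  set F := biasConst A B s p L + synthConst A B p * L
  have hF : 0 ≤ F := by positivity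
  have hst : 0 ≤ stochConst A B T F p :=
    mul_nonneg hSc (Real.rpow_nonneg (levelConst_nonneg hA hB hT.le hp) _)
  have hg := geomConst_nonneg
  have hN := noiseConst_nonneg φ ψ A
  have hc : 0 ≤ stochConst A B T F p * geomConst := by positivity
  refine ⟨rateConst p κ (biasConst A B s p L) (stochConst A B T F p * geomConst)
    (noiseConst φ ψ A), ?_, fun n α j₁ hn hα h f hf Ω _ P _ X W hsam => ?_⟩
  · unfold rateConst
    positivity
  · refine (linRisk_le h1 h2 hφ.mra hψ hs hp hq hL.le hT.le hn hf hF
      (eLpNorm_density_le h1 h2 hφ.mra hψ hs hp hq hL.le hf) hsam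
      (abs_noiseLevel_le φ ψ A hα j₁)).trans (ENNReal.ofReal_le_ofReal ?_)
    refine le_trans (le_of_eq ?_) (risk_bound_le hp hα hκ hb hc hN hn h)
    ring_nf

/-- To be used with `x = nα²`, `y = n`, `z = 2^{j₁}`. The numbers `u` and `v` of the proof balance
the bias against each of the stochastic terms, since `u²/x = u^{-2s}` and `v/y = v^{-2s}`. The lower
bound on `z` controls the bias, which gives the maximum; the upper bound controls the two stochastic
terms separately. -/
lemma rate_terms_le {s p c₁ c₂ x y z : ℝ} (hs : 0 < s) (hp : 1 ≤ p) (hc₁ : 0 < c₁) (hc₂ : 0 < c₂)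
    (hx : 0 < x) (hy : 0 < y) (hz : 0 < z)
    (h₁ : c₁ * min (x ^ (1 / (2 * s + 2))) (y ^ (1 / (2 * s + 1))) ≤ z)
    (h₂ : z ≤ c₂ * min (x ^ (1 / (2 * s + 2))) (y ^ (1 / (2 * s + 1)))) :
    z ^ (-(p * s)) + (z ^ 2 / x) ^ (p / 2) + (z / y) ^ (p / 2) ≤
      (c₁ ^ (-(p * s)) + c₂ ^ p + c₂ ^ (p / 2)) *
        max (x ^ (-(p * s / (2 * s + 2)))) (y ^ (-(p * s / (2 * s + 1)))) := by
  have hp0 : 0 < p := by linarith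
  set u := x ^ (1 / (2 * s + 2)) with hu
  set v := y ^ (1 / (2 * s + 1)) with hv
  have hu0 : 0 < u := Real.rpow_pos_of_pos hx _
  have hv0 : 0 < v := Real.rpow_pos_of_pos hy _
  have eu : u ^ (-(p * s)) = x ^ (-(p * s / (2 * s + 2))) := by
    rw [hu, ← Real.rpow_mul hx.le]
    ring_nf
  have ev : v ^ (-(p * s)) = y ^ (-(p * s / (2 * s + 1))) := by
    rw [hv, ← Real.rpow_mul hy.le]
    ring_nf
  have exu : x = u ^ (2 * s + 2) := by
    rw [hu, ← Real.rpow_mul hx.le, one_div_mul_cancel (by positivity), Real.rpow_one]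
  have eyv : y = v ^ (2 * s + 1) := by
    rw [hv, ← Real.rpow_mul hy.le, one_div_mul_cancel (by positivity), Real.rpow_one]
  rw [← eu, ← ev]
  have hzu : z ≤ c₂ * u := h₂.trans (by gcongr; exact min_le_left _ _)
  have hzv : z ≤ c₂ * v := h₂.trans (by gcongr; exact min_le_right _ _)
  set M := max (u ^ (-(p * s))) (v ^ (-(p * s)))
  have hps : -(p * s) ≤ 0 := by
    have : 0 < p * s := by positivity
    linarith
  have t0 : z ^ (-(p * s)) ≤ c₁ ^ (-(p * s)) * M := by
    have hm0 : 0 < min u v := lt_min hu0 hv0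
    calc z ^ (-(p * s)) ≤ (c₁ * min u v) ^ (-(p * s)) :=
          Real.rpow_le_rpow_of_nonpos (by positivity) h₁ hps
      _ = c₁ ^ (-(p * s)) * (min u v) ^ (-(p * s)) := Real.mul_rpow hc₁.le hm0.le
      _ ≤ _ := by
          gcongr
          rcases min_cases u v with ⟨h, -⟩ | ⟨h, -⟩ <;> rw [h]
          exacts [le_max_left _ _, le_max_right _ _]
  have t1 : (z ^ 2 / x) ^ (p / 2) ≤ c₂ ^ p * M := by
    calc (z ^ 2 / x) ^ (p / 2) ≤ ((c₂ * u) ^ 2 / x) ^ (p / 2) := by gcongr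
      _ = (c₂ ^ (2 : ℝ) * u ^ (-(2 * s))) ^ (p / 2) := by
          congr 1
          rw [exu, mul_pow, mul_div_assoc, ← Real.rpow_natCast, ← Real.rpow_natCast,
            ← Real.rpow_sub hu0]
          push_cast
          ring_nf
      _ = c₂ ^ p * u ^ (-(p * s)) := by
          rw [Real.mul_rpow (by positivity) (by positivity), ← Real.rpow_mul hc₂.le,
            ← Real.rpow_mul hu0.le]
          ring_nf
      _ ≤ _ := by
          gcongr
          exact le_max_left _ _
  have t2 : (z / y) ^ (p / 2) ≤ c₂ ^ (p / 2) * M := by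
    calc (z / y) ^ (p / 2) ≤ (c₂ * v / y) ^ (p / 2) := by gcongr
      _ = (c₂ * v ^ (-(2 * s))) ^ (p / 2) := by
          congr 1
          rw [eyv, mul_div_assoc]
          congr 1
          nth_rewrite 1 [← Real.rpow_one v]
          rw [← Real.rpow_sub hv0]
          ring_nf
      _ = c₂ ^ (p / 2) * v ^ (-(p * s)) := by
          rw [Real.mul_rpow (by positivity) (by positivity), ← Real.rpow_mul hv0.le]
          ring_nf
      _ ≤ _ := by
          gcongr
          exact le_max_right _ _
  linarith

end LDPWavelet

theorem proposition4p1 (φ ψ : ℝ → ℝ) (A : ℝ) (N : ℕ) (s p : ℝ) (q : ℝ≥0∞) (L T : ℝ)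
    (hs : 0 < s) (hsN : s < N + 1) (hp : 1 ≤ p) (hq : 1 ≤ q) (hL : 0 < L) (hT : 0 < T)
    (hφ : LDPWavelet.FatherAssumption φ N) (hψ : LDPWavelet.IsMotherWavelet φ ψ)
    (hφA : Function.support φ ⊆ Icc (-A) A) (hψA : Function.support ψ ⊆ Icc (-A) A) :
    (∀ κ : ℝ, 0 < κ → ∃ C : ℝ, 0 < C ∧ ∀ (n : ℕ) (α : ℝ) (j₁ : ℕ), 1 ≤ n → 0 < α →
      (p ≤ 2 ∨ (2 : ℝ) ^ j₁ ≤ κ * n ∨ α ≤ κ) →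
      LDPWavelet.SupRiskLE.{u} φ ψ A s p q L T n α j₁
        (C * ((2 : ℝ) ^ (-((j₁ : ℝ) * p * s))
          + ((2 : ℝ) ^ (2 * j₁) / (n * α ^ 2)) ^ (p / 2)
          + ((2 : ℝ) ^ j₁ / n) ^ (p / 2)))) ∧
    (∀ c₁ c₂ : ℝ, 0 < c₁ → 0 < c₂ → ∃ C : ℝ, 0 < C ∧
      ∀ (n : ℕ) (α : ℝ) (j₁ : ℕ), 1 ≤ n → 0 < α →
      c₁ * min ((n * α ^ 2) ^ (1 / (2 * s + 2))) ((n : ℝ) ^ (1 / (2 * s + 1))) ≤ (2 : ℝ) ^ j₁ →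
      (2 : ℝ) ^ j₁ ≤ c₂ * min ((n * α ^ 2) ^ (1 / (2 * s + 2))) ((n : ℝ) ^ (1 / (2 * s + 1))) →
      LDPWavelet.SupRiskLE.{u} φ ψ A s p q L T n α j₁
        (C * max ((n * α ^ 2) ^ (-(p * s / (2 * s + 2)))) ((n : ℝ) ^ (-(p * s / (2 * s + 1)))))) := by
  refine ⟨fun κ hκ => LDPWavelet.exists_supRiskLE hs hp hq hL hT hφ hψ hφA hψA hκ,
    fun c₁ c₂ hc₁ hc₂ => ?_⟩
  obtain ⟨C, hC, hbound⟩ :=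
    LDPWavelet.exists_supRiskLE.{u} (q := q) hs hp hq hL hT hφ hψ hφA hψA hc₂
  refine ⟨C * (c₁ ^ (-(p * s)) + c₂ ^ p + c₂ ^ (p / 2)), by positivity,
    fun n α j₁ hn hα h₁ h₂ => ?_⟩
  have hn1 : (1 : ℝ) ≤ n := by exact_mod_cast hn
  have hn0 : (0 : ℝ) < n := by linarith
  -- As `1/(2s+1) ≤ 1` and `n ≥ 1`, the upper bound on `2^{j₁}` is at most `c₂ n`, which is the
  -- second alternative in (i) with `κ = c₂`.
  have hκ : (2 : ℝ) ^ j₁ ≤ c₂ * n := by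
    refine h₂.trans ?_
    gcongr
    refine (min_le_right _ _).trans ?_
    refine (Real.rpow_le_rpow_of_exponent_le hn1 (?_ : _ ≤ (1 : ℝ))).trans_eq (Real.rpow_one _)
    rw [div_le_one (by positivity)]
    linarith
  refine (hbound n α j₁ hn hα (Or.inr (Or.inl hκ))).mono ?_
  rw [mul_assoc C]
  refine mul_le_mul_of_nonneg_left ?_ hC.le
  have h := LDPWavelet.rate_terms_le hs hp hc₁ hc₂ (by positivity) hn0 (by positivity) h₁ h₂
  have e0 : (2 : ℝ) ^ (-((j₁ : ℝ) * p * s)) = ((2 : ℝ) ^ j₁) ^ (-(p * s)) := by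
    rw [← Real.rpow_natCast, ← Real.rpow_mul two_pos.le]
    ring_nf
  have e1 : (2 : ℝ) ^ (2 * j₁) = ((2 : ℝ) ^ j₁) ^ 2 := by
    rw [← pow_mul, mul_comm]
  rw [e0, e1]
  exact h
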